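/- Let $\alpha\in[0,1)$ be irrational. Let $C(\mathbb T^2_\alpha)$ be the universal $C^*$-algebra generated by two unitaries $u_\alpha,v_\alpha$ with $u_\alpha v_\alpha=e^{2\pi i\alpha}v_\alpha u_\alpha$, let $\tau_\alpha$ be its tracial state with $\tau_\alpha(u_\alpha^n v_\alpha^m)=\delta_{n0}\delta_{m0}$, and let $R=C(\mathbb T^2_\alpha)''$ in the GNS representation of $\tau_\alpha$, with $\tau_R$ the extension of $\tau_\alpha$ to $R$ as the vector state of the GNS cyclic vector. Put $D_\alpha=\{u_\alpha\}''$ and $C_\alpha=\{v_\alpha\}''$, let $\theta_\alpha:D_\alpha\to C_\alpha$ be the normal $*$-isomorphism with $\theta_\alpha(u_\alpha)=v_\alpha$, and let $E_{D_\alpha}:R\to D_\alpha$, $E_{C_\alpha}:R\to C_\alpha$ be the $\tau_R$-preserving faithful normal conditional expectations. The (reduced) HNN extension $(M_\alpha,E)$ of $R$ by $\theta_\alpha$ with respect to $E_{D_\alpha}$, $E_{C_\alpha}$ is the von Neumann algebra $M_\alpha$, unique up to isomorphism, that contains $R$ as a von Neumann subalgebra, is generated by $R$ and a unitary $u(\alpha)$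 with $u(\alpha)\,\theta_\alpha(d)\,u(\alpha)^*=d$ for all $d\in D_\alpha$, and has a faithful normal conditional expectation $E:M_\alpha\to R$ such that $E(w)=0$ for every reduced word $$w=u(\alpha)^{\varepsilon_0}n_1u(\alpha)^{\varepsilon_1}n_2\cdots n_\ell u(\alpha)^{\varepsilon_\ell}\qquad(\ell\ge 0,\ n_j\in R,\ \varepsilon_j\in\{1,-1\}),$$ that is, one in which $E_{C_\alpha}(n_j)=0$ whenever $\varepsilon_{j-1}=1,\ \varepsilon_j=-1$, and $E_{D_\alpha}(n_j)=0$ whenever $\varepsilon_{j-1}=-1,\ \varepsilon_j=1$. Then such $\theta_\alpha$, $E_{D_\alpha}$, $E_{C_\alpha}$ and such an HNN extension exist, and every such $M_\alpha$ is a full factor of type II$_1$ generated, as a von Neumann algebra, by two Haar unitaries. More precisely, $M_\alpha$ is an infinite-dimensional factor; $\tau=\tau_R\circ E$ is a faithful normal tracial state on it; $M_\alpha'\cap M_\alpha^\omega=\mathbb C1$ for every free ultrafilter $\omega$ on $\mathbb N$, where $M_\alpha^\omega$ is the algebra of bounded sequences in $M_\alpha$ modulo those with $\lim_{n\to\omega}\tau(x_n^*x_n)=0$;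 and there are unitaries $a,b\in M_\alpha$ with $\tau(a^n)=\tau(b^n)=0$ for all integers $n\ne0$ and $\{a,b\}''=M_\alpha$. -/

import Mathlib

open scoped ENNReal InnerProductSpace ComplexOrder

noncomputable section

/-! ### Von Neumann algebras: generation, normality, states, conditional expectations -/

namespace VonNeumannAlgebra

section

variable {H : Type*} [NormedAddCommGroup H] [InnerProductSpace ℂ H] [CompleteSpace H]
variable {K : Type*} [NormedAddCommGroup K] [InnerProductSpace ℂ K] [CompleteSpace K]

/-- The von Neumann algebra `(S ∪ S*)''` generated by a set `S` of bounded operators. -/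
def generatedBy (S : Set (H →L[ℂ] H)) : VonNeumannAlgebra H where
  toStarSubalgebra :=
    StarSubalgebra.centralizer ℂ (StarSubalgebra.centralizer ℂ S : Set (H →L[ℂ] H))
  centralizer_centralizer' := by simp

theorem coe_generatedBy (S : Set (H →L[ℂ] H)) :
    (generatedBy S : Set (H →L[ℂ] H)) =
      Set.centralizer (Set.centralizer (S ∪ star S)) := by
  have h : (generatedBy S : Set (H →L[ℂ] H)) =
      (StarSubalgebra.centralizer ℂ (StarSubalgebra.centralizer ℂ S : Set (H →L[ℂ] H)) :
        Set (H →L[ℂ] H)) := rfl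
  rw [h]
  exact StarSubalgebra.coe_centralizer_centralizer ℂ S

theorem subset_generatedBy (S : Set (H →L[ℂ] H)) : S ⊆ generatedBy S := by
  rw [coe_generatedBy]
  exact Set.subset_union_left.trans Set.subset_centralizer_centralizer

theorem generatedBy_mono {S T : Set (H →L[ℂ] H)} (h : S ⊆ T) :
    generatedBy S ≤ generatedBy T := by
  rw [← SetLike.coe_subset_coe, coe_generatedBy, coe_generatedBy]
  exact Set.centralizer_subset (Set.centralizer_subset
    (Set.union_subset_union h (Set.star_subset_star.mpr h)))

/-- A functional on `N ⊆ B(H)` is `σ`-weakly continuous if it is of the form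
`x ↦ ∑ₙ ⟨aₙ, x bₙ⟩` with `∑ₙ ‖aₙ‖² < ∞` and `∑ₙ ‖bₙ‖² < ∞`. -/
def IsSigmaWeaklyContinuous (N : VonNeumannAlgebra H) (f : N.toStarSubalgebra → ℂ) : Prop :=
  ∃ a b : ℕ → H, Summable (fun n => ‖a n‖ ^ 2) ∧ Summable (fun n => ‖b n‖ ^ 2) ∧
    ∀ x : N.toStarSubalgebra,
      HasSum (fun n => ⟪a n, (x : H →L[ℂ] H) (b n)⟫_ℂ) (f x)

/-- Normality of a (positive linear) map between von Neumann algebras: every matrix coefficient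
is `σ`-weakly continuous. -/
def IsNormalMap (N : VonNeumannAlgebra H) (M : VonNeumannAlgebra K)
    (f : N.toStarSubalgebra → M.toStarSubalgebra) : Prop :=
  ∀ ξ η : K, IsSigmaWeaklyContinuous N (fun x => ⟪ξ, (f x : K →L[ℂ] K) η⟫_ℂ)

/-- Faithful normal tracial states. -/
structure IsFaithfulNormalTrace (M : VonNeumannAlgebra K)
    (τ : M.toStarSubalgebra →ₗ[ℂ] ℂ) : Prop where
  map_one : τ 1 = 1
  nonneg : ∀ x, 0 ≤ τ (star x * x)
  faithful : ∀ x, τ (star x * x) = 0 → x = 0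
  tracial : ∀ x y, τ (x * y) = τ (y * x)
  normal : IsSigmaWeaklyContinuous M τ

/-- `E : M → N` is a faithful normal conditional expectation of `M` onto its von Neumann
subalgebra `N`, where `N` is regarded as a subalgebra of `M` by the embedding `π`. -/
structure IsConditionalExpectation (M : VonNeumannAlgebra K) (N : VonNeumannAlgebra H)
    (π : N.toStarSubalgebra →⋆ₐ[ℂ] M.toStarSubalgebra)
    (E : M.toStarSubalgebra →ₗ[ℂ] N.toStarSubalgebra) : Prop where
  map_embedding : ∀ n, E (π n) = n
  bimodule : ∀ a x b, E (π a * x * π b) = a * E x * b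
  positive : ∀ x, (E (star x * x) : H →L[ℂ] H).IsPositive
  faithful : ∀ x, E (star x * x) = 0 → x = 0
  normal : IsNormalMap M N E

/-- `M` is a factor: its centre is `ℂ1`. -/
def IsFactor (M : VonNeumannAlgebra K) : Prop :=
  ∀ x ∈ M, x ∈ M.commutant → ∃ c : ℂ, x = c • (1 : K →L[ℂ] K)

/-- A factor of type II₁: an infinite-dimensional factor with a faithful normal tracial state. -/
def IsTypeII1Factor (M : VonNeumannAlgebra K) : Prop :=
  IsFactor M ∧ ¬ FiniteDimensional ℂ M.toStarSubalgebra ∧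
    ∃ τ : M.toStarSubalgebra →ₗ[ℂ] ℂ, IsFaithfulNormalTrace M τ

/-- The norm `‖x‖₂ = τ(x*x)^{1/2}` of a tracial state. -/
def norm2 (M : VonNeumannAlgebra K) (τ : M.toStarSubalgebra →ₗ[ℂ] ℂ)
    (x : M.toStarSubalgebra) : ℝ :=
  Real.sqrt (τ (star x * x)).re

/-- Fullness of a finite factor `M` with trace `τ`: `M' ∩ M^ω = ℂ1` for every free ultrafilter
`ω` on `ℕ`, where `M^ω` is the algebra of bounded sequences modulo those with
`lim_ω ‖xₙ‖₂ = 0`. -/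
def IsFull (M : VonNeumannAlgebra K) (τ : M.toStarSubalgebra →ₗ[ℂ] ℂ) : Prop :=
  ∀ ω : Ultrafilter ℕ, (ω : Filter ℕ) ≤ Filter.cofinite →
    ∀ x : ℕ → M.toStarSubalgebra, (∃ C : ℝ, ∀ n, ‖x n‖ ≤ C) →
      (∀ y : M.toStarSubalgebra,
        Filter.Tendsto (fun n => norm2 M τ (x n * y - y * x n)) ω (nhds 0)) →
      ∃ c : ℂ, Filter.Tendsto (fun n => norm2 M τ (x n - c • 1)) ω (nhds 0)

/-- A Haar unitary with respect to `τ`. -/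
def IsHaarUnitary (M : VonNeumannAlgebra K) (τ : M.toStarSubalgebra →ₗ[ℂ] ℂ)
    (w : unitary M.toStarSubalgebra) : Prop :=
  ∀ n : ℤ, n ≠ 0 → τ ((w ^ n : unitary M.toStarSubalgebra) : M.toStarSubalgebra) = 0

/-! ### HNN extensions -/

/-- `u^ε` for `ε = ±1`, with `true` standing for `+1` and `false` for `-1`. -/
def signPow {M : VonNeumannAlgebra K} (u : unitary M.toStarSubalgebra) :
    Bool → M.toStarSubalgebra
  | true => (u : M.toStarSubalgebra)
  | false => star (u : M.toStarSubalgebra)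

/-- The word `u^ε₀ π(n₁) u^ε₁ π(n₂) ⋯ π(nₗ) u^εₗ`, encoded by `ε₀` and the list of the pairs
`(nⱼ, εⱼ)`. -/
def hnnWord {N : VonNeumannAlgebra H} {M : VonNeumannAlgebra K}
    (π : N.toStarSubalgebra →⋆ₐ[ℂ] M.toStarSubalgebra) (u : unitary M.toStarSubalgebra) :
    Bool → List (N.toStarSubalgebra × Bool) → M.toStarSubalgebra
  | ε₀, [] => signPow u ε₀
  | ε₀, (n, ε) :: l => signPow u ε₀ * π n * hnnWord π u ε l

/-- Reduced words: between `u` and `u*` only elements of `ker E_{θ(D)}` occur, and between `u*`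
and `u` only elements of `ker E_D`. Here `C` is the range `θ(D)`. -/
def IsReducedWord {N D C : VonNeumannAlgebra H}
    (ED : N.toStarSubalgebra →ₗ[ℂ] D.toStarSubalgebra)
    (EC : N.toStarSubalgebra →ₗ[ℂ] C.toStarSubalgebra) :
    Bool → List (N.toStarSubalgebra × Bool) → Prop
  | _, [] => True
  | ε₀, (n, ε) :: l =>
    (ε₀ = true → ε = false → EC n = 0) ∧ (ε₀ = false → ε = true → ED n = 0) ∧
      IsReducedWord ED EC ε l

/-- `(M, E)`, with embedding `π : N → M` and stable unitary `u`, is the reduced HNN extension of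
`N` by the isomorphism `θ : D → C` of von Neumann subalgebras of `N`, with respect to the
conditional expectations `ED : N → D` and `EC : N → C = θ(D)`. These conditions determine
`(M, E, π, u)` up to isomorphism. -/
structure IsHNNExtension (N D C : VonNeumannAlgebra H)
    (hD : D.toStarSubalgebra ≤ N.toStarSubalgebra)
    (hC : C.toStarSubalgebra ≤ N.toStarSubalgebra)
    (θ : D.toStarSubalgebra ≃⋆ₐ[ℂ] C.toStarSubalgebra)
    (ED : N.toStarSubalgebra →ₗ[ℂ] D.toStarSubalgebra)
    (EC : N.toStarSubalgebra →ₗ[ℂ] C.toStarSubalgebra)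
    (M : VonNeumannAlgebra K)
    (π : N.toStarSubalgebra →⋆ₐ[ℂ] M.toStarSubalgebra)
    (u : unitary M.toStarSubalgebra)
    (E : M.toStarSubalgebra →ₗ[ℂ] N.toStarSubalgebra) : Prop where
  /-- the embedding is normal (it is injective, as `E` is a left inverse) -/
  normal : IsNormalMap N M π
  /-- `E` is a faithful normal conditional expectation onto `π(N)` -/
  condExp : IsConditionalExpectation M N π E
  /-- `M` is generated by `π(N)` and `u` -/
  generates : generatedBy
    (insert ((u : M.toStarSubalgebra) : K →L[ℂ] K)
      (Set.range fun n : N.toStarSubalgebra => (π n : K →L[ℂ] K))) = M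
  /-- `u π(θ(d)) u* = π(d)` for `d ∈ D` -/
  conj : ∀ d : D.toStarSubalgebra,
    (u : M.toStarSubalgebra) * π (StarSubalgebra.inclusion hC (θ d)) *
      star (u : M.toStarSubalgebra) = π (StarSubalgebra.inclusion hD d)
  /-- `E` vanishes on reduced words -/
  moment : ∀ (ε₀ : Bool) (l : List (N.toStarSubalgebra × Bool)),
    IsReducedWord ED EC ε₀ l → E (hnnWord π u ε₀ l) = 0

end

end VonNeumannAlgebra

/-! ### The non-commutative torus -/

namespace NCTorus

/-- The separable Hilbert space `ℓ²(ℤ²)`. -/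
abbrev L2 : Type := lp (fun _ : ℤ × ℤ => ℂ) 2

/-- `e^{2πiα}`. -/
def q (α : ℝ) : Circle := Circle.exp (2 * Real.pi * α)

/-- All pairs of unitaries on `ℓ²(ℤ²)` with `u v = e^{2πiα} v u`. -/
def Rep (α : ℝ) : Type :=
  {p : unitary (L2 →L[ℂ] L2) × unitary (L2 →L[ℂ] L2) //
    (p.1 : L2 →L[ℂ] L2) * (p.2 : L2 →L[ℂ] L2) =
      (q α : ℂ) • ((p.2 : L2 →L[ℂ] L2) * (p.1 : L2 →L[ℂ] L2))}

instance : Nontrivial L2 :=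
  ⟨⟨lp.single 2 (0, 0) 1, 0, fun h => by
    have := congrArg (fun f : L2 => f (0, 0)) h
    simp at this⟩⟩

/-- The bounded families of operators indexed by all such pairs. -/
abbrev Ambient (α : ℝ) : Type := lp (fun _ : Rep α => L2 →L[ℂ] L2) ∞

instance (α : ℝ) : CStarAlgebra (Ambient α) where

/-- The first unitary of every pair. -/
def ambientU (α : ℝ) : Ambient α :=
  ⟨fun p => (p.1.1 : L2 →L[ℂ] L2), memℓp_infty ⟨1, by
    rintro _ ⟨p, rfl⟩
    exact (CStarRing.norm_coe_unitary p.1.1).le⟩⟩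

/-- The second unitary of every pair. -/
def ambientV (α : ℝ) : Ambient α :=
  ⟨fun p => (p.1.2 : L2 →L[ℂ] L2), memℓp_infty ⟨1, by
    rintro _ ⟨p, rfl⟩
    exact (CStarRing.norm_coe_unitary p.1.2).le⟩⟩

/-- The C*-subalgebra generated by the two universal unitaries. -/
def torusSubalgebra (α : ℝ) : StarSubalgebra ℂ (Ambient α) :=
  (StarAlgebra.adjoin ℂ {ambientU α, ambientV α}).topologicalClosure

instance (α : ℝ) : IsClosed (torusSubalgebra α : Set (Ambient α)) :=
  StarSubalgebra.isClosed_topologicalClosure _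

/-- The non-commutative torus `C(𝕋²_α)`: the universal C*-algebra generated by two unitaries
`u_α`, `v_α` with `u_α v_α = e^{2πiα} v_α u_α`. It is realized inside the product of all
representations of the relation on `ℓ²(ℤ²)`; these suffice, since for a pair of unitaries in any
C*-algebra the norm of a *-polynomial in them is a supremum over representations on separable
Hilbert spaces. -/
def Torus (α : ℝ) : Type := torusSubalgebra α

instance (α : ℝ) : CStarAlgebra (Torus α) :=
  inferInstanceAs (CStarAlgebra (torusSubalgebra α))

/-- The inclusion of the torus into the product of all representations. -/
def toAmbient (α : ℝ) : Torus α →⋆ₐ[ℂ] Ambient α := (torusSubalgebra α).subtype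

instance (α : ℝ) : PartialOrder (Torus α) := CStarAlgebra.spectralOrder _

instance (α : ℝ) : StarOrderedRing (Torus α) := CStarAlgebra.spectralOrderedRing _

/-- The generator `u_α`. -/
def u (α : ℝ) : Torus α :=
  ⟨ambientU α, StarSubalgebra.le_topologicalClosure _
    (StarAlgebra.subset_adjoin ℂ _ (Set.mem_insert _ _))⟩

/-- The generator `v_α`. -/
def v (α : ℝ) : Torus α :=
  ⟨ambientV α, StarSubalgebra.le_topologicalClosure _
    (StarAlgebra.subset_adjoin ℂ _ (Set.mem_insert_of_mem _ rfl))⟩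

/-- The orthonormal basis vector `δ_i`. -/
def delta (i : ℤ × ℤ) : L2 := lp.single 2 i 1

theorem orthonormal_delta : Orthonormal ℂ delta := by
  rw [orthonormal_iff_ite]
  intro i j
  simp only [delta, lp.inner_single_left, lp.single_apply, Pi.single_apply]
  by_cases h : i = j <;> simp [h]

theorem span_delta : (Submodule.span ℂ (Set.range delta)).topologicalClosure = ⊤ := by
  have h := (HilbertBasis.ofRepr (LinearIsometryEquiv.refl ℂ L2)).dense_span
  have e : ⇑(HilbertBasis.ofRepr (LinearIsometryEquiv.refl ℂ L2)) = delta := by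
    funext i
    rw [← HilbertBasis.repr_symm_single]
    rfl
  rwa [e] at h

/-- The weighted permutation operator `δ_i ↦ c_i δ_{σ i}`, for `c_i` on the unit circle. -/
def weightedShift (σ : Equiv.Perm (ℤ × ℤ)) (c : ℤ × ℤ → Circle) : unitary (L2 →L[ℂ] L2) :=
  Unitary.linearIsometryEquiv.symm
    (HilbertBasis.mk (v := fun i => (c i : ℂ) • delta (σ i))
      (by
        rw [orthonormal_iff_ite]
        intro i j
        rw [inner_smul_left, inner_smul_right, orthonormal_iff_ite.mp orthonormal_delta]
        by_cases h : i = j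
        · subst h
          simp [← Circle.coe_inv_eq_conj]
        · simp [h])
      (by
        rw [← span_delta]
        refine Submodule.topologicalClosure_mono (Submodule.span_le.mpr ?_)
        rintro _ ⟨i, rfl⟩
        have h : delta i = ((c (σ.symm i) : ℂ)⁻¹) •
            ((c (σ.symm i) : ℂ) • delta (σ (σ.symm i))) := by
          rw [smul_smul, inv_mul_cancel₀ (Circle.coe_ne_zero _), one_smul,
            Equiv.apply_symm_apply]
        rw [SetLike.mem_coe, h]
        exact Submodule.smul_mem _ _ (Submodule.subset_span ⟨σ.symm i, rfl⟩))).repr.symm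

theorem weightedShift_delta (σ : Equiv.Perm (ℤ × ℤ)) (c : ℤ × ℤ → Circle) (i : ℤ × ℤ) :
    (weightedShift σ c : L2 →L[ℂ] L2) (delta i) = (c i : ℂ) • delta (σ i) := by
  have h : ∀ b : HilbertBasis (ℤ × ℤ) ℂ L2,
      ((Unitary.linearIsometryEquiv.symm b.repr.symm : unitary (L2 →L[ℂ] L2)) :
        L2 →L[ℂ] L2) (delta i) = b i := fun b => b.repr_symm_single i
  rw [weightedShift, h, HilbertBasis.coe_mk]

/-- The regular pair on `ℓ²(ℤ²)`: `δ_{(m,n)} ↦ δ_{(m+1,n)}` and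
`δ_{(m,n)} ↦ e^{-2πiαm} δ_{(m,n+1)}`. -/
def regular (α : ℝ) : Rep α :=
  ⟨(weightedShift (Equiv.addRight (1, 0)) 1,
    weightedShift (Equiv.addRight (0, 1)) fun i => q α ^ (-i.1)), by
    refine ContinuousLinearMap.ext_on
      (Submodule.dense_iff_topologicalClosure_eq_top.mpr span_delta) ?_
    rintro _ ⟨i, rfl⟩
    simp only [mul_apply_eq_comp, smul_apply, weightedShift_delta, map_smul, smul_smul,
      Pi.one_apply, Circle.coe_one, one_smul, Equiv.coe_addRight]
    have h : (q α : ℂ) * ((q α ^ (-(i + (1, 0)).1) : Circle) : ℂ) =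
        ((q α ^ (-i.1) : Circle) : ℂ) := by
      rw [← Circle.coe_mul, ← zpow_one_add]
      congr 2
      simp
    rw [h, add_right_comm]⟩

/-- The canonical tracial state `τ_α` on `C(𝕋²_α)`, the vector state of `δ_{(0,0)}` in the
regular representation; it satisfies `τ_α(u_αⁿ v_αᵐ) = δ_{n0} δ_{m0}`. -/
def trace (α : ℝ) : Torus α →ₚ[ℂ] ℂ :=
  PositiveLinearMap.mk₀
    { toFun := fun x => ⟪delta (0, 0), toAmbient α x (regular α) (delta (0, 0))⟫_ℂ
      map_add' := fun x y => by simp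
      map_smul' := fun c x => by simp }
    (by
      intro x hx
      obtain ⟨y, rfl⟩ := CStarAlgebra.nonneg_iff_eq_star_mul_self.mp hx
      have h : toAmbient α (star y * y) (regular α) =
        star (toAmbient α y (regular α)) * toAmbient α y (regular α) := rfl
      simp only [LinearMap.coe_mk, AddHom.coe_mk, h, mul_apply_eq_comp,
        ContinuousLinearMap.star_eq_adjoint, ContinuousLinearMap.adjoint_inner_right,
        inner_self_eq_norm_sq_to_K, ← RCLike.ofReal_pow]
      exact RCLike.ofReal_nonneg.mpr (sq_nonneg _))

/-- The Hilbert space of the GNS representation of `τ_α`. -/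
def GNSSpace (α : ℝ) : Type := (trace α).GNS

instance (α : ℝ) : NormedAddCommGroup (GNSSpace α) :=
  inferInstanceAs (NormedAddCommGroup (trace α).GNS)

instance (α : ℝ) : InnerProductSpace ℂ (GNSSpace α) :=
  inferInstanceAs (InnerProductSpace ℂ (trace α).GNS)

instance (α : ℝ) : CompleteSpace (GNSSpace α) :=
  inferInstanceAs (CompleteSpace (trace α).GNS)

/-- The GNS representation of `τ_α`. -/
def gns (α : ℝ) : Torus α →⋆ₐ[ℂ] (GNSSpace α →L[ℂ] GNSSpace α) := (trace α).gnsStarAlgHom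

/-- The cyclic vector of the GNS representation, the class of `1`. -/
def cyclicVector (α : ℝ) : GNSSpace α :=
  (((trace α).toPreGNS 1 : (trace α).PreGNS) : (trace α).GNS)

/-- `R = C(𝕋²_α)''` in the GNS representation. -/
def R (α : ℝ) : VonNeumannAlgebra (GNSSpace α) :=
  VonNeumannAlgebra.generatedBy (Set.range (gns α))

/-- `D_α = ⟨u_α⟩''`. -/
def D (α : ℝ) : VonNeumannAlgebra (GNSSpace α) :=
  VonNeumannAlgebra.generatedBy {gns α (u α)}

/-- `C_α = ⟨v_α⟩''`. -/
def C (α : ℝ) : VonNeumannAlgebra (GNSSpace α) :=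
  VonNeumannAlgebra.generatedBy {gns α (v α)}

theorem D_le_R (α : ℝ) : (D α).toStarSubalgebra ≤ (R α).toStarSubalgebra :=
  VonNeumannAlgebra.generatedBy_mono (Set.singleton_subset_iff.mpr ⟨u α, rfl⟩)

theorem C_le_R (α : ℝ) : (C α).toStarSubalgebra ≤ (R α).toStarSubalgebra :=
  VonNeumannAlgebra.generatedBy_mono (Set.singleton_subset_iff.mpr ⟨v α, rfl⟩)

/-- `u_α` as an element of `D_α`. -/
def uD (α : ℝ) : (D α).toStarSubalgebra :=
  ⟨gns α (u α), VonNeumannAlgebra.subset_generatedBy _ rfl⟩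

/-- `v_α` as an element of `C_α`. -/
def vC (α : ℝ) : (C α).toStarSubalgebra :=
  ⟨gns α (v α), VonNeumannAlgebra.subset_generatedBy _ rfl⟩

/-- The extension `τ_R` of `τ_α` to `R`, the vector state of the cyclic vector. -/
def traceR (α : ℝ) : (R α).toStarSubalgebra →ₗ[ℂ] ℂ where
  toFun x := ⟪cyclicVector α, (x : GNSSpace α →L[ℂ] GNSSpace α) (cyclicVector α)⟫_ℂ
  map_add' x y := by simp
  map_smul' c x := by simp

/-- `θ` is the normal `*`-isomorphism `θ_α : D_α → C_α` with `θ_α(u_α) = v_α`. -/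
def IsTheta (α : ℝ) (θ : (D α).toStarSubalgebra ≃⋆ₐ[ℂ] (C α).toStarSubalgebra) : Prop :=
  VonNeumannAlgebra.IsNormalMap (D α) (C α) θ ∧ θ (uD α) = vC α

/-- `E` is the `τ_R`-preserving (faithful) normal conditional expectation of `R` onto its von
Neumann subalgebra `B`. -/
def IsTracePreservingCondExp (α : ℝ) (B : VonNeumannAlgebra (GNSSpace α))
    (hB : B.toStarSubalgebra ≤ (R α).toStarSubalgebra)
    (E : (R α).toStarSubalgebra →ₗ[ℂ] B.toStarSubalgebra) : Prop :=
  VonNeumannAlgebra.IsConditionalExpectation (R α) B (StarSubalgebra.inclusion hB) E ∧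
    ∀ x, traceR α (StarSubalgebra.inclusion hB (E x)) = traceR α x

/-- `(M, E)` with embedding `π` and stable unitary `w` is the HNN extension `M_α` of `R` by `θ`
with respect to `ED` and `EC`. -/
abbrev IsTorusHNNExtension (α : ℝ)
    (θ : (D α).toStarSubalgebra ≃⋆ₐ[ℂ] (C α).toStarSubalgebra)
    (ED : (R α).toStarSubalgebra →ₗ[ℂ] (D α).toStarSubalgebra)
    (EC : (R α).toStarSubalgebra →ₗ[ℂ] (C α).toStarSubalgebra)
    {K : Type*} [NormedAddCommGroup K] [InnerProductSpace ℂ K] [CompleteSpace K]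
    (M : VonNeumannAlgebra K)
    (π : (R α).toStarSubalgebra →⋆ₐ[ℂ] M.toStarSubalgebra)
    (w : unitary M.toStarSubalgebra)
    (E : M.toStarSubalgebra →ₗ[ℂ] (R α).toStarSubalgebra) : Prop :=
  VonNeumannAlgebra.IsHNNExtension (R α) (D α) (C α) (D_le_R α) (C_le_R α) θ ED EC M π w E

end NCTorus

end

/-! The algebra `M_α` is the twisted von Neumann algebra of an HNN extension of groups. Let `H` be
the Heisenberg group of the elements `z uᵐ vⁿ` with `z` in the circle and `uv = e^{2πiα}vu`, and let
`G` be obtained from `H` by adjoining `t` with `t v t⁻¹ = u`, the circle staying central. The GNS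
space of `τ_α` is a regular representation of `H` in which the circle acts by scalars (`gnsRep`).
Its von Neumann algebra is `R`, and `D_α`, `C_α` belong to the subgroups of multiples of powers of
`u` and of `v`.

Existence: `G` has a regular representation of the same kind. An injective homomorphism of groups
respecting the circle gives a normal embedding of von Neumann algebras, diagonal along cosets, and a
conditional expectation `x ↦ W* x W` (`nonempty_inclusion`). A reduced word of the algebra, applied
to the cyclic vector, is supported on reduced words of `G` (`inner_e_hnnWord`); by Britton's lemma
none of these lies in `H`, so the expectation kills the word.

Structure of an arbitrary HNN extension: `u`, `v` and the stable unitary define a representation `λ`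
of `G` in `M`. Reduced words of `G` are reduced words of the algebra, so the moment condition makes
`τ = τ_R ∘ E` vanish on `λ_g` for every `g` off the circle. Thus `M` is generated by a tracial
twisted representation of `G` (`isTracialRep`), and the rest uses nothing else.

Fullness: for an asymptotically central sequence, subtract the ultralimit of the traces. The Fourier
masses `|τ(λ_g* xₙ)|²` behave in the limit like a finite conjugation-invariant measure on `G` modulo
the circle. A set with infinitely many disjoint conjugates therefore carries no mass in the limit.
Since both associated subgroups have infinite index in `H`, the set of words beginning with `t` is
of this kind, and so is the set of those beginning with `t⁻¹`; conjugates of these sets and of their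
inverses cover everything outside the circle (`null_compl_inf`). So the sequence tends to a scalar
in 2-norm. Factoriality is the case of constant sequences, and the powers of `t` give infinite
dimension. The Haar unitaries are `t` and `v`, which generate because `u = t v t⁻¹`. -/

noncomputable section

namespace VonNeumannAlgebra

/-! ### Amplifications, the density theorem and `σ`-weakly continuous functionals -/

section Amplification

variable {H : Type*} [NormedAddCommGroup H] [InnerProductSpace ℂ H] [CompleteSpace H]

/-- The amplification `x ⊗ 1` on `ℓ²(ι; H)`. -/
def amp (H : Type*) [NormedAddCommGroup H] [InnerProductSpace ℂ H] [CompleteSpace H] (ι : Type*) :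
    (H →L[ℂ] H) →⋆ₐ[ℂ] (lp (fun _ : ι => H) 2 →L[ℂ] lp (fun _ : ι => H) 2) where
  toFun x := lp.mapCLM 2 (fun _ => x) (norm_nonneg x) (fun _ => le_rfl)
  map_one' := by ext f i; simp
  map_mul' x y := by ext f i; simp
  map_zero' := by ext f i; simp
  map_add' x y := by ext f i; simp
  commutes' c := by ext f i; simp [Algebra.algebraMap_eq_smul_one]
  map_star' x := by
    refine (ContinuousLinearMap.eq_adjoint_iff _ _).mpr fun f g => ?_
    rw [lp.inner_eq_tsum, lp.inner_eq_tsum]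
    simp [ContinuousLinearMap.star_eq_adjoint, ContinuousLinearMap.adjoint_inner_left]

@[simp]
theorem amp_apply {ι : Type*} (x : H →L[ℂ] H) (f : lp (fun _ : ι => H) 2) (i : ι) :
    amp H ι x f i = x (f i) := rfl

theorem amp_single {ι : Type*} [DecidableEq ι] (x : H →L[ℂ] H) (i : ι) (ξ : H) :
    amp H ι x (lp.single 2 i ξ) = lp.single 2 i (x ξ) := by
  ext j
  rw [amp_apply, lp.single_apply, lp.single_apply]
  by_cases h : j = i
  · subst h; simp
  · simp [Pi.single_eq_of_ne h]

theorem mem_generatedBy_iff {S : Set (H →L[ℂ] H)} {x : H →L[ℂ] H} :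
    x ∈ generatedBy S ↔
      ∀ y, (∀ s ∈ S, s * y = y * s ∧ star s * y = y * star s) → y * x = x * y := by
  rw [← SetLike.mem_coe, coe_generatedBy, Set.mem_centralizer_iff]
  refine forall_congr' fun y => ?_
  rw [Set.mem_centralizer_iff]
  refine imp_congr_left ⟨fun h s hs => ⟨h s (Or.inl hs), h _ (Or.inr (by simpa using hs))⟩,
    fun h s hs => ?_⟩
  rcases hs with hs | hs
  · exact (h s hs).1
  · simpa using (h _ hs).2

theorem generatedBy_le {S : Set (H →L[ℂ] H)} {N : VonNeumannAlgebra H} (h : S ⊆ N) :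
    generatedBy S ≤ N := by
  intro x hx
  rw [← commutant_commutant N, mem_commutant_iff]
  intro y hy
  rw [mem_commutant_iff] at hy
  exact mem_generatedBy_iff.mp hx y fun s hs => ⟨hy s (h hs), hy _ (star_mem (h hs))⟩

/-- The density theorem: in the amplified space, `x b` is approximated by `span S · b`. -/
theorem amp_mem_closure {ι : Type*} (S : Submonoid (H →L[ℂ] H)) (hS : ∀ s ∈ S, star s ∈ S)
    {x : H →L[ℂ] H} (hx : x ∈ generatedBy (S : Set (H →L[ℂ] H)))
    (b : lp (fun _ : ι => H) 2) :
    amp H ι x b ∈ (Submodule.span ℂ ((fun s => amp H ι s b) '' S)).topologicalClosure := by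
  classical
  -- Von Neumann's bicommutant argument: the closed span of the orbit of `b` is invariant under the
  -- star-closed set `S`, so the projection onto it commutes with the amplified operators of `S`.
  set L := (Submodule.span ℂ ((fun s => amp H ι s b) '' S)).topologicalClosure with hL
  have hinv : ∀ s ∈ S, ∀ f ∈ L, amp H ι s f ∈ L := by
    intro s hs
    have : L ≤ L.comap (amp H ι s : _ →ₗ[ℂ] _) := by
      refine Submodule.topologicalClosure_minimal _ ?_ ?_
      · rw [Submodule.span_le]
        rintro _ ⟨r, hr, rfl⟩
        refine Submodule.le_topologicalClosure _ (Submodule.subset_span ⟨s * r, S.mul_mem hs hr, ?_⟩)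
        simp
      · exact (Submodule.isClosed_topologicalClosure _).preimage (amp H ι s).continuous
    exact this
  have hcomm : ∀ s ∈ S, ∀ f, L.starProjection (amp H ι s f) = amp H ι s (L.starProjection f) := by
    intro s hs f
    refine Submodule.eq_starProjection_of_mem_orthogonal
      (hinv s hs _ (Submodule.starProjection_apply_mem _ _)) ?_
    rw [← map_sub, Submodule.mem_orthogonal]
    intro g hg
    have h2 : g ∈ L := hg
    have := Submodule.sub_starProjection_mem_orthogonal (K := L) f
    rw [Submodule.mem_orthogonal] at this
    rw [← ContinuousLinearMap.adjoint_inner_left, ← ContinuousLinearMap.star_eq_adjoint, ← map_star]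
    exact this _ (hinv _ (hS s hs) g h2)
  -- The matrix entries of the projection commute with `S`, hence with `x`. So the projection
  -- commutes with the amplification of `x`, which therefore leaves `L` invariant.
  let P : ι → ι → H →L[ℂ] H := fun i j =>
    lp.evalCLM ℂ (fun _ => H) 2 i ∘L L.starProjection ∘L
      lp.singleContinuousLinearMap ℂ (fun _ => H) 2 j
  have hP : ∀ i j ξ, P i j ξ = L.starProjection (lp.single 2 j ξ) i := fun i j ξ => rfl
  have hPx : ∀ i j, P i j * x = x * P i j := by
    intro i j
    refine mem_generatedBy_iff.mp hx _ fun s hs => ?_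
    have key : ∀ s ∈ S, s * P i j = P i j * s := by
      intro s hs
      ext ξ
      rw [mul_apply_eq_comp, mul_apply_eq_comp, hP, hP, ← amp_single, hcomm s hs, amp_apply]
    exact ⟨key s hs, key _ (hS s hs)⟩
  have hx' : L.starProjection ∘L amp H ι x = amp H ι x ∘L L.starProjection := by
    refine lp.ext_continuousLinearMap (by simp) fun j => ?_
    ext ξ i
    have := DFunLike.congr_fun (hPx i j) ξ
    rw [mul_apply_eq_comp, mul_apply_eq_comp, hP, hP, ← amp_single] at this
    exact this
  have hb : b ∈ L := Submodule.le_topologicalClosure _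
    (Submodule.subset_span ⟨1, S.one_mem, by simp⟩)
  have := DFunLike.congr_fun hx' b
  simp only [ContinuousLinearMap.comp_apply] at this
  rw [Submodule.starProjection_eq_self_iff.mpr hb] at this
  exact Submodule.starProjection_eq_self_iff.mp this

theorem memℓp_two_iff {ι H : Type*} [NormedAddCommGroup H] (a : ι → H) :
    Memℓp (E := fun _ : ι => H) a 2 ↔ Summable fun i => ‖a i‖ ^ 2 := by
  rw [memℓp_gen_iff (by simp)]
  simp

/-- The two sequences are vectors of `ℓ²(ℕ; H)`, so such a functional is a single matrix coefficient
of the amplification, and the density theorem applies to it directly. -/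
theorem isSigmaWeaklyContinuous_iff {N : VonNeumannAlgebra H} {f : N.toStarSubalgebra → ℂ} :
    IsSigmaWeaklyContinuous N f ↔
      ∃ a b : lp (fun _ : ℕ => H) 2, ∀ x : N.toStarSubalgebra, f x = ⟪a, amp H ℕ x b⟫_ℂ := by
  constructor
  · rintro ⟨a, b, ha, hb, h⟩
    refine ⟨⟨a, (memℓp_two_iff a).mpr ha⟩, ⟨b, (memℓp_two_iff b).mpr hb⟩, fun x => ?_⟩
    exact (h x).unique (lp.hasSum_inner _ _)
  · rintro ⟨a, b, h⟩
    refine ⟨a, b, (memℓp_two_iff _).mp a.2, (memℓp_two_iff _).mp b.2, fun x => ?_⟩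
    rw [h]
    exact lp.hasSum_inner a (amp H ℕ x b)

/-- A square-summable family has countable support: the support of `a` injects into `ℕ`, and both
families are transported there and extended by zero. This allows index sets such as `Unit`, `ℕ ⊕ ℕ`
and coset transversals of uncountable groups. -/
theorem isSigmaWeaklyContinuous_of_amp {ι : Type*} (N : VonNeumannAlgebra H)
    (a b : lp (fun _ : ι => H) 2) :
    IsSigmaWeaklyContinuous N (fun x => ⟪a, amp H ι x b⟫_ℂ) := by
  have ha := (memℓp_two_iff _).mp a.2
  have hb := (memℓp_two_iff _).mp b.2
  have hc : Countable (Function.support fun i => ‖a i‖ ^ 2) := ha.countable_support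
  obtain ⟨j, hj⟩ := exists_injective_nat (Function.support fun i => ‖a i‖ ^ 2)
  have hsum : ∀ c : ι → H, Summable (fun i => ‖c i‖ ^ 2) →
      Summable fun n => ‖Function.extend j (fun i => c i) 0 n‖ ^ 2 := by
    intro c hcs
    rw [← hj.summable_iff]
    · refine (hcs.subtype _).congr fun i => ?_
      simp [hj.extend_apply]
    · intro n hn
      rw [Function.extend_apply' _ _ _ (by simpa using hn)]
      simp
  refine ⟨_, _, hsum a ha, hsum b hb, fun x => ?_⟩
  rw [← hj.hasSum_iff]
  · have h := lp.hasSum_inner (𝕜 := ℂ) a (amp H ι x b)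
    have h2 := (Subtype.val_injective (p := (· ∈ Function.support fun i => ‖a i‖ ^ 2))).hasSum_iff
      (f := fun i => ⟪a i, amp H ι x b i⟫_ℂ) (a := ⟪a, amp H ι x b⟫_ℂ) (by
        intro i hi
        have : a i = 0 := by simpa using hi
        simp [this])
    refine (h2.mpr h).congr_fun fun i => ?_
    simp [hj.extend_apply]
  · intro n hn
    rw [Function.extend_apply' _ _ _ (by simpa using hn)]
    simp

theorem isSigmaWeaklyContinuous_inner (N : VonNeumannAlgebra H) (ξ η : H) :
    IsSigmaWeaklyContinuous N (fun x => ⟪ξ, (x : H →L[ℂ] H) η⟫_ℂ) := by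
  have := isSigmaWeaklyContinuous_of_amp N (lp.single (E := fun _ : Unit => H) 2 () ξ)
    (lp.single 2 () η)
  simp only [amp_single, lp.inner_single_left] at this
  simpa using this

theorem IsSigmaWeaklyContinuous.sub {N : VonNeumannAlgebra H} {f g : N.toStarSubalgebra → ℂ}
    (hf : IsSigmaWeaklyContinuous N f) (hg : IsSigmaWeaklyContinuous N g) :
    IsSigmaWeaklyContinuous N (fun x => f x - g x) := by
  obtain ⟨a, b, ha, hb, h⟩ := hf
  obtain ⟨a', b', ha', hb', h'⟩ := hg
  have := isSigmaWeaklyContinuous_of_amp (ι := ℕ ⊕ ℕ) N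
    ⟨Sum.elim a a', (memℓp_two_iff _).mpr (Summable.sum _ ha ha')⟩
    ⟨Sum.elim b (fun n => - b' n), (memℓp_two_iff _).mpr (Summable.sum _ hb (by
      simpa [Function.comp_def] using hb'))⟩
  convert this with x
  refine HasSum.unique ?_ (lp.hasSum_inner _ _)
  rw [sub_eq_add_neg]
  refine HasSum.sum (h x) ((h' x).neg.congr_fun fun n => ?_)
  simp

theorem IsSigmaWeaklyContinuous.mul_mul {N : VonNeumannAlgebra H} {f : N.toStarSubalgebra → ℂ}
    (hf : IsSigmaWeaklyContinuous N f) (p r : N.toStarSubalgebra) :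
    IsSigmaWeaklyContinuous N (fun x => f (p * x * r)) := by
  obtain ⟨a, b, h⟩ := isSigmaWeaklyContinuous_iff.mp hf
  refine isSigmaWeaklyContinuous_iff.mpr ⟨amp H ℕ (star (p : H →L[ℂ] H)) a, amp H ℕ r b, fun x => ?_⟩
  rw [h, map_star, ContinuousLinearMap.star_eq_adjoint, ContinuousLinearMap.adjoint_inner_left]
  simp

/-- Two `σ`-weakly continuous functionals which agree on a generating star-closed submonoid
agree. -/
theorem IsSigmaWeaklyContinuous.ext_of_generatedBy {N : VonNeumannAlgebra H}
    {f g : N.toStarSubalgebra → ℂ} (hf : IsSigmaWeaklyContinuous N f)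
    (hg : IsSigmaWeaklyContinuous N g) (S : Submonoid (H →L[ℂ] H)) (hS : ∀ s ∈ S, star s ∈ S)
    (hN : generatedBy (S : Set (H →L[ℂ] H)) = N)
    (h : ∀ s : N.toStarSubalgebra, (s : H →L[ℂ] H) ∈ S → f s = g s) (x : N.toStarSubalgebra) :
    f x = g x := by
  obtain ⟨a, b, hab⟩ := isSigmaWeaklyContinuous_iff.mp (hf.sub hg)
  have hx : (x : H →L[ℂ] H) ∈ generatedBy (S : Set (H →L[ℂ] H)) := by rw [hN]; exact x.2
  -- The difference of the functionals at `x` is the inner product of `a` with the amplified vector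
  -- `x b`. It vanishes on `S`, so `a` is orthogonal to the closed span that contains `x b`.
  have hmem := amp_mem_closure S hS hx b
  have hle : (Submodule.span ℂ ((fun s => amp H ℕ s b) '' S)).topologicalClosure ≤
      (Submodule.span ℂ {a})ᗮ := by
    refine Submodule.topologicalClosure_minimal _ ?_ (Submodule.isClosed_orthogonal _)
    rw [Submodule.span_le]
    rintro _ ⟨s, hs, rfl⟩
    rw [SetLike.mem_coe, Submodule.mem_orthogonal_singleton_iff_inner_right]
    have hsN : s ∈ N.toStarSubalgebra := by
      have := subset_generatedBy (S : Set (H →L[ℂ] H)) hs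
      rw [hN] at this
      exact this
    rw [← hab ⟨s, hsN⟩, h ⟨s, hsN⟩ hs, sub_self]
  have h0 := hle hmem
  rw [Submodule.mem_orthogonal_singleton_iff_inner_right, ← hab x] at h0
  exact sub_eq_zero.mp h0

end Amplification

end VonNeumannAlgebra
end

/-! ### Isometries determined by Gram matrices -/

noncomputable section

section Gram

variable {X H K : Type*} [NormedAddCommGroup H] [InnerProductSpace ℂ H]
  [NormedAddCommGroup K] [InnerProductSpace ℂ K]

theorem inner_linearCombination_eq_of_gram {f : X → H} {f' : X → K}
    (h : ∀ x y, ⟪f x, f y⟫_ℂ = ⟪f' x, f' y⟫_ℂ) (a b : X →₀ ℂ) :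
    ⟪Finsupp.linearCombination ℂ f a, Finsupp.linearCombination ℂ f b⟫_ℂ =
      ⟪Finsupp.linearCombination ℂ f' a, Finsupp.linearCombination ℂ f' b⟫_ℂ := by
  simp only [Finsupp.linearCombination_apply, Finsupp.sum_inner, Finsupp.inner_sum,
    inner_smul_left, inner_smul_right, h]

theorem norm_linearCombination_eq_of_gram {f : X → H} {f' : X → K}
    (h : ∀ x y, ⟪f x, f y⟫_ℂ = ⟪f' x, f' y⟫_ℂ) (a : X →₀ ℂ) :
    ‖Finsupp.linearCombination ℂ f' a‖ = ‖Finsupp.linearCombination ℂ f a‖ := by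
  rw [norm_eq_sqrt_re_inner (𝕜 := ℂ), norm_eq_sqrt_re_inner (𝕜 := ℂ),
    inner_linearCombination_eq_of_gram h]

theorem denseRange_linearCombination {f : X → H}
    (hf : Dense (Submodule.span ℂ (Set.range f) : Set H)) :
    DenseRange (Finsupp.linearCombination ℂ f) := by
  rw [← Finsupp.range_linearCombination ℂ] at hf
  exact hf

/-- The isometry determined by two families with the same Gram matrix, the first one total. -/
def gramIsometry [CompleteSpace K] (f : X → H) (f' : X → K)
    (hf : Dense (Submodule.span ℂ (Set.range f) : Set H))
    (h : ∀ x y, ⟪f x, f y⟫_ℂ = ⟪f' x, f' y⟫_ℂ) : H →ₗᵢ[ℂ] K where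
  toLinearMap := ((Finsupp.linearCombination ℂ f').extendOfNorm
    (Finsupp.linearCombination ℂ f)).toLinearMap
  norm_map' := by
    refine (denseRange_linearCombination hf).induction ?_
      (isClosed_eq (by simp only [ContinuousLinearMap.coe_coe]; fun_prop) continuous_norm)
    rintro _ ⟨a, rfl⟩
    rw [ContinuousLinearMap.coe_coe, LinearMap.extendOfNorm_eq (denseRange_linearCombination hf)
      ⟨1, fun a => by rw [one_mul, norm_linearCombination_eq_of_gram h]⟩,
      norm_linearCombination_eq_of_gram h]

theorem gramIsometry_apply [CompleteSpace K] (f : X → H) (f' : X → K)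
    (hf : Dense (Submodule.span ℂ (Set.range f) : Set H))
    (h : ∀ x y, ⟪f x, f y⟫_ℂ = ⟪f' x, f' y⟫_ℂ) (x : X) : gramIsometry f f' hf h (f x) = f' x := by
  have := LinearMap.extendOfNorm_eq (f := Finsupp.linearCombination ℂ f')
    (denseRange_linearCombination hf)
    ⟨1, fun a => by rw [one_mul, norm_linearCombination_eq_of_gram h]⟩ (Finsupp.single x 1)
  rw [Finsupp.linearCombination_single, Finsupp.linearCombination_single, one_smul,
    one_smul] at this
  exact this

/-- The unitary determined by two total families with the same Gram matrix. -/
def gramEquiv [CompleteSpace H] [CompleteSpace K] (f : X → H) (f' : X → K)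
    (hf : Dense (Submodule.span ℂ (Set.range f) : Set H))
    (hf' : Dense (Submodule.span ℂ (Set.range f') : Set K))
    (h : ∀ x y, ⟪f x, f y⟫_ℂ = ⟪f' x, f' y⟫_ℂ) : H ≃ₗᵢ[ℂ] K :=
  LinearIsometryEquiv.ofSurjective (gramIsometry f f' hf h) (by
    have hcl := (gramIsometry f f' hf h).isometry.isClosedEmbedding.isClosed_range
    rw [← Set.range_eq_univ, ← hcl.closure_eq]
    refine Dense.closure_eq (hf'.mono ?_)
    have : Submodule.span ℂ (Set.range f') ≤ LinearMap.range (gramIsometry f f' hf h).toLinearMap := by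
      rw [Submodule.span_le]
      rintro _ ⟨x, rfl⟩
      exact ⟨f x, gramIsometry_apply f f' hf h x⟩
    exact this)

theorem gramEquiv_apply [CompleteSpace H] [CompleteSpace K] (f : X → H) (f' : X → K)
    (hf : Dense (Submodule.span ℂ (Set.range f) : Set H))
    (hf' : Dense (Submodule.span ℂ (Set.range f') : Set K))
    (h : ∀ x y, ⟪f x, f y⟫_ℂ = ⟪f' x, f' y⟫_ℂ) (x : X) :
    gramEquiv f f' hf hf' h (f x) = f' x :=
  gramIsometry_apply f f' hf h x

end Gram

/-! ### Twisted regular representations: right translations, separating vector, model on `ℓ²(G / c)`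
-/

/-- A twisted regular representation: a unitary representation of a group `G` in which the circle
`c` acts by scalars, with a cyclic unit vector whose coefficient vanishes off the circle. -/
structure RegularRep {G : Type*} [Group G] (c : Circle →* G) (K : Type*) [NormedAddCommGroup K]
    [InnerProductSpace ℂ K] [CompleteSpace K] where
  lam : G →* unitary (K →L[ℂ] K)
  vac : K
  lam_circle : ∀ z, (lam (c z) : K →L[ℂ] K) = (z : ℂ) • 1
  norm_vac : ‖vac‖ = 1
  inner_vac : ∀ g, g ∉ c.range → ⟪vac, (lam g : K →L[ℂ] K) vac⟫_ℂ = 0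
  dense_orbit : Dense (Submodule.span ℂ
    (Set.range fun g => (lam g : K →L[ℂ] K) vac) : Set K)

namespace RegularRep

open VonNeumannAlgebra

variable {G : Type*} [Group G] {c : Circle →* G} {K : Type*} [NormedAddCommGroup K]
    [InnerProductSpace ℂ K] [CompleteSpace K] (r : RegularRep c K)

/-- The orbit of the cyclic vector. -/
def e (g : G) : K := (r.lam g : K →L[ℂ] K) r.vac

theorem e_one : r.e 1 = r.vac := by simp [e]

theorem dense_e : Dense (Submodule.span ℂ (Set.range r.e) : Set K) := r.dense_orbit

theorem lam_mul_apply (g h : G) (ξ : K) :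
    (r.lam (g * h) : K →L[ℂ] K) ξ = (r.lam g : K →L[ℂ] K) ((r.lam h : K →L[ℂ] K) ξ) := by
  simp

theorem lam_e (g h : G) : (r.lam g : K →L[ℂ] K) (r.e h) = r.e (g * h) :=
  (r.lam_mul_apply g h _).symm

theorem star_lam (g : G) : star (r.lam g : K →L[ℂ] K) = r.lam g⁻¹ := by
  rw [map_inv]; rfl

theorem inner_lam_right (g : G) (ξ η : K) :
    ⟪ξ, (r.lam g : K →L[ℂ] K) η⟫_ℂ = ⟪(r.lam g⁻¹ : K →L[ℂ] K) ξ, η⟫_ℂ := by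
  rw [← star_lam, ContinuousLinearMap.star_eq_adjoint, ContinuousLinearMap.adjoint_inner_left]

theorem inner_e (g h : G) : ⟪r.e g, r.e h⟫_ℂ = ⟪r.vac, r.e (g⁻¹ * h)⟫_ℂ := by
  rw [← lam_e r g⁻¹ h, inner_lam_right, inv_inv]
  rfl

theorem inner_vac_circle (z : Circle) : ⟪r.vac, r.e (c z)⟫_ℂ = z := by
  rw [e, lam_circle]
  simp [r.norm_vac]

theorem inner_e_eq_zero {g h : G} (H : g⁻¹ * h ∉ c.range) : ⟪r.e g, r.e h⟫_ℂ = 0 := by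
  rw [inner_e]; exact r.inner_vac _ H

/-- The vacuum coefficient of a group element is its phase on the circle and zero elsewhere. The
Gram matrix comparisons between groups and between translates reduce to this. -/
theorem inner_vac_congr {G' : Type*} [Group G'] {c' : Circle →* G'} {H : Type*}
    [NormedAddCommGroup H] [InnerProductSpace ℂ H] [CompleteSpace H] (r' : RegularRep c' H)
    {g : G} {g' : G'} (h : ∀ z, g = c z ↔ g' = c' z) :
    ⟪r.vac, r.e g⟫_ℂ = ⟪r'.vac, r'.e g'⟫_ℂ := by
  by_cases hg : g ∈ c.range
  · obtain ⟨z, rfl⟩ := hg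
    rw [(h z).mp rfl, inner_vac_circle, inner_vac_circle]
  · have hgc : g' ∉ c'.range := by
      rintro ⟨z, rfl⟩
      exact hg ⟨z, ((h z).mpr rfl).symm⟩
    exact (r.inner_vac g hg).trans (r'.inner_vac g' hgc).symm

/-- The operators `lam g`. -/
def ops : Submonoid (K →L[ℂ] K) := MonoidHom.mrange ((unitary (K →L[ℂ] K)).subtype.comp r.lam)

theorem star_mem_ops : ∀ x ∈ r.ops, star x ∈ r.ops := by
  rintro _ ⟨g, rfl⟩
  exact ⟨g⁻¹, (r.star_lam g).symm⟩

/-- The von Neumann algebra of the representation. -/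
def vN : VonNeumannAlgebra K := generatedBy (r.ops : Set (K →L[ℂ] K))

theorem lam_mem_vN (g : G) : (r.lam g : K →L[ℂ] K) ∈ r.vN := subset_generatedBy _ ⟨g, rfl⟩

section Right

variable (hc : c.range ≤ Subgroup.center G)
include hc

theorem circle_conj_iff (h g : G) (z : Circle) : h⁻¹ * g * h = c z ↔ g = c z := by
  have hz := (Subgroup.mem_center_iff.mp (hc ⟨z, rfl⟩)) h
  constructor
  · intro H
    have : g = h * (h⁻¹ * g * h) * h⁻¹ := by group
    rw [this, H, hz]; group
  · rintro rfl
    rw [mul_assoc, ← hz]; group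

/-- Right translation by `h` conjugates `g⁻¹ * g'`, and conjugation fixes each element of the
central circle and permutes the others. This is traciality of the vector state in disguise. -/
theorem inner_e_mul_right (g g' h : G) : ⟪r.e g, r.e g'⟫_ℂ = ⟪r.e (g * h), r.e (g' * h)⟫_ℂ := by
  rw [inner_e, inner_e]
  refine r.inner_vac_congr r fun z => ?_
  rw [← circle_conj_iff hc h]
  simp only [mul_inv_rev, mul_assoc]

/-- Right translation. -/
def right (h : G) : K ≃ₗᵢ[ℂ] K :=
  gramEquiv r.e (fun g => r.e (g * h)) r.dense_e
    (by
      have : Set.range (fun g => r.e (g * h)) = Set.range r.e :=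
        (Equiv.mulRight h).surjective.range_comp r.e
      rw [this]; exact r.dense_e)
    (fun g g' => r.inner_e_mul_right hc g g' h)

theorem right_e (g h : G) : r.right hc h (r.e g) = r.e (g * h) := gramEquiv_apply _ _ _ _ _ g

theorem right_lam (h g : G) (ξ : K) :
    r.right hc h ((r.lam g : K →L[ℂ] K) ξ) = (r.lam g : K →L[ℂ] K) (r.right hc h ξ) := by
  have : ((r.right hc h : K ≃L[ℂ] K) : K →L[ℂ] K) ∘L (r.lam g : K →L[ℂ] K) =
      (r.lam g : K →L[ℂ] K) ∘L ((r.right hc h : K ≃L[ℂ] K) : K →L[ℂ] K) := by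
    refine ContinuousLinearMap.ext_on r.dense_e ?_
    rintro _ ⟨k, rfl⟩
    simp [lam_e, right_e, mul_assoc]
  exact DFunLike.congr_fun this ξ

theorem right_vN (h : G) {x : K →L[ℂ] K} (hx : x ∈ r.vN) (ξ : K) :
    r.right hc h (x ξ) = x (r.right hc h ξ) := by
  have := mem_generatedBy_iff.mp hx ((r.right hc h : K ≃L[ℂ] K) : K →L[ℂ] K) (by
    have key : ∀ s ∈ r.ops, s * ((r.right hc h : K ≃L[ℂ] K) : K →L[ℂ] K) =
        ((r.right hc h : K ≃L[ℂ] K) : K →L[ℂ] K) * s := by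
      rintro _ ⟨g, rfl⟩
      ext ξ
      exact (r.right_lam hc h g ξ).symm
    exact fun s hs => ⟨key s hs, key _ (r.star_mem_ops s hs)⟩)
  exact DFunLike.congr_fun this ξ

/-- Right translations commute with the algebra, so an operator is determined by its value at the
cyclic vector: that vector is separating. -/
theorem apply_e {x : K →L[ℂ] K} (hx : x ∈ r.vN) (g : G) : x (r.e g) = r.right hc g (x r.vac) := by
  rw [right_vN r hc g hx, ← e_one, right_e, one_mul]

theorem eq_zero_of_apply_vac {x : K →L[ℂ] K} (hx : x ∈ r.vN) (h : x r.vac = 0) : x = 0 := by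
  refine ContinuousLinearMap.ext_on r.dense_e ?_
  rintro _ ⟨g, rfl⟩
  rw [r.apply_e hc hx, h]
  simp

theorem inner_e_apply_e {x : K →L[ℂ] K} (hx : x ∈ r.vN) (g h : G) :
    ⟪r.e g, x (r.e h)⟫_ℂ = ⟪r.e (g * h⁻¹), x r.vac⟫_ℂ := by
  rw [r.apply_e hc hx, ← (r.right hc h).inner_map_map (r.e (g * h⁻¹)), right_e,
    inv_mul_cancel_right]

theorem eq_zero_iff_inner_e {x : K →L[ℂ] K} (hx : x ∈ r.vN) :
    x = 0 ↔ ∀ g, ⟪r.e g, x r.vac⟫_ℂ = 0 := by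
  refine ⟨fun h g => by simp [h], fun h => r.eq_zero_of_apply_vac hc hx ?_⟩
  refine r.dense_e.eq_zero_of_inner_right (𝕜 := ℂ) fun v hv => ?_
  induction hv using Submodule.span_induction with
  | mem y hy => obtain ⟨g, rfl⟩ := hy; exact h g
  | zero => simp
  | add y z _ _ hy hz => rw [inner_add_left, hy, hz, add_zero]
  | smul a y _ hy => rw [inner_smul_left, hy, mul_zero]

end Right

/-! ### Existence -/

section Existence

variable (c) in
theorem exists_phase (g : G) : ∃ z, c z = (QuotientGroup.mk g : G ⧸ c.range).out⁻¹ * g := by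
  have : (QuotientGroup.mk g : G ⧸ c.range).out⁻¹ * g ∈ c.range :=
    QuotientGroup.eq.mp (QuotientGroup.out_eq' _)
  exact this

variable (c) in
/-- The phase of `g` relative to the chosen representative of its coset. -/
def phase (g : G) : Circle := Classical.choose (exists_phase c g)

variable (c) in
theorem c_phase (g : G) : c (phase c g) = (QuotientGroup.mk g : G ⧸ c.range).out⁻¹ * g :=
  Classical.choose_spec (exists_phase c g)

variable (c) in
/-- The model vectors in `ℓ²(G / c)`. -/
def modelVec (g : G) : lp (fun _ : G ⧸ c.range => ℂ) 2 := by
  classical exact lp.single 2 (QuotientGroup.mk g) (phase c g : ℂ)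

/-- The phase is measured against a representative that depends only on the coset; injectivity of
`c` then makes it multiplicative along the circle. -/
theorem modelVec_mul (hinj : Function.Injective c) (g : G) (z : Circle) :
    modelVec c (g * c z) = (z : ℂ) • modelVec c g := by
  classical
  have hq : (QuotientGroup.mk (g * c z) : G ⧸ c.range) = QuotientGroup.mk g := by
    rw [eq_comm, QuotientGroup.eq]; simp
  have hp : phase c (g * c z) = phase c g * z := by
    apply hinj
    rw [map_mul, c_phase, c_phase, hq, mul_assoc]
  simp only [modelVec]
  rw [hq, hp, ← lp.single_smul]
  simp [mul_comm]

theorem inner_modelVec_self (g : G) : ⟪modelVec c g, modelVec c g⟫_ℂ = 1 := by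
  classical
  simp [modelVec, Circle.norm_coe]

theorem inner_modelVec_eq_zero {g h : G} (H : g⁻¹ * h ∉ c.range) :
    ⟪modelVec c g, modelVec c h⟫_ℂ = 0 := by
  classical
  have : (QuotientGroup.mk g : G ⧸ c.range) ≠ QuotientGroup.mk h := by
    rwa [Ne, QuotientGroup.eq]
  simp [modelVec, lp.inner_single_left, lp.single_apply, this]

theorem inner_modelVec_mul_left (hinj : Function.Injective c) (k g h : G) :
    ⟪modelVec c g, modelVec c h⟫_ℂ = ⟪modelVec c (k * g), modelVec c (k * h)⟫_ℂ := by
  have hk : (k * g)⁻¹ * (k * h) = g⁻¹ * h := by group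
  by_cases H : g⁻¹ * h ∈ c.range
  · obtain ⟨z, hz⟩ := H
    have : h = g * c z := by rw [hz]; group
    rw [this, ← mul_assoc, modelVec_mul hinj, modelVec_mul hinj, inner_smul_right,
      inner_smul_right, inner_modelVec_self, inner_modelVec_self]
  · rw [inner_modelVec_eq_zero H, inner_modelVec_eq_zero (by rwa [hk])]

theorem dense_modelVec : Dense (Submodule.span ℂ (Set.range (modelVec c)) :
    Set (lp (fun _ : G ⧸ c.range => ℂ) 2)) := by
  classical
  have h := (HilbertBasis.ofRepr (LinearIsometryEquiv.refl ℂ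
    (lp (fun _ : G ⧸ c.range => ℂ) 2))).dense_span
  rw [Submodule.dense_iff_topologicalClosure_eq_top, eq_top_iff, ← h]
  refine Submodule.topologicalClosure_mono (Submodule.span_le.mpr ?_)
  rintro _ ⟨i, rfl⟩
  obtain ⟨g, rfl⟩ := QuotientGroup.mk_surjective i
  have : (HilbertBasis.ofRepr (LinearIsometryEquiv.refl ℂ
      (lp (fun _ : G ⧸ c.range => ℂ) 2))) (QuotientGroup.mk g) =
      ((phase c g : ℂ)⁻¹) • modelVec c g := by
    rw [← HilbertBasis.repr_symm_single]
    simp only [modelVec]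
    rw [← lp.single_smul]
    simp
    rfl
  rw [this]
  exact Submodule.smul_mem _ _ (Submodule.subset_span ⟨g, rfl⟩)

/-- Left translation in the model. -/
def modelLeft (hinj : Function.Injective c) (k : G) :
    lp (fun _ : G ⧸ c.range => ℂ) 2 ≃ₗᵢ[ℂ] lp (fun _ : G ⧸ c.range => ℂ) 2 :=
  gramEquiv (modelVec c) (fun g => modelVec c (k * g)) dense_modelVec
    (by
      have : Set.range (fun g => modelVec c (k * g)) = Set.range (modelVec c) :=
        (Equiv.mulLeft k).surjective.range_comp (modelVec c)
      rw [this]; exact dense_modelVec)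
    (fun g h => inner_modelVec_mul_left hinj k g h)

theorem modelLeft_modelVec (hinj : Function.Injective c) (k g : G) :
    modelLeft hinj k (modelVec c g) = modelVec c (k * g) := gramEquiv_apply _ _ _ _ _ g

theorem linearIsometryEquiv_ext {X H : Type*} [NormedAddCommGroup H] [InnerProductSpace ℂ H]
    {f : X → H} (hf : Dense (Submodule.span ℂ (Set.range f) : Set H)) {S T : H ≃ₗᵢ[ℂ] H}
    (h : ∀ x, S (f x) = T (f x)) : S = T := by
  have : ((S : H ≃L[ℂ] H) : H →L[ℂ] H) = ((T : H ≃L[ℂ] H) : H →L[ℂ] H) := by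
    refine ContinuousLinearMap.ext_on hf ?_
    rintro _ ⟨x, rfl⟩
    exact h x
  ext ξ
  exact DFunLike.congr_fun this ξ

/-- The twisted regular representation on `ℓ²(G / c)`. -/
def model (hinj : Function.Injective c) (hc : c.range ≤ Subgroup.center G) :
    RegularRep c (lp (fun _ : G ⧸ c.range => ℂ) 2) where
  lam := Unitary.linearIsometryEquiv.symm.toMonoidHom.comp
    { toFun := modelLeft hinj
      map_one' := linearIsometryEquiv_ext (f := modelVec c) dense_modelVec fun g => by
        simp [modelLeft_modelVec]
      map_mul' := fun k l => linearIsometryEquiv_ext (f := modelVec c) dense_modelVec fun g => by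
        simp [modelLeft_modelVec, mul_assoc] }
  vac := modelVec c 1
  lam_circle z := by
    refine ContinuousLinearMap.ext_on (s := Set.range (modelVec c)) dense_modelVec ?_
    rintro _ ⟨g, rfl⟩
    have h1 : c z * g = g * c z := (Subgroup.mem_center_iff.mp (hc ⟨z, rfl⟩) g).symm
    have h2 := modelLeft_modelVec hinj (c z) g
    rw [h1, modelVec_mul hinj] at h2
    exact h2
  norm_vac := by
    rw [norm_eq_sqrt_re_inner (𝕜 := ℂ), inner_modelVec_self]; simp
  inner_vac g hg := by
    have h2 := modelLeft_modelVec hinj g 1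
    have : ⟪modelVec c 1, modelLeft hinj g (modelVec c 1)⟫_ℂ = 0 := by
      rw [h2]
      exact inner_modelVec_eq_zero (by simpa using hg)
    exact this
  dense_orbit := by
    have h : (fun g => modelLeft hinj g (modelVec c 1)) = modelVec c := by
      funext g
      rw [modelLeft_modelVec, mul_one]
    have hd := dense_modelVec (c := c)
    rw [← h] at hd
    exact hd

end Existence

end RegularRep
end

/-! ### Subgroups: embeddings and conditional expectations -/

noncomputable section

namespace VonNeumannAlgebra

variable {H : Type*} [NormedAddCommGroup H] [InnerProductSpace ℂ H] [CompleteSpace H]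
  {K : Type*} [NormedAddCommGroup K] [InnerProductSpace ℂ K] [CompleteSpace K]

theorem clm_ext_inner {H K : Type*} [NormedAddCommGroup H] [InnerProductSpace ℂ H]
    [NormedAddCommGroup K] [InnerProductSpace ℂ K] {x y : H →L[ℂ] K} (h : ∀ ξ η, ⟪ξ, x η⟫_ℂ = ⟪ξ, y η⟫_ℂ) : x = y := by
  ext η
  exact ext_inner_left ℂ fun ξ => h ξ η

/-- The compression `W* x W`. -/
def compress (W : H →ₗᵢ[ℂ] K) : (K →L[ℂ] K) →ₗ[ℂ] (H →L[ℂ] H) where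
  toFun x := ContinuousLinearMap.adjoint W.toContinuousLinearMap ∘L x ∘L W.toContinuousLinearMap
  map_add' x y := by ext; simp
  map_smul' a x := by ext; simp

theorem inner_compress (W : H →ₗᵢ[ℂ] K) (x : K →L[ℂ] K) (ξ η : H) :
    ⟪ξ, compress W x η⟫_ℂ = ⟪W ξ, x (W η)⟫_ℂ :=
  ContinuousLinearMap.adjoint_inner_right W.toContinuousLinearMap ξ _

/-- The isometry carries both defining sequences from `H` to `K`. This is the source of normality
for expectations of the form `W* x W`. -/
theorem IsSigmaWeaklyContinuous.comp_compress {N : VonNeumannAlgebra H} {M : VonNeumannAlgebra K}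
    {f : N.toStarSubalgebra → ℂ} (hf : IsSigmaWeaklyContinuous N f) (W : H →ₗᵢ[ℂ] K)
    (E : M.toStarSubalgebra → N.toStarSubalgebra)
    (hE : ∀ x, (E x : H →L[ℂ] H) = compress W x) :
    IsSigmaWeaklyContinuous M (fun x => f (E x)) := by
  obtain ⟨a, b, ha, hb, h⟩ := hf
  refine ⟨fun n => W (a n), fun n => W (b n), by simpa using ha, by simpa using hb, fun x => ?_⟩
  simpa only [hE, inner_compress] using h (E x)

end VonNeumannAlgebra

open VonNeumannAlgebra

namespace RegularRep

variable {Q G : Type*} [Group Q] [Group G] {cQ : Circle →* Q} {c : Circle →* G} {j : Q →* G}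
  {H : Type*} [NormedAddCommGroup H] [InnerProductSpace ℂ H] [CompleteSpace H]
  {K : Type*} [NormedAddCommGroup K] [InnerProductSpace ℂ K] [CompleteSpace K]

/-- The data which realize the von Neumann algebra of a subgroup inside that of the group. -/
structure Inclusion (j : Q →* G) (s : RegularRep cQ H) (r : RegularRep c K) where
  W : H →ₗᵢ[ℂ] K
  amplify : (H →L[ℂ] H) →⋆ₐ[ℂ] (K →L[ℂ] K)
  W_e : ∀ q, W (s.e q) = r.e (j q)
  amplify_lam : ∀ q, amplify (s.lam q) = r.lam (j q)
  amplify_W : ∀ x ξ, amplify x (W ξ) = W (x ξ)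
  normal : ∀ (N : VonNeumannAlgebra H) ξ η,
    IsSigmaWeaklyContinuous N (fun x => ⟪ξ, amplify (x : H →L[ℂ] H) η⟫_ℂ)

theorem eq_zero_of_dense_span {X H : Type*} [NormedAddCommGroup H] [InnerProductSpace ℂ H] {f : X → H} {ξ : H}
    (hf : Dense (Submodule.span ℂ (Set.range f) : Set H)) (h : ∀ x, ⟪f x, ξ⟫_ℂ = 0) : ξ = 0 := by
  refine hf.eq_zero_of_inner_right (𝕜 := ℂ) fun v hv => ?_
  induction hv using Submodule.span_induction with
  | mem y hy => obtain ⟨g, rfl⟩ := hy; exact h g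
  | zero => simp
  | add y z _ _ hy hz => rw [inner_add_left, hy, hz, add_zero]
  | smul a y _ hy => rw [inner_smul_left, hy, mul_zero]

theorem inner_map_map_eq_zero {X Y : Type*} {f : X → H} {g : Y → H}
    (hf : Dense (Submodule.span ℂ (Set.range f) : Set H))
    (hg : Dense (Submodule.span ℂ (Set.range g) : Set H)) (S T : H →L[ℂ] K)
    (h : ∀ x y, ⟪S (f x), T (g y)⟫_ℂ = 0) (ξ η : H) : ⟪S ξ, T η⟫_ℂ = 0 := by
  have h1 : ∀ y, ContinuousLinearMap.adjoint S (T (g y)) = 0 := fun y =>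
    eq_zero_of_dense_span hf fun x => by
      rw [ContinuousLinearMap.adjoint_inner_right]; exact h x y
  have h2 : ContinuousLinearMap.adjoint S ∘L T = 0 := by
    refine ContinuousLinearMap.ext_on hg ?_
    rintro _ ⟨y, rfl⟩
    simpa using h1 y
  rw [← ContinuousLinearMap.adjoint_inner_right]
  have := DFunLike.congr_fun h2 η
  simp only [ContinuousLinearMap.comp_apply] at this
  rw [this]
  simp

section Exists

variable (s : RegularRep cQ H) (r : RegularRep c K) (hc : c.range ≤ Subgroup.center G)
  (hj : Function.Injective j) (hjc : ∀ z, j (cQ z) = c z)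
include hj hjc

theorem inner_e_map (q q' : Q) : ⟪s.e q, s.e q'⟫_ℂ = ⟪r.e (j q), r.e (j q')⟫_ℂ := by
  rw [inner_e, inner_e]
  refine s.inner_vac_congr r fun z => ?_
  rw [← hjc, ← map_inv, ← map_mul, hj.eq_iff]

-- Choose a right transversal `T` of `j(Q)` in `G`. Then `K` is the Hilbert sum of the copies of `H`
-- obtained from `W` by right translation by `t ∈ T`; on each of them `j(Q)` acts as on `H`, and
-- `amplify` is the diagonal action. Taking `1 ∈ T` makes `W` itself one of the summands.
include hc in
theorem nonempty_inclusion : Nonempty (Inclusion j s r) := by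
  classical
  let W : H →ₗᵢ[ℂ] K := gramIsometry s.e (fun q => r.e (j q)) s.dense_e
    (s.inner_e_map r hj hjc)
  have hW : ∀ q, W (s.e q) = r.e (j q) := gramIsometry_apply _ _ _ _
  obtain ⟨T, hT, h1T⟩ := j.range.exists_isComplement_right 1
  let V : T → H →ₗᵢ[ℂ] K := fun t => (r.right hc t).toLinearIsometry.comp W
  have hV : ∀ t q, V t (s.e q) = r.e (j q * t) := fun t q => by
    change r.right hc t (W (s.e q)) = _
    rw [hW, right_e]
  have hsum : IsHilbertSum ℂ (fun _ : T => H) V := by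
    refine IsHilbertSum.mk ?_ ?_
    · intro t t' htt ξ η
      refine inner_map_map_eq_zero s.dense_e s.dense_e (V t).toContinuousLinearMap
        (V t').toContinuousLinearMap (fun q q' => ?_) ξ η
      change ⟪V t (s.e q), V t' (s.e q')⟫_ℂ = 0
      rw [hV, hV]
      refine r.inner_e_eq_zero ?_
      -- Orbit vectors that are not orthogonal differ by a central phase, which can be absorbed into
      -- `q`; then `t` and `t'` represent the same coset.
      rintro ⟨z, hz⟩
      have hz' : j q' * t' = j (q * cQ z) * t := by
        rw [map_mul, hjc, mul_assoc, ← Subgroup.mem_center_iff.mp (hc ⟨z, rfl⟩), hz]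
        group
      have := hT.1 (a₁ := (⟨j q', q', rfl⟩, t')) (a₂ := (⟨j (q * cQ z), _, rfl⟩, t)) hz'
      exact htt (congrArg Prod.snd this).symm
    · rw [← Submodule.dense_iff_topologicalClosure_eq_top.mp r.dense_e]
      refine Submodule.topologicalClosure_mono (Submodule.span_le.mpr ?_)
      rintro _ ⟨g, rfl⟩
      obtain ⟨⟨⟨_, q, rfl⟩, t⟩, rfl⟩ := hT.2 g
      refine Submodule.mem_iSup_of_mem t ⟨s.e q, ?_⟩
      exact hV t q
  let Φ := hsum.linearIsometryEquiv
  have hΦ : ∀ t ξ, Φ (V t ξ) = lp.single 2 t ξ := fun t ξ => by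
    rw [← hsum.linearIsometryEquiv_symm_apply_single, LinearIsometryEquiv.apply_symm_apply]
  let A : (H →L[ℂ] H) →⋆ₐ[ℂ] (K →L[ℂ] K) :=
    (StarAlgEquiv.toStarAlgHom Φ.symm.conjStarAlgEquiv).comp (VonNeumannAlgebra.amp H T)
  have hA : ∀ x ξ, A x ξ = Φ.symm (VonNeumannAlgebra.amp H T x (Φ ξ)) := fun x ξ => rfl
  have hAV : ∀ x t ξ, A x (V t ξ) = V t (x ξ) := fun x t ξ => by
    rw [hA, hΦ, amp_single, ← hΦ, LinearIsometryEquiv.symm_apply_apply]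
  have hV1 : ∀ ξ, V ⟨1, h1T⟩ ξ = W ξ := by
    intro ξ
    have : (V ⟨1, h1T⟩).toContinuousLinearMap = W.toContinuousLinearMap := by
      refine ContinuousLinearMap.ext_on s.dense_e ?_
      rintro _ ⟨q, rfl⟩
      change V _ (s.e q) = W (s.e q)
      rw [hV, hW, mul_one]
    exact DFunLike.congr_fun this ξ
  refine ⟨⟨W, A, hW, fun q => ?_, fun x ξ => ?_, fun N ξ η => ?_⟩⟩
  · refine ContinuousLinearMap.ext_on r.dense_e ?_
    rintro _ ⟨g, rfl⟩
    obtain ⟨⟨⟨_, q', rfl⟩, t⟩, rfl⟩ := hT.2 g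
    change A _ (r.e (j q' * t)) = (r.lam (j q) : K →L[ℂ] K) (r.e (j q' * t))
    rw [← hV, hAV, s.lam_e, hV, hV, r.lam_e, map_mul, mul_assoc]
  · rw [← hV1, hAV, hV1]
  · have := isSigmaWeaklyContinuous_of_amp N (Φ ξ) (Φ η)
    refine cast (congrArg _ (funext fun x => ?_)) this
    rw [hA, ← Φ.inner_map_map ξ, LinearIsometryEquiv.apply_symm_apply]

end Exists

namespace Inclusion

variable {s : RegularRep cQ H} {r : RegularRep c K} (I : Inclusion j s r)

theorem W_vac : I.W s.vac = r.vac := by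
  rw [← e_one, I.W_e, map_one, e_one]

theorem W_lam (q : Q) (ξ : H) :
    I.W ((s.lam q : H →L[ℂ] H) ξ) = (r.lam (j q) : K →L[ℂ] K) (I.W ξ) := by
  rw [← I.amplify_W, I.amplify_lam]

theorem compress_lam (q : Q) : compress I.W (r.lam (j q)) = s.lam q := by
  refine clm_ext_inner fun ξ η => ?_
  rw [inner_compress, ← I.W_lam, LinearIsometry.inner_map_map]

/-- The range of `W` is spanned by the orbit over `j(Q)`, and `g` moves it to the orbit over `g
j(Q)`. These are disjoint unions of circle cosets, since `j(Q)` contains the circle. -/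
theorem compress_lam_eq_zero (hjc : ∀ z, j (cQ z) = c z) {g : G} (hg : g ∉ j.range) :
    compress I.W (r.lam g) = 0 := by
  refine clm_ext_inner fun ξ η => ?_
  rw [inner_compress]
  have := inner_map_map_eq_zero s.dense_e s.dense_e I.W.toContinuousLinearMap
    ((r.lam g : K →L[ℂ] K) ∘L I.W.toContinuousLinearMap) (fun q q' => ?_) ξ η
  · simpa using this
  · change ⟪I.W (s.e q), (r.lam g : K →L[ℂ] K) (I.W (s.e q'))⟫_ℂ = 0
    rw [I.W_e, I.W_e, lam_e]
    refine r.inner_e_eq_zero ?_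
    rintro ⟨z, hz⟩
    refine hg ⟨q * cQ z * q'⁻¹, ?_⟩
    rw [map_mul, map_mul, hjc, hz, map_inv]
    group

variable (j r) in
/-- The operators of the subgroup. -/
def subOps : Submonoid (K →L[ℂ] K) :=
  MonoidHom.mrange (((unitary (K →L[ℂ] K)).subtype.comp r.lam).comp j)

theorem star_mem_subOps : ∀ x ∈ subOps j r, star x ∈ subOps j r := by
  rintro _ ⟨q, rfl⟩
  refine ⟨q⁻¹, ?_⟩
  simp only [MonoidHom.comp_apply, map_inv]
  rfl

variable (j r) in
/-- The von Neumann algebra generated by the operators of the subgroup. -/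
def subAlg : VonNeumannAlgebra K := generatedBy (subOps j r : Set (K →L[ℂ] K))

theorem subAlg_le : subAlg j r ≤ r.vN :=
  generatedBy_mono (by rintro _ ⟨q, rfl⟩; exact ⟨j q, rfl⟩)

/-- For `y` commuting with the operators of the subgroup, the coefficients of `y * amplify x` and
`amplify x * y` are `σ`-weakly continuous in `x` and agree on the group operators. -/
theorem amplify_mem {x : H →L[ℂ] H} (hx : x ∈ s.vN) : I.amplify x ∈ subAlg j r := by
  refine mem_generatedBy_iff.mpr fun y hy => clm_ext_inner fun ξ η => ?_
  have h1 := I.normal s.vN (ContinuousLinearMap.adjoint y ξ) η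
  have h2 := I.normal s.vN ξ (y η)
  have := h1.ext_of_generatedBy h2 s.ops s.star_mem_ops rfl (by
    rintro ⟨_, hq⟩ ⟨q, rfl⟩
    change ⟪ContinuousLinearMap.adjoint y ξ, I.amplify (s.lam q) η⟫_ℂ =
      ⟪ξ, I.amplify (s.lam q) (y η)⟫_ℂ
    rw [I.amplify_lam, ContinuousLinearMap.adjoint_inner_left]
    have := DFunLike.congr_fun (hy _ ⟨q, rfl⟩).1 η
    exact congrArg _ this.symm) ⟨x, hx⟩
  rw [ContinuousLinearMap.adjoint_inner_left] at this
  exact this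

/-- The same comparison of normal functionals; group operators outside `j(Q)` contribute zero to
both sides. -/
theorem compress_mem (hjc : ∀ z, j (cQ z) = c z) {x : K →L[ℂ] K} (hx : x ∈ r.vN) :
    compress I.W x ∈ s.vN := by
  refine mem_generatedBy_iff.mpr fun y hy => clm_ext_inner fun ξ η => ?_
  have h1 := isSigmaWeaklyContinuous_inner r.vN (I.W (ContinuousLinearMap.adjoint y ξ)) (I.W η)
  have h2 := isSigmaWeaklyContinuous_inner r.vN (I.W ξ) (I.W (y η))
  have := h1.ext_of_generatedBy h2 r.ops r.star_mem_ops rfl (by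
    rintro ⟨_, hq⟩ ⟨g, rfl⟩
    change ⟪I.W (ContinuousLinearMap.adjoint y ξ), (r.lam g : K →L[ℂ] K) (I.W η)⟫_ℂ =
      ⟪I.W ξ, (r.lam g : K →L[ℂ] K) (I.W (y η))⟫_ℂ
    rw [← inner_compress, ← inner_compress, ContinuousLinearMap.adjoint_inner_left]
    by_cases hg : g ∈ j.range
    · obtain ⟨q, rfl⟩ := hg
      rw [compress_lam]
      exact congrArg _ (DFunLike.congr_fun (hy _ ⟨q, rfl⟩).1 η).symm
    · rw [I.compress_lam_eq_zero hjc hg]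
      simp) ⟨x, hx⟩
  rw [mul_apply_eq_comp, mul_apply_eq_comp, inner_compress, ← this, ← inner_compress,
    ContinuousLinearMap.adjoint_inner_left]

/-- The embedding of the von Neumann algebra of the subgroup. -/
def embed : s.vN.toStarSubalgebra →⋆ₐ[ℂ] r.vN.toStarSubalgebra where
  toFun x := ⟨I.amplify x, subAlg_le (I.amplify_mem x.2)⟩
  map_one' := Subtype.ext (map_one I.amplify)
  map_mul' _ _ := Subtype.ext (map_mul I.amplify _ _)
  map_zero' := Subtype.ext (map_zero I.amplify)
  map_add' _ _ := Subtype.ext (map_add I.amplify _ _)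
  commutes' a := Subtype.ext (I.amplify.commutes' a)
  map_star' _ := Subtype.ext (map_star I.amplify _)

/-- The conditional expectation onto the von Neumann algebra of the subgroup. -/
def expect (hjc : ∀ z, j (cQ z) = c z) :
    r.vN.toStarSubalgebra →ₗ[ℂ] s.vN.toStarSubalgebra where
  toFun x := ⟨compress I.W x, I.compress_mem hjc x.2⟩
  map_add' _ _ := Subtype.ext (map_add (compress I.W) _ _)
  map_smul' _ _ := Subtype.ext (map_smul (compress I.W) _ _)

theorem compress_bimodule (a b : H →L[ℂ] H) (x : K →L[ℂ] K) :
    compress I.W (I.amplify a * x * I.amplify b) = a * compress I.W x * b := by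
  refine clm_ext_inner fun ξ η => ?_
  rw [inner_compress, mul_apply_eq_comp, mul_apply_eq_comp, mul_apply_eq_comp, mul_apply_eq_comp,
    I.amplify_W, ← ContinuousLinearMap.adjoint_inner_left,
    ← ContinuousLinearMap.adjoint_inner_left a, inner_compress,
    ← ContinuousLinearMap.star_eq_adjoint, ← map_star, I.amplify_W]
  rfl

theorem compress_amplify (a : H →L[ℂ] H) : compress I.W (I.amplify a) = a := by
  refine clm_ext_inner fun ξ η => ?_
  rw [inner_compress, I.amplify_W, LinearIsometry.inner_map_map]

theorem compress_star_mul_self_isPositive (W : H →ₗᵢ[ℂ] K) (x : K →L[ℂ] K) :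
    (compress W (star x * x)).IsPositive := by
  have : compress W (star x * x) = ContinuousLinearMap.adjoint (x ∘L W.toContinuousLinearMap) ∘L
      (x ∘L W.toContinuousLinearMap) := by
    refine clm_ext_inner fun ξ η => ?_
    rw [inner_compress, ContinuousLinearMap.comp_apply, ContinuousLinearMap.adjoint_inner_right, mul_apply_eq_comp,
      ContinuousLinearMap.star_eq_adjoint, ContinuousLinearMap.adjoint_inner_right]
    rfl
  rw [this]
  exact ContinuousLinearMap.isPositive_adjoint_comp_self _

/-- The vacuum coefficient of `W* x* x W` is the squared norm of `x` applied to the vacuum, and the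
vacuum is separating. -/
theorem eq_zero_of_compress (hc : c.range ≤ Subgroup.center G) {x : K →L[ℂ] K} (hx : x ∈ r.vN)
    (h : compress I.W (star x * x) = 0) : x = 0 := by
  refine r.eq_zero_of_apply_vac hc hx ?_
  have h1 := inner_compress I.W (star x * x) s.vac s.vac
  rw [h, I.W_vac, mul_apply_eq_comp, ContinuousLinearMap.star_eq_adjoint,
    ContinuousLinearMap.adjoint_inner_right] at h1
  simpa using h1.symm

theorem isConditionalExpectation (hc : c.range ≤ Subgroup.center G)
    (hjc : ∀ z, j (cQ z) = c z) :
    IsConditionalExpectation r.vN s.vN I.embed (I.expect hjc) where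
  map_embedding _ := Subtype.ext (I.compress_amplify _)
  bimodule _ _ _ := Subtype.ext (I.compress_bimodule _ _ _)
  positive x := compress_star_mul_self_isPositive I.W (x : K →L[ℂ] K)
  faithful x hx := Subtype.ext (I.eq_zero_of_compress hc x.2 (congrArg Subtype.val hx))
  normal ξ η := (isSigmaWeaklyContinuous_inner s.vN ξ η).comp_compress I.W _ fun _ => rfl

theorem embed_normal : IsNormalMap s.vN r.vN I.embed := fun ξ η => I.normal s.vN ξ η

theorem amplify_compress (hjc : ∀ z, j (cQ z) = c z) {x : K →L[ℂ] K} (hx : x ∈ subAlg j r) :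
    I.amplify (compress I.W x) = x := by
  refine clm_ext_inner fun ξ η => ?_
  have h1 := (I.normal s.vN ξ η).comp_compress (M := subAlg j r) I.W
    (fun x => ⟨compress I.W x, I.compress_mem hjc (subAlg_le x.2)⟩) fun _ => rfl
  have h2 := isSigmaWeaklyContinuous_inner (subAlg j r) ξ η
  refine h1.ext_of_generatedBy h2 (subOps j r) star_mem_subOps rfl ?_ ⟨x, hx⟩
  rintro ⟨_, hq⟩ ⟨q, rfl⟩
  change ⟪ξ, I.amplify (compress I.W (r.lam (j q))) η⟫_ℂ = ⟪ξ, (r.lam (j q) : K →L[ℂ] K) η⟫_ℂ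
  rw [compress_lam, amplify_lam]

/-- The von Neumann algebra of the subgroup is the one generated by its operators. -/
def equivSubAlg (hjc : ∀ z, j (cQ z) = c z) :
    s.vN.toStarSubalgebra ≃⋆ₐ[ℂ] (subAlg j r).toStarSubalgebra where
  toFun x := ⟨I.amplify x, I.amplify_mem x.2⟩
  invFun x := ⟨compress I.W x, I.compress_mem hjc (subAlg_le x.2)⟩
  left_inv _ := Subtype.ext (I.compress_amplify _)
  right_inv x := Subtype.ext (I.amplify_compress hjc x.2)
  map_mul' _ _ := Subtype.ext (map_mul I.amplify _ _)
  map_add' _ _ := Subtype.ext (map_add I.amplify _ _)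
  map_smul' _ _ := Subtype.ext (map_smul I.amplify _ _)
  map_star' _ := Subtype.ext (map_star I.amplify _)

theorem amplify_isPositive {x : H →L[ℂ] H} (hx : x.IsPositive) : (I.amplify x).IsPositive := by
  rw [← ContinuousLinearMap.nonneg_iff_isPositive] at hx ⊢
  exact map_nonneg I.amplify hx

/-- The conditional expectation of the von Neumann algebra of the group onto the subalgebra
generated by the operators of the subgroup. -/
def subExpect (hjc : ∀ z, j (cQ z) = c z) :
    r.vN.toStarSubalgebra →ₗ[ℂ] (subAlg j r).toStarSubalgebra where
  toFun x := ⟨I.amplify (compress I.W x), I.amplify_mem (I.compress_mem hjc x.2)⟩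
  map_add' x y := Subtype.ext (by simp)
  map_smul' a x := Subtype.ext (by simp)

theorem inner_subExpect (hjc : ∀ z, j (cQ z) = c z) (x : r.vN.toStarSubalgebra) :
    ⟪r.vac, (I.subExpect hjc x : K →L[ℂ] K) r.vac⟫_ℂ = ⟪r.vac, (x : K →L[ℂ] K) r.vac⟫_ℂ := by
  change ⟪r.vac, I.amplify (compress I.W x) r.vac⟫_ℂ = _
  rw [← I.W_vac, I.amplify_W, LinearIsometry.inner_map_map, inner_compress]

theorem isConditionalExpectation_subExpect (hc : c.range ≤ Subgroup.center G)
    (hjc : ∀ z, j (cQ z) = c z) :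
    IsConditionalExpectation r.vN (subAlg j r)
      (StarSubalgebra.inclusion (show (subAlg j r).toStarSubalgebra ≤ r.vN.toStarSubalgebra from
        subAlg_le)) (I.subExpect hjc) where
  map_embedding n := Subtype.ext (I.amplify_compress hjc n.2)
  bimodule a x b := Subtype.ext (by
    have ha := I.amplify_compress hjc a.2
    have hb := I.amplify_compress hjc b.2
    change I.amplify (compress I.W ((a : K →L[ℂ] K) * x * b)) =
      (a : K →L[ℂ] K) * I.amplify (compress I.W x) * b
    rw [← ha, ← hb, I.compress_bimodule, map_mul, map_mul, ha, hb])
  positive x := I.amplify_isPositive (compress_star_mul_self_isPositive I.W (x : K →L[ℂ] K))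
  faithful x hx := Subtype.ext (I.eq_zero_of_compress hc x.2 (by
    have h := congrArg (compress I.W) (congrArg Subtype.val hx)
    change compress I.W (I.amplify (compress I.W _)) = compress I.W 0 at h
    rwa [I.compress_amplify, map_zero] at h))
  normal ξ η := (I.normal s.vN ξ η).comp_compress (M := r.vN) I.W
    (fun x => ⟨compress I.W x, I.compress_mem hjc x.2⟩) fun _ => rfl

end Inclusion

end RegularRep
end

/-! ### Reduced words in HNN extensions of groups and disjoint conjugates -/

noncomputable section

namespace HNNExtension

variable {G : Type*} [Group G] {A B : Subgroup G} {φ : A ≃* B}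

variable (φ) in
/-- `t` for `true` and `t⁻¹` for `false`. -/
def tPow : Bool → HNNExtension G A B φ
  | true => t
  | false => t⁻¹

theorem tPow_not (ε : Bool) : tPow φ (!ε) = (tPow φ ε)⁻¹ := by
  cases ε <;> simp [tPow]

variable (A B) in
/-- `t^ε n t^ε'` has no cancellation. -/
def NoCancel (ε : Bool) (n : G) (ε' : Bool) : Prop :=
  (ε = true → ε' = false → n ∉ A) ∧ (ε = false → ε' = true → n ∉ B)

theorem NoCancel.inv {ε ε' : Bool} {n : G} (h : NoCancel A B ε n ε') :
    NoCancel A B (!ε') n⁻¹ (!ε) := by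
  refine ⟨fun h1 h2 => ?_, fun h1 h2 => ?_⟩
  · rw [inv_mem_iff]; exact h.1 (by simpa using h2) (by simpa using h1)
  · rw [inv_mem_iff]; exact h.2 (by simpa using h2) (by simpa using h1)

variable (φ) in
/-- The elements `t^ε n₁ ⋯ nₗ t^δ` given by reduced words. -/
inductive IsTWord : Bool → Bool → HNNExtension G A B φ → Prop
  | base (ε : Bool) : IsTWord ε ε (tPow φ ε)
  | cons {ε ε' δ : Bool} {n : G} {g : HNNExtension G A B φ} (h : NoCancel A B ε n ε')
      (hg : IsTWord ε' δ g) : IsTWord ε δ (tPow φ ε * of n * g)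

namespace IsTWord

theorem snoc {ε δ δ' : Bool} {g : HNNExtension G A B φ} (hg : IsTWord φ ε δ g) {n : G}
    (h : NoCancel A B δ n δ') : IsTWord φ ε δ' (g * of n * tPow φ δ') := by
  induction hg with
  | base ε => exact cons h (base δ')
  | @cons ε ε' δ m k h1 hg ih =>
    have := cons h1 (ih h)
    simpa only [mul_assoc] using this

theorem inv {ε δ : Bool} {g : HNNExtension G A B φ} (hg : IsTWord φ ε δ g) :
    IsTWord φ (!δ) (!ε) g⁻¹ := by
  induction hg with
  | base ε => rw [← tPow_not]; exact base _
  | @cons ε ε' δ m k h1 hg ih =>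
    have := ih.snoc h1.inv
    rwa [tPow_not, map_inv, mul_assoc, ← mul_inv_rev, ← mul_inv_rev] at this

/-- `±1` as a unit of `ℤ`. -/
def sgn : Bool → ℤˣ
  | true => 1
  | false => -1

theorem t_zpow_sgn (ε : Bool) : (t : HNNExtension G A B φ) ^ (sgn ε : ℤ) = tPow φ ε := by
  cases ε <;> simp [sgn, tPow]

/-- The syllables of `NormalWord.ReducedWord` have the form `t^{±1} g`, so a word ending in `t^{±1}`
needs a last group element; `m` fills that place. -/
theorem exists_list {ε δ : Bool} {g : HNNExtension G A B φ} (hg : IsTWord φ ε δ g) (m : G) :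
    ∃ l : List (ℤˣ × G),
      l.IsChain (fun a b => a.2 ∈ toSubgroup A B a.1 → a.1 = b.1) ∧
      l.head?.map Prod.fst = some (sgn ε) ∧
      (l.map (fun x => (t : HNNExtension G A B φ) ^ (x.1 : ℤ) * of x.2)).prod = g * of m := by
  induction hg with
  | base ε => exact ⟨[(sgn ε, m)], by simp, by simp, by simp [t_zpow_sgn]⟩
  | @cons ε ε' δ n k h1 hg ih =>
    obtain ⟨l, hl, hh, hp⟩ := ih
    refine ⟨(sgn ε, n) :: l, ?_, by simp, by simp [hp, t_zpow_sgn, mul_assoc]⟩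
    cases l with
    | nil => simp at hh
    | cons x l =>
      refine List.isChain_cons_cons.mpr ⟨fun hn => ?_, hl⟩
      have hx : x.1 = sgn ε' := by simpa using hh
      rw [hx]
      cases ε <;> cases ε' <;> try rfl
      · exact absurd hn (h1.2 rfl rfl)
      · exact absurd hn (h1.1 rfl rfl)

theorem exists_reducedWord {ε δ : Bool} {g : HNNExtension G A B φ} (hg : IsTWord φ ε δ g)
    (n m : G) : ∃ w : NormalWord.ReducedWord G A B, w.head = n ∧
      w.toList.head?.map Prod.fst = some (sgn ε) ∧ w.prod φ = of n * g * of m := by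
  obtain ⟨l, hl, hh, hp⟩ := hg.exists_list m
  refine ⟨⟨n, l, hl⟩, rfl, hh, ?_⟩
  rw [NormalWord.ReducedWord.prod, hp, mul_assoc]

/-- Uniqueness of normal forms: reduced words of the same element have the same exponents, and their
first letters differ by an element that can be moved across the first power of `t`. -/
theorem head_unique {ε δ ε' δ' : Bool} {g g' : HNNExtension G A B φ} (hg : IsTWord φ ε δ g)
    (hg' : IsTWord φ ε' δ' g') {n m n' m' : G}
    (h : of n * g * of m = of n' * g' * of m') :
    ε = ε' ∧ n⁻¹ * n' ∈ toSubgroup A B (-sgn ε) := by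
  obtain ⟨w, hw, hh, hp⟩ := hg.exists_reducedWord n m
  obtain ⟨w', hw', hh', hp'⟩ := hg'.exists_reducedWord n' m'
  obtain ⟨h1, h2⟩ := ReducedWord.map_fst_eq_and_of_prod_eq φ (w₁ := w) (w₂ := w')
    (by rw [hp, hp', h])
  constructor
  · have := congrArg List.head? h1
    rw [List.head?_map, List.head?_map, hh, hh'] at this
    cases ε <;> cases ε' <;> simp_all [sgn]
  · have := h2 (sgn ε) (by simp [hh])
    rwa [hw, hw'] at this

/-- Britton's lemma. -/
theorem notMem_range {ε δ : Bool} {g : HNNExtension G A B φ} (hg : IsTWord φ ε δ g) (n m : G) :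
    of n * g * of m ∉ (of : G →* HNNExtension G A B φ).range := by
  intro h
  obtain ⟨w, hw, hh, hp⟩ := hg.exists_reducedWord n m
  rw [← hp] at h
  have := ReducedWord.toList_eq_nil_of_mem_of_range φ w h
  simp [this] at hh

end IsTWord

/-- Exactly the non-reduced pieces are collapsed into the base group by the defining relation. -/
theorem tPow_mul_of (ε : Bool) (n : G) (h : ¬ NoCancel A B ε n (!ε)) :
    ∃ m, tPow φ ε * of n * (tPow φ ε)⁻¹ = of m := by
  cases ε
  · have hn : n ∈ B := by simpa [NoCancel] using h
    refine ⟨_, Eq.trans ?_ (equiv_symm_eq_conj (φ := φ) ⟨n, hn⟩).symm⟩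
    simp [tPow]
  · have hn : n ∈ A := by simpa [NoCancel] using h
    exact ⟨_, (equiv_eq_conj ⟨n, hn⟩).symm⟩

theorem noCancel_self (ε : Bool) (n : G) : NoCancel A B ε n ε := by
  cases ε <;> simp [NoCancel]

/-- The elements with a reduced word of positive length. -/
def IsProper (g : HNNExtension G A B φ) : Prop :=
  ∃ ε δ k n m, IsTWord φ ε δ k ∧ g = of n * k * of m

theorem tPow_mul_cases (ε : Bool) {g : HNNExtension G A B φ}
    (hg : g ∈ (of : G →* HNNExtension G A B φ).range ∨ IsProper g) :
    tPow φ ε * g ∈ (of : G →* HNNExtension G A B φ).range ∨ IsProper (tPow φ ε * g) := by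
  rcases hg with ⟨n, rfl⟩ | ⟨ε', δ, k, n, m, hk, rfl⟩
  · exact Or.inr ⟨ε, ε, _, 1, n, .base ε, by simp⟩
  · by_cases h : NoCancel A B ε n ε'
    · exact Or.inr ⟨ε, δ, _, 1, m, .cons h hk, by simp [mul_assoc]⟩
    · have hε : ε' = !ε := by
        by_contra hne
        have : ε' = ε := by cases ε <;> cases ε' <;> simp_all
        exact h (this ▸ noCancel_self ε' n)
      subst hε
      obtain ⟨p, hp⟩ := tPow_mul_of (φ := φ) ε n h
      cases hk with
      | base =>
        refine Or.inl ⟨p * m, ?_⟩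
        rw [map_mul, ← hp, tPow_not]
        simp only [mul_assoc]
      | @cons _ ε'' _ m' k' h1 hk' =>
        refine Or.inr ⟨_, _, k', p * m', m, hk', ?_⟩
        rw [map_mul, ← hp, tPow_not]
        simp only [mul_assoc]

theorem mem_range_or_isProper (g : HNNExtension G A B φ) :
    g ∈ (of : G →* HNNExtension G A B φ).range ∨ IsProper g := by
  suffices H : ∀ h : HNNExtension G A B φ,
      h ∈ (of : G →* HNNExtension G A B φ).range ∨ IsProper h →
      (g * h) ∈ (of : G →* HNNExtension G A B φ).range ∨ IsProper (g * h) by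
    have := H 1 (Or.inl (one_mem _))
    rwa [mul_one] at this
  -- Asking the property of `g` and `g⁻¹` together, for all `h`, makes it define a subgroup, so it
  -- need only be checked on the base group and on `t`.
  let P : Subgroup (HNNExtension G A B φ) :=
    { carrier := {g | ∀ h : HNNExtension G A B φ,
        (h ∈ (of : G →* HNNExtension G A B φ).range ∨ IsProper h →
          (g * h) ∈ (of : G →* HNNExtension G A B φ).range ∨ IsProper (g * h)) ∧
        (h ∈ (of : G →* HNNExtension G A B φ).range ∨ IsProper h →
          (g⁻¹ * h) ∈ (of : G →* HNNExtension G A B φ).range ∨ IsProper (g⁻¹ * h))}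
      one_mem' := fun h => by simp
      mul_mem' := fun {a b} ha hb h => by
        refine ⟨fun hh => ?_, fun hh => ?_⟩
        · rw [mul_assoc]; exact (ha _).1 ((hb _).1 hh)
        · rw [mul_inv_rev, mul_assoc]; exact (hb _).2 ((ha _).2 hh)
      inv_mem' := fun {a} ha h => ⟨(ha h).2, by simpa using (ha h).1⟩ }
  have hof : ∀ n : G, ∀ h : HNNExtension G A B φ,
      h ∈ (of : G →* HNNExtension G A B φ).range ∨ IsProper h →
      of n * h ∈ (of : G →* HNNExtension G A B φ).range ∨ IsProper (of n * h) := by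
    rintro n _ (⟨m, rfl⟩ | ⟨ε, δ, k, n', m, hk, rfl⟩)
    · exact Or.inl ⟨n * m, by simp⟩
    · exact Or.inr ⟨ε, δ, k, n * n', m, hk, by simp [mul_assoc]⟩
  have hP : g ∈ P := by
    induction g using HNNExtension.induction_on with
    | of n => exact fun h => ⟨hof n h, by rw [← map_inv]; exact hof n⁻¹ h⟩
    | t => exact fun h => ⟨tPow_mul_cases true, tPow_mul_cases false⟩
    | mul x y hx hy => exact P.mul_mem hx hy
    | inv x hx => exact P.inv_mem hx
  exact fun h => (hP h).1

/-- The elements with a reduced word `n t^ε ⋯`, where `n` can be moved across `t^ε`. -/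
def startsWith (ε : Bool) : Set (HNNExtension G A B φ) :=
  {g | ∃ δ k n m, IsTWord φ ε δ k ∧ n ∈ toSubgroup A B (-IsTWord.sgn ε) ∧
    g = of n * k * of m}

/-- In an ideal of subsets of an HNN extension which is invariant under conjugation and contains
the sets with infinitely many disjoint conjugates, the complement of `A ⊓ B` is contained. -/
theorem null_compl_inf {Null : Set (HNNExtension G A B φ) → Prop}
    (mono : ∀ S T, S ⊆ T → Null T → Null S)
    (union : ∀ S T, Null S → Null T → Null (S ∪ T))
    (conj : ∀ S k, Null S → Null {g | k⁻¹ * g * k ∈ S})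
    (disj : ∀ S : Set (HNNExtension G A B φ), (∀ g ∈ S, ∀ z ∈ A ⊓ B, g * of z ∈ S) →
      (∃ k : ℕ → HNNExtension G A B φ, ∀ i j, i ≠ j → ∀ g,
        (k i)⁻¹ * g * k i ∈ S → (k j)⁻¹ * g * k j ∉ S) → Null S)
    (hZ : ∀ z ∈ A ⊓ B, of z ∈ Subgroup.center (HNNExtension G A B φ))
    (hA : ∃ a : ℕ → G, ∀ i j, i ≠ j → (a i)⁻¹ * a j ∉ A)
    (hB : ∃ b : ℕ → G, ∀ i j, i ≠ j → (b i)⁻¹ * b j ∉ B) :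
    Null {g | ∀ z ∈ A ⊓ B, g ≠ of z} := by
  -- The sign `-sgn ε` selects the subgroup that can be moved across `t^ε`: `B` for `t`, `A` for
  -- `t⁻¹`.
  have hAB : ∀ ε : Bool, ∃ a : ℕ → G, ∀ i j, i ≠ j →
      a i * (a j)⁻¹ ∉ toSubgroup A B (-IsTWord.sgn ε) := by
    rintro (_ | _)
    · obtain ⟨a, ha⟩ := hA
      exact ⟨fun i => (a i)⁻¹, fun i j hij => by simpa [IsTWord.sgn] using ha i j hij⟩
    · obtain ⟨a, ha⟩ := hB
      exact ⟨fun i => (a i)⁻¹, fun i j hij => by simpa [IsTWord.sgn] using ha i j hij⟩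
  -- An element of the `i`-th conjugate has a reduced word whose first letter lies in the left coset
  -- of `(a i)⁻¹`. By `head_unique` the element determines this coset, so the conjugates are
  -- disjoint.
  have key : ∀ (ε : Bool) (a : ℕ → G),
      (∀ i j, i ≠ j → a i * (a j)⁻¹ ∉ toSubgroup A B (-IsTWord.sgn ε)) →
      ∀ i j, i ≠ j → ∀ g : HNNExtension G A B φ,
      (of (a i)⁻¹)⁻¹ * g * of (a i)⁻¹ ∈ startsWith (φ := φ) ε →
      (of (a j)⁻¹)⁻¹ * g * of (a j)⁻¹ ∉ startsWith (φ := φ) ε := by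
    rintro ε a ha i j hij g ⟨δ, k, n, m, hk, hn, h⟩ ⟨δ', k', n', m', hk', hn', h'⟩
    have e1 : g = of ((a i)⁻¹ * n) * k * of (m * a i) := by
      have : g = of (a i)⁻¹ * (of n * k * of m) * of (a i) := by rw [← h, map_inv]; group
      simpa [mul_assoc] using this
    have e2 : g = of ((a j)⁻¹ * n') * k' * of (m' * a j) := by
      have : g = of (a j)⁻¹ * (of n' * k' * of m') * of (a j) := by rw [← h', map_inv]; group
      simpa [mul_assoc] using this
    have := (hk.head_unique hk' (e1.symm.trans e2)).2
    refine ha i j hij ?_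
    have h3 := mul_mem (mul_mem hn this) (inv_mem hn')
    simpa [mul_assoc] using h3
  have hst : ∀ ε, Null (startsWith (φ := φ) ε) := by
    intro ε
    obtain ⟨a, ha⟩ := hAB ε
    refine disj _ ?_ ⟨fun i => of (a i)⁻¹, key ε a ha⟩
    rintro _ ⟨δ, k, n, m, hk, hn, rfl⟩ z -
    exact ⟨δ, k, n, m * z, hk, hn, by simp [mul_assoc]⟩
  -- The same conjugators serve for the inverses. Centrality of `A ⊓ B` is what keeps this set
  -- stable under right multiplication by it.
  have hinv : Null {g | g⁻¹ ∈ startsWith (φ := φ) true} := by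
    obtain ⟨a, ha⟩ := hAB true
    refine disj _ ?_ ⟨fun i => of (a i)⁻¹, fun i j hij g h1 h2 => ?_⟩
    · rintro g ⟨δ, k, n, m, hk, hn, h⟩ z hz
      refine ⟨δ, k, n, m * z⁻¹, hk, hn, ?_⟩
      rw [mul_inv_rev, h, map_mul, ← map_inv,
        ← Subgroup.mem_center_iff.mp (hZ z⁻¹ (inv_mem hz)) (of n * k * of m)]
      simp only [mul_assoc]
    · refine key true a ha i j hij g⁻¹ ?_ ?_
      · simpa [mul_assoc] using h1
      · simpa [mul_assoc] using h2
  -- Three cases: the word begins with an element of `B` followed by `t`; its inverse does; or `t⁻¹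
  -- g t` is still reduced and begins with `t⁻¹`.
  have hprop : Null {g : HNNExtension G A B φ | IsProper g} := by
    refine mono _ _ ?_ (union _ _ (union _ _ (hst true) hinv) (conj _ t (hst false)))
    rintro _ ⟨ε, δ, k, n, m, hk, rfl⟩
    by_cases h1 : NoCancel A B false n ε
    · by_cases h2 : NoCancel A B δ m true
      · refine Or.inr ⟨true, _, 1, 1, (IsTWord.cons h1 hk).snoc h2, one_mem _, ?_⟩
        simp [tPow, mul_assoc]
      · refine Or.inl (Or.inr ?_)
        have hδ : δ = false := by
          cases δ
          · rfl
          · exact absurd (noCancel_self true m) h2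
        have hm : m ∈ B := by simpa [NoCancel, hδ] using h2
        have hk' := hk.inv
        rw [hδ] at hk'
        exact ⟨_, _, m⁻¹, n⁻¹, hk', inv_mem hm, by simp [mul_assoc]⟩
    · refine Or.inl (Or.inl ?_)
      have hε : ε = true := by
        cases ε
        · exact absurd (noCancel_self false n) h1
        · rfl
      have hn : n ∈ B := by simpa [NoCancel, hε] using h1
      rw [hε] at hk
      exact ⟨_, _, n, m, hk, hn, rfl⟩
  have hof : Null {g | g ∉ (of : G →* HNNExtension G A B φ).range} := by
    refine mono _ _ (fun g hg => ?_) hprop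
    exact (mem_range_or_isProper g).resolve_left hg
  -- A base element `n` outside `A ⊓ B` becomes proper after one conjugation: `t⁻¹ n t` if `n ∉ B`,
  -- and `t n t⁻¹` if `n ∈ B` but `n ∉ A`.
  refine mono _ _ ?_ (union _ _ hof (union _ _ (conj _ t hprop) (conj _ t⁻¹ hprop)))
  intro g hg
  by_cases hr : g ∈ (of : G →* HNNExtension G A B φ).range
  · obtain ⟨n, rfl⟩ := hr
    refine Or.inr ?_
    by_cases hn : n ∈ B
    · have hA' : n ∉ A := fun h => hg n ⟨h, hn⟩ rfl
      refine Or.inr ⟨true, false, _, 1, 1, .cons (n := n) ?_ (.base false), ?_⟩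
      · simpa [NoCancel] using hA'
      · simp [tPow, mul_assoc]
    · refine Or.inl ⟨false, true, _, 1, 1, .cons (n := n) ?_ (.base true), ?_⟩
      · simpa [NoCancel] using hn
      · simp [tPow, mul_assoc]
  · exact Or.inl hr

end HNNExtension
end

/-! ### The non-commutative torus as a twisted representation of the Heisenberg group -/

noncomputable section

namespace VonNeumannAlgebra

variable {H : Type*} [NormedAddCommGroup H] [InnerProductSpace ℂ H] [CompleteSpace H]

theorem isClosed_coe (N : VonNeumannAlgebra H) : IsClosed (N : Set (H →L[ℂ] H)) := by
  rw [← N.centralizer_centralizer]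
  exact Set.isClosed_centralizer _

theorem apply_mem_closure (S : Submonoid (H →L[ℂ] H)) (hS : ∀ s ∈ S, star s ∈ S)
    {x : H →L[ℂ] H} (hx : x ∈ generatedBy (S : Set (H →L[ℂ] H))) (ξ : H) :
    x ξ ∈ (Submodule.span ℂ ((fun s : H →L[ℂ] H => s ξ) '' S)).topologicalClosure := by
  have h := amp_mem_closure S hS hx (lp.single (E := fun _ : Unit => H) 2 () ξ)
  have hle : (Submodule.span ℂ ((fun s => amp H Unit s
      (lp.single (E := fun _ : Unit => H) 2 () ξ)) '' S)).topologicalClosure ≤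
      ((Submodule.span ℂ ((fun s : H →L[ℂ] H => s ξ) '' S)).topologicalClosure).comap
        (lp.evalCLM ℂ (fun _ : Unit => H) 2 () : _ →ₗ[ℂ] _) := by
    refine Submodule.topologicalClosure_minimal _ ?_ ?_
    · rw [Submodule.span_le]
      rintro _ ⟨s, hs, rfl⟩
      refine Submodule.le_topologicalClosure _ (Submodule.subset_span ⟨s, hs, ?_⟩)
      change _ = amp H Unit s (lp.single (E := fun _ : Unit => H) 2 () ξ) ()
      simp
    · exact (Submodule.isClosed_topologicalClosure _).preimage
        (lp.evalCLM ℂ (fun _ : Unit => H) 2 ()).continuous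
  have h2 := hle h
  have h3 : x ξ = lp.evalCLM ℂ (fun _ : Unit => H) 2 ()
      (amp H Unit x (lp.single (E := fun _ : Unit => H) 2 () ξ)) := by
    change _ = amp H Unit x (lp.single (E := fun _ : Unit => H) 2 () ξ) ()
    simp
  rw [h3]
  exact h2

end VonNeumannAlgebra

/-- Conjugation by `V` multiplies `U` by `κ⁻¹`, hence `U ^ m` by `κ ^ (-m)`; conjugating `V ^ n` by
`U ^ m` then produces the exponent `n * m`. -/
theorem zpow_commutation {𝒰 : Type*} [Group 𝒰] {U V κ : 𝒰} (hκ : κ ∈ Subgroup.center 𝒰)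
    (h : U * V = κ * (V * U)) (n m : ℤ) : V ^ n * U ^ m = κ ^ (-(n * m)) * (U ^ m * V ^ n) := by
  have hκ' : ∀ k : ℤ, ∀ x, x * κ ^ k = κ ^ k * x := fun k =>
    Subgroup.mem_center_iff.mp (zpow_mem hκ k)
  have h1 : V * U * V⁻¹ = κ⁻¹ * U := by
    rw [eq_inv_mul_iff_mul_eq, ← mul_assoc, ← h]; group
  have h2 : V * U ^ m * V⁻¹ = κ ^ (-m) * U ^ m := by
    rw [← conj_zpow, h1, Commute.mul_zpow, inv_zpow', ]
    have := hκ' (-1) U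
    rw [zpow_neg_one] at this
    exact this.symm
  have h3 : (U ^ m)⁻¹ * V * U ^ m = κ ^ (-m) * V := by
    have : V * U ^ m = κ ^ (-m) * U ^ m * V := by rw [← h2]; group
    rw [mul_assoc, this, ← mul_assoc, ← mul_assoc, hκ' (-m), mul_assoc (κ ^ (-m))]
    group
  have h4 : (U ^ m)⁻¹ * V ^ n * U ^ m = κ ^ (-(n * m)) * V ^ n := by
    have : ((U ^ m)⁻¹ * V * ((U ^ m)⁻¹)⁻¹) ^ n = (U ^ m)⁻¹ * V ^ n * ((U ^ m)⁻¹)⁻¹ :=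
      conj_zpow
    rw [inv_inv, h3, Commute.mul_zpow (hκ' (-m) V).symm, ← zpow_mul] at this
    rw [← this]
    congr 2
    ring
  have h5 : V ^ n * U ^ m = U ^ m * ((U ^ m)⁻¹ * V ^ n * U ^ m) := by group
  rw [h5, h4, ← mul_assoc, hκ', mul_assoc]

/-- The homomorphism of unitary groups induced by a unital star homomorphism. -/
def unitaryMap {A B : Type*} [Semiring A] [StarRing A] [Algebra ℂ A] [Semiring B] [StarRing B]
    [Algebra ℂ B] (f : A →⋆ₐ[ℂ] B) : unitary A →* unitary B where
  toFun x := ⟨f x, Unitary.map_mem f x.2⟩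
  map_one' := Subtype.ext (map_one f)
  map_mul' _ _ := Subtype.ext (map_mul f _ _)

namespace NCTorus

/-- The Heisenberg group with circle centre: `(z, m, n)` stands for `z uᵐ vⁿ`. -/
@[ext]
structure Heis (α : ℝ) where
  z : Circle
  m : ℤ
  n : ℤ

namespace Heis

variable {α : ℝ}

/-- The twist is the factor produced when `vⁿ` of the first element is moved past `uᵐ` of the
second; the inverse below acquires its factor in the same way. -/
instance : Mul (Heis α) := ⟨fun x y => ⟨x.z * y.z * q α ^ (-(x.n * y.m)), x.m + y.m, x.n + y.n⟩⟩
instance : One (Heis α) := ⟨⟨1, 0, 0⟩⟩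
instance : Inv (Heis α) := ⟨fun x => ⟨x.z⁻¹ * q α ^ (-(x.n * x.m)), -x.m, -x.n⟩⟩

theorem mul_def (x y : Heis α) :
    x * y = ⟨x.z * y.z * q α ^ (-(x.n * y.m)), x.m + y.m, x.n + y.n⟩ := rfl
theorem one_def : (1 : Heis α) = ⟨1, 0, 0⟩ := rfl
theorem inv_def (x : Heis α) : x⁻¹ = ⟨x.z⁻¹ * q α ^ (-(x.n * x.m)), -x.m, -x.n⟩ := rfl

instance : Group (Heis α) :=
  Group.ofLeftAxioms
    (fun x y w => by
      ext1
      · simp only [mul_def, add_mul, mul_add, neg_add, zpow_add]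
        simp only [mul_assoc, mul_left_comm, mul_comm]
      · exact add_assoc _ _ _
      · exact add_assoc _ _ _)
    (fun x => by simp [mul_def, one_def])
    (fun x => by
      ext1
      · simp only [mul_def, inv_def, one_def, neg_mul, neg_neg]
        rw [mul_assoc, mul_assoc, mul_left_comm (q α ^ _), ← zpow_add, neg_add_cancel, zpow_zero,
          mul_one, inv_mul_cancel]
      · exact neg_add_cancel _
      · exact neg_add_cancel _)

variable (α) in
/-- The central circle. -/
def circle : Circle →* Heis α where
  toFun z := ⟨z, 0, 0⟩
  map_one' := rfl
  map_mul' x y := by simp [mul_def]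

theorem mem_range_circle {x : Heis α} : x ∈ (circle α).range ↔ x.m = 0 ∧ x.n = 0 := by
  constructor
  · rintro ⟨z, rfl⟩
    exact ⟨rfl, rfl⟩
  · rintro ⟨h1, h2⟩
    exact ⟨x.z, by ext1 <;> simp [circle, h1, h2]⟩

theorem circle_central : (circle α).range ≤ Subgroup.center (Heis α) := by
  rintro _ ⟨z, rfl⟩
  rw [Subgroup.mem_center_iff]
  intro g
  ext1 <;> simp [circle, mul_def, mul_comm]

theorem circle_injective : Function.Injective (circle α) := fun _ _ h => congrArg Heis.z h

/-- The group of the multiples of powers of a single unitary. -/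
abbrev Line : Type := Circle × Multiplicative ℤ

/-- The circle in `Line`. -/
def lineCircle : Circle →* Line := MonoidHom.inl _ _

theorem lineCircle_injective : Function.Injective lineCircle := fun _ _ h => congrArg Prod.fst h

theorem lineCircle_central : lineCircle.range ≤ Subgroup.center Line := fun x _ =>
  Subgroup.mem_center_iff.mpr fun g => mul_comm g x

variable (α) in
/-- The multiples of powers of `u`. -/
def lineU : Line →* Heis α where
  toFun x := ⟨x.1, x.2.toAdd, 0⟩
  map_one' := rfl
  map_mul' x y := by simp [mul_def]

variable (α) in
/-- The multiples of powers of `v`. -/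
def lineV : Line →* Heis α where
  toFun x := ⟨x.1, 0, x.2.toAdd⟩
  map_one' := rfl
  map_mul' x y := by simp [mul_def]

theorem lineU_injective : Function.Injective (lineU α) := fun _ _ h =>
  Prod.ext (congrArg Heis.z h) (congrArg Heis.m h)

theorem lineV_injective : Function.Injective (lineV α) := fun _ _ h =>
  Prod.ext (congrArg Heis.z h) (congrArg Heis.n h)

theorem lineU_circle (z : Circle) : lineU α (lineCircle z) = circle α z := rfl

theorem lineV_circle (z : Circle) : lineV α (lineCircle z) = circle α z := rfl

/-- The homomorphism of the Heisenberg group given by a pair of elements with the commutation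
relation. -/
def lift {𝒰 : Type*} [Group 𝒰] (ζ : Circle →* 𝒰) (hζ : ζ.range ≤ Subgroup.center 𝒰) (U V : 𝒰)
    (h : U * V = ζ (q α) * (V * U)) : Heis α →* 𝒰 where
  toFun x := ζ x.z * (U ^ x.m * V ^ x.n)
  map_one' := by simp [one_def]
  map_mul' x y := by
    have hz : ∀ z g, g * ζ z = ζ z * g := fun z =>
      Subgroup.mem_center_iff.mp (hζ ⟨z, rfl⟩)
    have hc := zpow_commutation (hζ ⟨_, rfl⟩) h x.n y.m
    simp only [mul_def, map_mul, map_zpow, zpow_add]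
    calc ζ x.z * ζ y.z * ζ (q α) ^ (-(x.n * y.m)) * (U ^ x.m * U ^ y.m * (V ^ x.n * V ^ y.n))
        = ζ x.z * ζ y.z * (U ^ x.m * (ζ (q α) ^ (-(x.n * y.m)) * (U ^ y.m * V ^ x.n)) * V ^ y.n) := by
          rw [← map_zpow, ← mul_assoc (U ^ x.m) (ζ _), hz _ (U ^ x.m)]
          simp only [mul_assoc]
      _ = ζ x.z * (U ^ x.m * V ^ x.n) * (ζ y.z * (U ^ y.m * V ^ y.n)) := by
          rw [← hc, ← mul_assoc (ζ x.z * _) (ζ y.z), mul_assoc (ζ x.z) _ (ζ y.z),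
            hz _ (U ^ x.m * V ^ x.n)]
          simp only [mul_assoc]

end Heis

/-- The scalar unitaries. -/
def scalarUnitary (A : Type*) [CStarAlgebra A] : Circle →* unitary A where
  toFun z := ⟨algebraMap ℂ A z, by
    rw [Unitary.mem_iff, ← algebraMap_star_comm, ← map_mul, ← map_mul]
    simp [← Circle.coe_inv_eq_conj]⟩
  map_one' := by ext; simp
  map_mul' x y := by ext; simp

theorem scalarUnitary_central (A : Type*) [CStarAlgebra A] :
    (scalarUnitary A).range ≤ Subgroup.center (unitary A) := by
  rintro _ ⟨z, rfl⟩
  rw [Subgroup.mem_center_iff]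
  intro g
  ext
  exact (Algebra.commutes _ _).symm

variable (α : ℝ)

theorem toAmbient_injective : Function.Injective (toAmbient α) := Subtype.val_injective

theorem u_mem_unitary : u α ∈ unitary (Torus α) := by
  rw [Unitary.mem_iff]
  constructor <;> refine toAmbient_injective α ?_ <;> rw [map_mul, map_star, map_one] <;>
    ext p : 2
  · exact (Unitary.mem_iff.mp p.1.1.2).1
  · exact (Unitary.mem_iff.mp p.1.1.2).2

theorem v_mem_unitary : v α ∈ unitary (Torus α) := by
  rw [Unitary.mem_iff]
  constructor <;> refine toAmbient_injective α ?_ <;> rw [map_mul, map_star, map_one] <;>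
    ext p : 2
  · exact (Unitary.mem_iff.mp p.1.2.2).1
  · exact (Unitary.mem_iff.mp p.1.2.2).2

theorem u_mul_v : u α * v α = (q α : ℂ) • (v α * u α) := by
  refine toAmbient_injective α ?_
  rw [map_mul, map_smul, map_mul]
  ext p : 2
  exact p.2

/-- The Heisenberg group in the unitaries of the torus. -/
def torusRep : Heis α →* unitary (Torus α) :=
  Heis.lift (scalarUnitary _) (scalarUnitary_central _) ⟨u α, u_mem_unitary α⟩
    ⟨v α, v_mem_unitary α⟩ (by
      ext
      change u α * v α = algebraMap ℂ (Torus α) (q α) * (v α * u α)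
      rw [u_mul_v, Algebra.smul_def])

theorem torusRep_circle (z : Circle) :
    (torusRep α (Heis.circle α z) : Torus α) = (z : ℂ) • 1 := by
  have : torusRep α (Heis.circle α z) = scalarUnitary _ z := by
    change scalarUnitary _ z * (_ ^ (0 : ℤ) * _ ^ (0 : ℤ)) = _
    simp
  rw [this, ← Algebra.algebraMap_eq_smul_one]
  rfl

theorem torusRep_u : (torusRep α ⟨1, 1, 0⟩ : Torus α) = u α := by
  have : torusRep α ⟨1, 1, 0⟩ = ⟨u α, u_mem_unitary α⟩ := by
    change scalarUnitary _ 1 * (_ ^ (1 : ℤ) * _ ^ (0 : ℤ)) = _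
    simp
  rw [this]

theorem torusRep_v : (torusRep α ⟨1, 0, 1⟩ : Torus α) = v α := by
  have : torusRep α ⟨1, 0, 1⟩ = ⟨v α, v_mem_unitary α⟩ := by
    change scalarUnitary _ 1 * (_ ^ (0 : ℤ) * _ ^ (1 : ℤ)) = _
    simp
  rw [this]

/-- The regular representation of the torus. -/
def evalRegular : Torus α →⋆ₐ[ℂ] (L2 →L[ℂ] L2) where
  toFun x := toAmbient α x (regular α)
  map_one' := by rw [map_one]; rfl
  map_mul' x y := by rw [map_mul]; rfl
  map_zero' := by rw [map_zero]; rfl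
  map_add' x y := by rw [map_add]; rfl
  commutes' a := by
    rw [Algebra.algebraMap_eq_smul_one, map_smul, map_one, Algebra.algebraMap_eq_smul_one]; rfl
  map_star' x := by rw [map_star]; rfl

theorem unitary_zpow_shift {H : Type*} [NormedAddCommGroup H] [InnerProductSpace ℂ H]
    [CompleteSpace H] (T : unitary (H →L[ℂ] H)) (f : ℤ → H)
    (h : ∀ k, (T : H →L[ℂ] H) (f k) = f (k + 1)) (n k : ℤ) :
    ((T ^ n : unitary (H →L[ℂ] H)) : H →L[ℂ] H) (f k) = f (k + n) := by
  have hinv : ∀ k, ((T⁻¹ : unitary (H →L[ℂ] H)) : H →L[ℂ] H) (f k) = f (k - 1) := by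
    intro k
    have h1 : ((T⁻¹ * T : unitary (H →L[ℂ] H)) : H →L[ℂ] H) (f (k - 1)) = f (k - 1) := by simp
    rw [Submonoid.coe_mul, mul_apply_eq_comp, h, sub_add_cancel] at h1
    exact h1
  induction n generalizing k with
  | zero => simp
  | succ n ih =>
    rw [zpow_add_one, Submonoid.coe_mul, mul_apply_eq_comp, h, ih]
    congr 1; ring
  | pred n ih =>
    rw [zpow_sub_one, Submonoid.coe_mul, mul_apply_eq_comp, hinv, ih]
    congr 1; ring

/-- No power of `q` appears: `vⁿ` acts first, along the line `m = 0` on which its weights are `1`,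
and `u` has trivial weights. The values of `τ_α` on group elements can be read off from this. -/
theorem evalRegular_torusRep (x : Heis α) :
    evalRegular α (torusRep α x) (delta (0, 0)) = (x.z : ℂ) • delta (x.m, x.n) := by
  let U : unitary (L2 →L[ℂ] L2) := (regular α).1.1
  let V : unitary (L2 →L[ℂ] L2) := (regular α).1.2
  have h0 : evalRegular α (torusRep α x) =
      (x.z : ℂ) • (((U ^ x.m : unitary (L2 →L[ℂ] L2)) : L2 →L[ℂ] L2) *
        ((V ^ x.n : unitary (L2 →L[ℂ] L2)) : L2 →L[ℂ] L2)) := by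
    have h1 : unitaryMap (evalRegular α) ⟨u α, u_mem_unitary α⟩ = U := rfl
    have h2 : unitaryMap (evalRegular α) ⟨v α, v_mem_unitary α⟩ = V := rfl
    rw [← h1, ← h2, ← map_zpow, ← map_zpow]
    rw [← Submonoid.coe_mul, ← map_mul]
    have h3 : (torusRep α x : Torus α) = (x.z : ℂ) • (((⟨u α, u_mem_unitary α⟩ : unitary (Torus α)) ^
        x.m * ⟨v α, v_mem_unitary α⟩ ^ x.n : unitary (Torus α)) : Torus α) := by
      rw [Algebra.smul_def]; rfl
    rw [h3, map_smul]
    rfl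
  have hV : ((V ^ x.n : unitary (L2 →L[ℂ] L2)) : L2 →L[ℂ] L2) (delta (0, 0)) = delta (0, x.n) := by
    have := unitary_zpow_shift V (fun k => delta (0, k)) (fun k => by
      change (weightedShift _ _ : L2 →L[ℂ] L2) (delta (0, k)) = _
      rw [weightedShift_delta]
      simp) x.n 0
    simpa using this
  have hU : ((U ^ x.m : unitary (L2 →L[ℂ] L2)) : L2 →L[ℂ] L2) (delta (0, x.n)) =
      delta (x.m, x.n) := by
    have := unitary_zpow_shift U (fun k => delta (k, x.n)) (fun k => by
      change (weightedShift _ _ : L2 →L[ℂ] L2) (delta (k, x.n)) = _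
      rw [weightedShift_delta]
      simp) x.m 0
    simpa using this
  rw [h0, smul_apply, mul_apply_eq_comp, hV, hU]

theorem gns_apply_cyclicVector (x : Torus α) :
    gns α x (cyclicVector α) = (((trace α).toPreGNS x : (trace α).PreGNS) : (trace α).GNS) := by
  change (trace α).gnsNonUnitalStarAlgHom x
    (((trace α).toPreGNS 1 : (trace α).PreGNS) : (trace α).GNS) = _
  rw [PositiveLinearMap.gnsNonUnitalStarAlgHom_apply_coe,
    PositiveLinearMap.leftMulMapPreGNS_apply, PositiveLinearMap.ofPreGNS_toPreGNS, mul_one]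

theorem inner_cyclicVector_gns (x : Torus α) :
    ⟪cyclicVector α, gns α x (cyclicVector α)⟫_ℂ =
      ⟪delta (0, 0), evalRegular α x (delta (0, 0))⟫_ℂ := by
  rw [gns_apply_cyclicVector]
  refine (UniformSpace.Completion.inner_coe _ _).trans ?_
  rw [PositiveLinearMap.preGNS_inner_def, PositiveLinearMap.ofPreGNS_toPreGNS,
    PositiveLinearMap.ofPreGNS_toPreGNS, star_one, one_mul]
  rfl

theorem torus_eq_top (S : StarSubalgebra ℂ (Torus α)) (hS : IsClosed (S : Set (Torus α)))
    (hu : u α ∈ S) (hv : v α ∈ S) (x : Torus α) : x ∈ S := by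
  have hcl : IsClosed ((S.map (toAmbient α) : StarSubalgebra ℂ (Ambient α)) : Set (Ambient α)) := by
    have h : Topology.IsClosedEmbedding (Subtype.val : torusSubalgebra α → Ambient α) :=
      (StarSubalgebra.isClosed_topologicalClosure _).isClosedEmbedding_subtypeVal
    exact h.isClosedMap _ hS
  have hle : torusSubalgebra α ≤ S.map (toAmbient α) := by
    refine StarSubalgebra.topologicalClosure_minimal ?_ hcl
    rw [StarAlgebra.adjoin_le_iff]
    rintro _ (rfl | rfl)
    · exact ⟨u α, hu, rfl⟩
    · exact ⟨v α, hv, rfl⟩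
  obtain ⟨y, hy, hyx⟩ := hle (show toAmbient α x ∈ torusSubalgebra α from x.2)
  rw [← toAmbient_injective α hyx]
  exact hy

/-- The Heisenberg group on the GNS space. -/
def gnsHom : Heis α →* unitary (GNSSpace α →L[ℂ] GNSSpace α) :=
  (unitaryMap (gns α)).comp (torusRep α)

theorem coe_gnsHom (x : Heis α) :
    (gnsHom α x : GNSSpace α →L[ℂ] GNSSpace α) = gns α (torusRep α x) := rfl

theorem gns_mem (N : VonNeumannAlgebra (GNSSpace α)) (hu : gns α (u α) ∈ N)
    (hv : gns α (v α) ∈ N) (x : Torus α) : gns α x ∈ N := by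
  refine torus_eq_top α (N.toStarSubalgebra.comap (gns α)) ?_ hu hv x
  exact N.isClosed_coe.preimage (map_continuous (gns α))

/-- A von Neumann algebra is norm closed, so once it contains the images of `u` and `v` it contains
the image of the whole C*-algebra. -/
theorem R_eq : R α = VonNeumannAlgebra.generatedBy
    (MonoidHom.mrange ((unitary (GNSSpace α →L[ℂ] GNSSpace α)).subtype.comp (gnsHom α)) :
      Set (GNSSpace α →L[ℂ] GNSSpace α)) := by
  refine le_antisymm (VonNeumannAlgebra.generatedBy_le ?_) (VonNeumannAlgebra.generatedBy_mono ?_)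
  · rintro _ ⟨x, rfl⟩
    refine gns_mem α _ ?_ ?_ x
    · rw [← torusRep_u]; exact VonNeumannAlgebra.subset_generatedBy _ ⟨⟨1, 1, 0⟩, rfl⟩
    · rw [← torusRep_v]; exact VonNeumannAlgebra.subset_generatedBy _ ⟨⟨1, 0, 1⟩, rfl⟩
  · rintro _ ⟨x, rfl⟩
    exact ⟨torusRep α x, rfl⟩

/-- The GNS space as a regular representation of the Heisenberg group. -/
def gnsRep : RegularRep (Heis.circle α) (GNSSpace α) where
  lam := gnsHom α
  vac := cyclicVector α
  lam_circle z := by rw [coe_gnsHom, torusRep_circle, map_smul, map_one]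
  norm_vac := by
    rw [norm_eq_sqrt_re_inner (𝕜 := ℂ)]
    have := inner_cyclicVector_gns α 1
    rw [map_one, map_one, one_apply_eq_self, one_apply_eq_self,
      orthonormal_iff_ite.mp orthonormal_delta] at this
    rw [this]; simp
  inner_vac x hx := by
    rw [Heis.mem_range_circle] at hx
    rw [coe_gnsHom, inner_cyclicVector_gns, evalRegular_torusRep, inner_smul_right,
      orthonormal_iff_ite.mp orthonormal_delta, if_neg, mul_zero]
    intro h
    rw [Prod.ext_iff] at h
    exact hx ⟨h.1.symm, h.2.symm⟩
  dense_orbit := by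
    rw [Submodule.dense_iff_topologicalClosure_eq_top, eq_top_iff]
    -- The orbit of the C*-algebra is dense by the GNS construction; the density theorem then puts
    -- it in the closed span of the orbit of the group.
    have hd : Dense (Set.range fun x => gns α x (cyclicVector α)) := by
      have h1 : (fun x => gns α x (cyclicVector α)) =
          ((↑) : (trace α).PreGNS → (trace α).GNS) ∘ (trace α).toPreGNS :=
        funext (gns_apply_cyclicVector α)
      have h2 : DenseRange (((↑) : (trace α).PreGNS → (trace α).GNS) ∘ (trace α).toPreGNS) := by
        rw [DenseRange, (trace α).toPreGNS.surjective.range_comp]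
        exact UniformSpace.Completion.denseRange_coe
      exact h1 ▸ h2
    intro ξ _
    have h2 := hd ξ
    refine closure_minimal ?_ (Submodule.isClosed_topologicalClosure _) h2
    rintro _ ⟨x, rfl⟩
    have hx : gns α x ∈ R α := VonNeumannAlgebra.subset_generatedBy _ ⟨x, rfl⟩
    rw [R_eq] at hx
    have := VonNeumannAlgebra.apply_mem_closure _ (by
      rintro _ ⟨g, rfl⟩
      refine ⟨g⁻¹, ?_⟩
      rw [MonoidHom.comp_apply, map_inv]
      rfl) hx (cyclicVector α)
    refine Submodule.topologicalClosure_mono (Submodule.span_mono ?_) this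
    rintro _ ⟨_, ⟨g, rfl⟩, rfl⟩
    exact ⟨g, rfl⟩

theorem vN_gnsRep : (gnsRep α).vN = R α := (R_eq α).symm

theorem zpow_mem_generatedBy {H : Type*} [NormedAddCommGroup H] [InnerProductSpace ℂ H]
    [CompleteSpace H] (N : VonNeumannAlgebra H) (T : unitary (H →L[ℂ] H))
    (hT : (T : H →L[ℂ] H) ∈ N) (n : ℤ) : ((T ^ n : unitary (H →L[ℂ] H)) : H →L[ℂ] H) ∈ N := by
  cases n with
  | ofNat n =>
    rw [Int.ofNat_eq_natCast, zpow_natCast, SubmonoidClass.coe_pow]; exact pow_mem hT n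
  | negSucc n =>
    rw [zpow_negSucc]
    change star ((T ^ (n + 1) : unitary (H →L[ℂ] H)) : H →L[ℂ] H) ∈ N
    rw [SubmonoidClass.coe_pow]
    exact star_mem (pow_mem hT _)

theorem coe_gnsHom_mk (z : Circle) (m n : ℤ) :
    (gnsHom α ⟨z, m, n⟩ : GNSSpace α →L[ℂ] GNSSpace α) =
      (z : ℂ) • (((gnsHom α ⟨1, 1, 0⟩ ^ m : unitary _) : GNSSpace α →L[ℂ] GNSSpace α) *
        ((gnsHom α ⟨1, 0, 1⟩ ^ n : unitary _) : GNSSpace α →L[ℂ] GNSSpace α)) := by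
  have h1 : torusRep α ⟨1, 1, 0⟩ = ⟨u α, u_mem_unitary α⟩ := Subtype.ext (torusRep_u α)
  have h2 : torusRep α ⟨1, 0, 1⟩ = ⟨v α, v_mem_unitary α⟩ := Subtype.ext (torusRep_v α)
  rw [← map_zpow, ← map_zpow, coe_gnsHom, coe_gnsHom, coe_gnsHom, map_zpow, map_zpow, h1, h2,
    ← map_mul, ← map_smul, Algebra.smul_def]
  rfl

theorem smul_mem_vN {H : Type*} [NormedAddCommGroup H] [InnerProductSpace ℂ H]
    [CompleteSpace H] (N : VonNeumannAlgebra H) {x : H →L[ℂ] H} (hx : x ∈ N) (a : ℂ) :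
    a • x ∈ N :=
  N.toStarSubalgebra.smul_mem hx a

theorem subAlg_lineU : RegularRep.Inclusion.subAlg (Heis.lineU α) (gnsRep α) = D α := by
  refine le_antisymm (VonNeumannAlgebra.generatedBy_le ?_) (VonNeumannAlgebra.generatedBy_mono ?_)
  · rintro _ ⟨⟨z, k⟩, rfl⟩
    change (gnsHom α ⟨z, k.toAdd, 0⟩ : GNSSpace α →L[ℂ] GNSSpace α) ∈ D α
    rw [coe_gnsHom_mk, zpow_zero, Submonoid.coe_one, mul_one]
    refine smul_mem_vN _ (zpow_mem_generatedBy _ _ ?_ _) _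
    rw [coe_gnsHom, torusRep_u]
    exact VonNeumannAlgebra.subset_generatedBy _ rfl
  · rintro _ rfl
    rw [← torusRep_u]
    exact ⟨(1, Multiplicative.ofAdd 1), rfl⟩

theorem subAlg_lineV : RegularRep.Inclusion.subAlg (Heis.lineV α) (gnsRep α) = C α := by
  refine le_antisymm (VonNeumannAlgebra.generatedBy_le ?_) (VonNeumannAlgebra.generatedBy_mono ?_)
  · rintro _ ⟨⟨z, k⟩, rfl⟩
    change (gnsHom α ⟨z, 0, k.toAdd⟩ : GNSSpace α →L[ℂ] GNSSpace α) ∈ C α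
    rw [coe_gnsHom_mk, zpow_zero, Submonoid.coe_one, one_mul]
    refine smul_mem_vN _ (zpow_mem_generatedBy _ _ ?_ _) _
    rw [coe_gnsHom, torusRep_v]
    exact VonNeumannAlgebra.subset_generatedBy _ rfl
  · rintro _ rfl
    rw [← torusRep_v]
    exact ⟨(1, Multiplicative.ofAdd 1), rfl⟩

end NCTorus
end

/-! ### Existence of the HNN extension -/

noncomputable section

open VonNeumannAlgebra HNNExtension

namespace RegularRep

variable {G : Type*} [Group G] {c : Circle →* G} {K : Type*} [NormedAddCommGroup K]
    [InnerProductSpace ℂ K] [CompleteSpace K] (r : RegularRep c K)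

theorem e_mul_circle (g : G) (z : Circle) : r.e (g * c z) = (z : ℂ) • r.e g := by
  rw [← lam_e, e, lam_circle]
  simp [e]

/-- Vectors with disjoint supports are orthogonal. -/
theorem inner_eq_zero_of_disjoint {ξ η : K} (h : ∀ g, ⟪r.e g, ξ⟫_ℂ = 0 ∨ ⟪r.e g, η⟫_ℂ = 0) :
    ⟪ξ, η⟫_ℂ = 0 := by
  -- The closed span of the orbit vectors orthogonal to `η` is itself orthogonal to `η`; the aim is
  -- to show that it contains `ξ`.
  set L := (Submodule.span ℂ (r.e '' {g | ⟪r.e g, η⟫_ℂ = 0})).topologicalClosure with hL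
  have hmem : ∀ g, ⟪r.e g, η⟫_ℂ = 0 → r.e g ∈ L := fun g hg =>
    Submodule.le_topologicalClosure _ (Submodule.subset_span ⟨g, hg, rfl⟩)
  have hperp : ∀ ζ : K, (∀ g, ⟪r.e g, η⟫_ℂ = 0 → ⟪ζ, r.e g⟫_ℂ = 0) → ∀ x ∈ L, ⟪ζ, x⟫_ℂ = 0 := by
    intro ζ hζ x hx
    have hle : L ≤ (Submodule.span ℂ {ζ})ᗮ := by
      refine Submodule.topologicalClosure_minimal _ ?_ (Submodule.isClosed_orthogonal _)
      rw [Submodule.span_le]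
      rintro _ ⟨g, hg, rfl⟩
      rw [SetLike.mem_coe, Submodule.mem_orthogonal_singleton_iff_inner_right]
      exact hζ g hg
    exact (Submodule.mem_orthogonal_singleton_iff_inner_right).mp (hle hx)
  -- An orbit vector `e g` not orthogonal to `η` is orthogonal to `ξ`, and also to `L`: a generator
  -- of `L` not orthogonal to it would be a phase multiple of it.
  have hξ : ξ - L.starProjection ξ = 0 := by
    refine eq_zero_of_dense_span r.dense_e fun g => ?_
    by_cases hg : ⟪r.e g, η⟫_ℂ = 0
    · exact Submodule.inner_right_of_mem_orthogonal (hmem g hg)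
        (Submodule.sub_starProjection_mem_orthogonal ξ)
    · rw [inner_sub_right, (h g).resolve_right hg, zero_sub, neg_eq_zero]
      refine hperp _ (fun g' hg' => r.inner_e_eq_zero ?_) _
        (Submodule.starProjection_apply_mem _ _)
      rintro ⟨z, hz⟩
      have : g' = g * c z := by rw [hz]; group
      rw [this, e_mul_circle, inner_smul_left, mul_eq_zero] at hg'
      refine hg'.elim (fun h0 => ?_) hg
      rw [map_eq_zero] at h0
      exact Circle.coe_ne_zero z h0
  have hξL : ξ ∈ L := by
    rw [sub_eq_zero] at hξ
    rw [hξ]; exact Submodule.starProjection_apply_mem _ _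
  rw [← inner_conj_symm, hperp η (fun g hg => by rw [← inner_conj_symm, hg, map_zero]) ξ hξL,
    map_zero]

end RegularRep

namespace NCTorus

variable (α : ℝ)

/-- The subgroup of the multiples of the powers of `v`. -/
def subV : Subgroup (Heis α) where
  carrier := {x | x.m = 0}
  one_mem' := rfl
  mul_mem' {x y} hx hy := by
    change x.m + y.m = 0
    rw [show x.m = 0 from hx, show y.m = 0 from hy, add_zero]
  inv_mem' {x} hx := by
    change -x.m = 0
    rw [show x.m = 0 from hx, neg_zero]

/-- The subgroup of the multiples of the powers of `u`. -/
def subU : Subgroup (Heis α) where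
  carrier := {x | x.n = 0}
  one_mem' := rfl
  mul_mem' {x y} hx hy := by
    change x.n + y.n = 0
    rw [show x.n = 0 from hx, show y.n = 0 from hy, add_zero]
  inv_mem' {x} hx := by
    change -x.n = 0
    rw [show x.n = 0 from hx, neg_zero]

theorem mem_subV {x : Heis α} : x ∈ subV α ↔ x.m = 0 := Iff.rfl

/-- The isomorphism with `v ↦ u`. -/
def swap : subV α ≃* subU α where
  toFun x := ⟨⟨x.1.z, x.1.n, 0⟩, rfl⟩
  invFun x := ⟨⟨x.1.z, 0, x.1.m⟩, rfl⟩
  left_inv x := Subtype.ext (Heis.ext rfl x.2.symm rfl)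
  right_inv x := Subtype.ext (Heis.ext rfl rfl x.2.symm)
  map_mul' x y := Subtype.ext (Heis.ext (by
    have := (mem_subV α).mp y.2
    simp [Heis.mul_def, this]) rfl rfl)

/-- The HNN extension of the Heisenberg group with `t v t⁻¹ = u`. -/
abbrev HNN : Type := HNNExtension (Heis α) (subV α) (subU α) (swap α)

/-- The inclusion of the Heisenberg group. -/
abbrev ofH : Heis α →* HNN α := HNNExtension.of

/-- The central circle of the HNN extension. -/
def hnnCircle : Circle →* HNN α := (ofH α).comp (Heis.circle α)

theorem hnnCircle_apply (z : Circle) : hnnCircle α z = ofH α (Heis.circle α z) := rfl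

theorem hnnCircle_injective : Function.Injective (hnnCircle α) :=
  (HNNExtension.of_injective (swap α)).comp Heis.circle_injective

theorem hnnCircle_central : (hnnCircle α).range ≤ Subgroup.center (HNN α) := by
  rintro _ ⟨z, rfl⟩
  rw [Subgroup.mem_center_iff]
  intro g
  change Commute g (hnnCircle α z)
  induction g using HNNExtension.induction_on with
  | of x =>
    change ofH α x * ofH α _ = ofH α _ * ofH α x
    rw [← map_mul, ← map_mul, Subgroup.mem_center_iff.mp (Heis.circle_central ⟨z, rfl⟩) x]
  | t => exact HNNExtension.t_mul_of (φ := swap α) ⟨Heis.circle α z, rfl⟩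
  | mul x y hx hy => exact hx.mul_left hy
  | inv x hx => exact hx.inv_left

theorem t_lineV (k : Heis.Line) :
    (t : HNN α) * ofH α (Heis.lineV α k) * t⁻¹ = ofH α (Heis.lineU α k) := by
  rw [mul_inv_eq_iff_eq_mul]
  exact HNNExtension.t_mul_of (φ := swap α) ⟨Heis.lineV α k, rfl⟩

theorem mem_range_lineV {x : Heis α} (hx : x ∈ subV α) : ∃ k, Heis.lineV α k = x :=
  ⟨(x.z, Multiplicative.ofAdd x.n), Heis.ext rfl hx.symm rfl⟩

theorem mem_range_lineU {x : Heis α} (hx : x ∈ subU α) : ∃ k, Heis.lineU α k = x :=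
  ⟨(x.z, Multiplicative.ofAdd x.m), Heis.ext rfl rfl hx.symm⟩

section Existence

variable {α} {H₁ : Type*} [NormedAddCommGroup H₁] [InnerProductSpace ℂ H₁] [CompleteSpace H₁]
  {s : RegularRep Heis.lineCircle H₁}
  {H : Type*} [NormedAddCommGroup H] [InnerProductSpace ℂ H] [CompleteSpace H]
  {r : RegularRep (Heis.circle α) H}
  {K : Type*} [NormedAddCommGroup K] [InnerProductSpace ℂ K] [CompleteSpace K]
  {h : RegularRep (hnnCircle α) K}
  (ID : RegularRep.Inclusion (Heis.lineU α) s r) (IC : RegularRep.Inclusion (Heis.lineV α) s r)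
  (I : RegularRep.Inclusion (ofH α) r h)

variable (h) in
/-- The stable unitary. -/
def stable : unitary h.vN.toStarSubalgebra :=
  ⟨⟨h.lam t, h.lam_mem_vN t⟩, Unitary.mem_iff.mpr
    ⟨Subtype.ext (Unitary.mem_iff.mp (h.lam t).2).1, Subtype.ext (Unitary.mem_iff.mp (h.lam t).2).2⟩⟩

theorem coe_signPow (ε : Bool) :
    (signPow (stable h) ε : K →L[ℂ] K) = h.lam (tPow (swap α) ε) := by
  cases ε
  · exact h.star_lam t
  · rfl

-- The vacuum is separating, so it suffices to compare values there. The left side becomes left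
-- translation by `t` and right translation by `t⁻¹` of the copy along `v` of the vector `x vac`;
-- since `t vᵏ t⁻¹ = uᵏ`, this is the copy along `u`.
include ID IC in
theorem lam_t_conj {x : H₁ →L[ℂ] H₁} (hx : x ∈ s.vN) :
    (h.lam t : K →L[ℂ] K) * I.amplify (IC.amplify x) * star (h.lam t : K →L[ℂ] K) =
      I.amplify (ID.amplify x) := by
  have hr : ∀ {y}, y ∈ s.vN → ∀ {j : Heis.Line →* Heis α} (J : RegularRep.Inclusion j s r),
      I.amplify (J.amplify y) ∈ h.vN := fun hy _ J =>
    RegularRep.Inclusion.subAlg_le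
      (I.amplify_mem (RegularRep.Inclusion.subAlg_le (J.amplify_mem hy)))
  have hC := hr hx IC
  have hD := hr hx ID
  rw [← sub_eq_zero]
  refine h.eq_zero_of_apply_vac (hnnCircle_central α) (sub_mem (mul_mem (mul_mem
    (h.lam_mem_vN t) hC) (star_mem (h.lam_mem_vN t))) hD) ?_
  have hW : ∀ ξ : H₁, (h.lam t : K →L[ℂ] K)
      (h.right (hnnCircle_central α) t⁻¹ (I.W (IC.W ξ))) = I.W (ID.W ξ) := by
    intro ξ
    have : (h.lam t : K →L[ℂ] K) ∘L
        ((h.right (hnnCircle_central α) t⁻¹ : K ≃L[ℂ] K) : K →L[ℂ] K) ∘L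
        I.W.toContinuousLinearMap ∘L IC.W.toContinuousLinearMap =
        I.W.toContinuousLinearMap ∘L ID.W.toContinuousLinearMap := by
      refine ContinuousLinearMap.ext_on s.dense_e ?_
      rintro _ ⟨k, rfl⟩
      change (h.lam t : K →L[ℂ] K) (h.right (hnnCircle_central α) t⁻¹ (I.W (IC.W (s.e k)))) =
        I.W (ID.W (s.e k))
      rw [IC.W_e, ID.W_e, I.W_e, I.W_e, h.right_e, h.lam_e, ← t_lineV, mul_assoc]
    exact DFunLike.congr_fun this ξ
  rw [sub_apply, sub_eq_zero, mul_apply_eq_comp, mul_apply_eq_comp, h.star_lam]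
  change (h.lam t : K →L[ℂ] K) (I.amplify (IC.amplify x) (h.e t⁻¹)) = _
  rw [h.apply_e (hnnCircle_central α) hC, ← I.W_vac, I.amplify_W, I.amplify_W, ← IC.W_vac,
    IC.amplify_W, hW, IC.W_vac, ← ID.W_vac, ID.amplify_W]

theorem hnn_generates : generatedBy
    (insert ((stable h : h.vN.toStarSubalgebra) : K →L[ℂ] K)
      (Set.range fun n : r.vN.toStarSubalgebra => (I.embed n : K →L[ℂ] K))) = h.vN := by
  refine le_antisymm (generatedBy_le ?_) (generatedBy_le ?_)
  · rintro _ (rfl | ⟨n, rfl⟩)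
    · exact h.lam_mem_vN t
    · exact (I.embed n).2
  · set N := generatedBy (insert ((stable h : h.vN.toStarSubalgebra) : K →L[ℂ] K)
      (Set.range fun n : r.vN.toStarSubalgebra => (I.embed n : K →L[ℂ] K)))
    rintro _ ⟨g, rfl⟩
    change (h.lam g : K →L[ℂ] K) ∈ N
    induction g using HNNExtension.induction_on with
    | of x =>
      refine subset_generatedBy _ (Or.inr ⟨⟨r.lam x, r.lam_mem_vN x⟩, ?_⟩)
      exact I.amplify_lam x
    | t => exact subset_generatedBy _ (Or.inl rfl)
    | mul x y hx hy => rw [map_mul]; exact mul_mem hx hy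
    | inv x hx => rw [← h.star_lam]; exact star_mem hx

theorem inner_e_eq_zero_of_compress {j : Heis.Line →* Heis α} (J : RegularRep.Inclusion j s r)
    {n : H →L[ℂ] H} (hn : compress J.W n = 0) (k : Heis.Line) :
    ⟪r.e (j k), star n r.vac⟫_ℂ = 0 := by
  rw [ContinuousLinearMap.star_eq_adjoint, ContinuousLinearMap.adjoint_inner_right,
    ← inner_conj_symm, ← J.W_e, ← J.W_vac, ← inner_compress, hn]
  simp

/-- A reduced word applied to the cyclic vector is supported on the reduced words of the group. -/
theorem inner_e_hnnWord (ε : Bool) (l : List (r.vN.toStarSubalgebra × Bool))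
    (hl : IsReducedWord (ID.subExpect Heis.lineU_circle) (IC.subExpect Heis.lineV_circle) ε l)
    (g : HNN α) (hg : ∀ δ k m, IsTWord (swap α) ε δ k → g ≠ k * ofH α m) :
    ⟪h.e g, (hnnWord I.embed (stable h) ε l : K →L[ℂ] K) h.vac⟫_ℂ = 0 := by
  induction l generalizing ε g with
  | nil =>
    change ⟪h.e g, (signPow (stable h) ε : K →L[ℂ] K) h.vac⟫_ℂ = 0
    rw [coe_signPow]
    refine h.inner_e_eq_zero ?_
    rintro ⟨z, hz⟩
    refine hg ε _ (Heis.circle α z⁻¹) (.base ε) ?_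
    rw [← hnnCircle_apply, map_inv, hz]
    group
  | cons p l ih =>
    obtain ⟨n, ε'⟩ := p
    obtain ⟨h1, h2, hl'⟩ := hl
    set ξ := (hnnWord I.embed (stable h) ε' l : K →L[ℂ] K) h.vac with hξ
    have hw : (hnnWord I.embed (stable h) ε ((n, ε') :: l) : K →L[ℂ] K) h.vac =
        (h.lam (tPow (swap α) ε) : K →L[ℂ] K) (I.amplify n ξ) := by
      rw [← coe_signPow]; rfl
    rw [hw, h.inner_lam_right, h.lam_e]
    set g' := (tPow (swap α) ε)⁻¹ * g with hg'
    have hmem : I.amplify (star (n : H →L[ℂ] H)) ∈ h.vN :=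
      RegularRep.Inclusion.subAlg_le (I.amplify_mem (star_mem n.2))
    rw [← ContinuousLinearMap.adjoint_inner_left, ← ContinuousLinearMap.star_eq_adjoint,
      ← map_star, h.apply_e (hnnCircle_central α) hmem, ← I.W_vac, I.amplify_W]
    let T : H →L[ℂ] K := ((h.right (hnnCircle_central α) g' : K ≃L[ℂ] K) : K →L[ℂ] K) ∘L
      I.W.toContinuousLinearMap
    change ⟪T (star (n : H →L[ℂ] H) r.vac), ξ⟫_ℂ = 0
    rw [← ContinuousLinearMap.adjoint_inner_right]
    -- Compare coefficients at each `x` of the Heisenberg group. If `t^ε x t^ε'` does not cancel,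
    -- then `x * g'` cannot begin a reduced word with `t^ε'`, since `g` would begin one with `t^ε`;
    -- so the tail vanishes by induction. If it cancels, `x` lies in the associated subgroup, where
    -- `star n` has no coefficient because the expectation kills `n`.
    refine r.inner_eq_zero_of_disjoint fun x => ?_
    by_cases hx : NoCancel (subV α) (subU α) ε x ε'
    · right
      rw [ContinuousLinearMap.adjoint_inner_right]
      have hT : T (r.e x) = h.e (ofH α x * g') := by
        change h.right (hnnCircle_central α) g' (I.W (r.e x)) = _
        rw [I.W_e, h.right_e]
      rw [hT]
      refine ih ε' hl' _ fun δ k m hk he => ?_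
      have hx' : NoCancel (subV α) (subU α) ε x⁻¹ ε' :=
        ⟨fun a b => by rw [inv_mem_iff]; exact hx.1 a b,
          fun a b => by rw [inv_mem_iff]; exact hx.2 a b⟩
      refine hg δ _ m (.cons hx' hk) ?_
      rw [mul_assoc, mul_assoc, ← he, hg', map_inv]
      group
    · left
      cases ε <;> cases ε'
      · exact absurd (noCancel_self false x) hx
      · have hxU : x ∈ subU α := by simpa [NoCancel] using hx
        obtain ⟨k, rfl⟩ := mem_range_lineU α hxU
        refine inner_e_eq_zero_of_compress ID ?_ k
        have := congrArg (fun y => compress ID.W y.1) (h2 rfl rfl)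
        change compress ID.W (ID.amplify (compress ID.W n)) = compress ID.W 0 at this
        rwa [ID.compress_amplify, map_zero] at this
      · have hxV : x ∈ subV α := by simpa [NoCancel] using hx
        obtain ⟨k, rfl⟩ := mem_range_lineV α hxV
        refine inner_e_eq_zero_of_compress IC ?_ k
        have := congrArg (fun y => compress IC.W y.1) (h1 rfl rfl)
        change compress IC.W (IC.amplify (compress IC.W n)) = compress IC.W 0 at this
        rwa [IC.compress_amplify, map_zero] at this
      · exact absurd (noCancel_self true x) hx

/-- A matrix coefficient between orbit vectors of `x`, `y` in `H` is the coefficient of the word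
vector at `x * y⁻¹`. That element lies in `H`, where no reduced word containing `t` can lie. -/
theorem hnn_moment (ε : Bool) (l : List (r.vN.toStarSubalgebra × Bool))
    (hl : IsReducedWord (ID.subExpect Heis.lineU_circle) (IC.subExpect Heis.lineV_circle) ε l) :
    I.expect (fun _ => rfl) (hnnWord I.embed (stable h) ε l) = 0 := by
  refine Subtype.ext ?_
  change compress I.W (hnnWord I.embed (stable h) ε l : K →L[ℂ] K) = 0
  refine clm_ext_inner fun ξ η => ?_
  rw [inner_compress]
  have := RegularRep.inner_map_map_eq_zero r.dense_e r.dense_e I.W.toContinuousLinearMap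
    ((hnnWord I.embed (stable h) ε l : K →L[ℂ] K) ∘L I.W.toContinuousLinearMap)
    (fun x y => ?_) ξ η
  · simpa using this
  · change ⟪I.W (r.e x), (hnnWord I.embed (stable h) ε l : K →L[ℂ] K) (I.W (r.e y))⟫_ℂ = 0
    rw [I.W_e, I.W_e, h.inner_e_apply_e (hnnCircle_central α)
      (hnnWord I.embed (stable h) ε l).2]
    refine inner_e_hnnWord ID IC I ε l hl _ fun δ k m hk he => ?_
    refine hk.notMem_range 1 m ⟨x * y⁻¹, ?_⟩
    rw [map_one, one_mul, ← he, map_mul, map_inv]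

end Existence

/-- The algebras are variables with equations to the group algebras, so that the equations can be
substituted away. The isomorphism `θ` passes through the algebra of `Heis.Line`, which embeds once
along `u` and once along `v`. -/
theorem exists_hnnExtension {N D C : VonNeumannAlgebra (GNSSpace α)}
    (hN : (gnsRep α).vN = N)
    (hD : RegularRep.Inclusion.subAlg (Heis.lineU α) (gnsRep α) = D)
    (hC : RegularRep.Inclusion.subAlg (Heis.lineV α) (gnsRep α) = C)
    (hDN : D.toStarSubalgebra ≤ N.toStarSubalgebra)
    (hCN : C.toStarSubalgebra ≤ N.toStarSubalgebra) :
    ∃ (θ : D.toStarSubalgebra ≃⋆ₐ[ℂ] C.toStarSubalgebra)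
      (ED : N.toStarSubalgebra →ₗ[ℂ] D.toStarSubalgebra)
      (EC : N.toStarSubalgebra →ₗ[ℂ] C.toStarSubalgebra),
      IsNormalMap D C θ ∧
      (∀ d : D.toStarSubalgebra, (d : GNSSpace α →L[ℂ] GNSSpace α) = gns α (u α) →
        (θ d : GNSSpace α →L[ℂ] GNSSpace α) = gns α (v α)) ∧
      (IsConditionalExpectation N D (StarSubalgebra.inclusion hDN) ED ∧
        ∀ x, ⟪cyclicVector α, (ED x : GNSSpace α →L[ℂ] GNSSpace α) (cyclicVector α)⟫_ℂ =
          ⟪cyclicVector α, (x : GNSSpace α →L[ℂ] GNSSpace α) (cyclicVector α)⟫_ℂ) ∧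
      (IsConditionalExpectation N C (StarSubalgebra.inclusion hCN) EC ∧
        ∀ x, ⟪cyclicVector α, (EC x : GNSSpace α →L[ℂ] GNSSpace α) (cyclicVector α)⟫_ℂ =
          ⟪cyclicVector α, (x : GNSSpace α →L[ℂ] GNSSpace α) (cyclicVector α)⟫_ℂ) ∧
      ∃ (K : Type) (_ : NormedAddCommGroup K) (_ : InnerProductSpace ℂ K) (_ : CompleteSpace K)
        (M : VonNeumannAlgebra K) (π : N.toStarSubalgebra →⋆ₐ[ℂ] M.toStarSubalgebra)
        (w : unitary M.toStarSubalgebra) (E : M.toStarSubalgebra →ₗ[ℂ] N.toStarSubalgebra),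
        IsHNNExtension N D C hDN hCN θ ED EC M π w E := by
  subst hN hD hC
  let s := RegularRep.model Heis.lineCircle_injective Heis.lineCircle_central
  let h := RegularRep.model (hnnCircle_injective α) (hnnCircle_central α)
  obtain ⟨ID⟩ := RegularRep.nonempty_inclusion s (gnsRep α) Heis.circle_central
    Heis.lineU_injective Heis.lineU_circle
  obtain ⟨IC⟩ := RegularRep.nonempty_inclusion s (gnsRep α) Heis.circle_central
    Heis.lineV_injective Heis.lineV_circle
  obtain ⟨I⟩ := RegularRep.nonempty_inclusion (gnsRep α) h (hnnCircle_central α)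
    (j := ofH α) (HNNExtension.of_injective (swap α)) (fun _ => rfl)
  refine ⟨(ID.equivSubAlg Heis.lineU_circle).symm.trans (IC.equivSubAlg Heis.lineV_circle),
    ID.subExpect Heis.lineU_circle, IC.subExpect Heis.lineV_circle, ?_, ?_,
    ⟨ID.isConditionalExpectation_subExpect Heis.circle_central _, ID.inner_subExpect _⟩,
    ⟨IC.isConditionalExpectation_subExpect Heis.circle_central _, IC.inner_subExpect _⟩,
    _, inferInstance, inferInstance, inferInstance, h.vN, I.embed, stable h,
    I.expect (fun _ => rfl), ?_⟩
  · intro ξ η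
    exact (IC.normal s.vN ξ η).comp_compress ID.W _ fun _ => rfl
  · intro d hd
    change IC.amplify (compress ID.W d) = _
    have hu : gns α (u α) = (gnsRep α).lam (Heis.lineU α (1, Multiplicative.ofAdd 1)) := by
      rw [← torusRep_u]; rfl
    have hv : gns α (v α) = (gnsRep α).lam (Heis.lineV α (1, Multiplicative.ofAdd 1)) := by
      rw [← torusRep_v]; rfl
    rw [hd, hu, hv, ID.compress_lam, IC.amplify_lam]
  · refine ⟨I.embed_normal, I.isConditionalExpectation (hnnCircle_central α) _,
      hnn_generates I, fun d => Subtype.ext ?_, fun ε l hl => hnn_moment ID IC I ε l hl⟩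
    have hd := lam_t_conj ID IC I (x := compress ID.W d)
      (ID.compress_mem Heis.lineU_circle (RegularRep.Inclusion.subAlg_le d.2))
    rw [ID.amplify_compress Heis.lineU_circle d.2] at hd
    exact hd

theorem exists_torusHNNExtension :
    ∃ (θ : (D α).toStarSubalgebra ≃⋆ₐ[ℂ] (C α).toStarSubalgebra)
      (ED : (R α).toStarSubalgebra →ₗ[ℂ] (D α).toStarSubalgebra)
      (EC : (R α).toStarSubalgebra →ₗ[ℂ] (C α).toStarSubalgebra),
      IsTheta α θ ∧ IsTracePreservingCondExp α (D α) (D_le_R α) ED ∧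
      IsTracePreservingCondExp α (C α) (C_le_R α) EC ∧
      ∃ (K : Type) (_ : NormedAddCommGroup K) (_ : InnerProductSpace ℂ K) (_ : CompleteSpace K)
        (M : VonNeumannAlgebra K) (π : (R α).toStarSubalgebra →⋆ₐ[ℂ] M.toStarSubalgebra)
        (w : unitary M.toStarSubalgebra)
        (E : M.toStarSubalgebra →ₗ[ℂ] (R α).toStarSubalgebra),
        IsTorusHNNExtension α θ ED EC M π w E := by
  obtain ⟨θ, ED, EC, hθ, hθu, hED, hEC, h⟩ := exists_hnnExtension α (vN_gnsRep α)
    (subAlg_lineU α) (subAlg_lineV α) (D_le_R α) (C_le_R α)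
  exact ⟨θ, ED, EC, ⟨hθ, Subtype.ext (hθu _ rfl)⟩, hED, hEC, h⟩

end NCTorus
end

/-! ### Faithful normal traces and the space `L²(M, τ)` -/

noncomputable section

/-- The completion of a space with a positive definite inner product. -/
theorem InnerProductSpace.Core.exists_completion.{u} {F : Type u} [AddCommGroup F] [Module ℂ F]
    (c : InnerProductSpace.Core ℂ F) :
    ∃ (L : Type u) (_ : NormedAddCommGroup L) (_ : InnerProductSpace ℂ L) (_ : CompleteSpace L)
      (Λ : F →ₗ[ℂ] L), DenseRange Λ ∧ ∀ x y, ⟪Λ x, Λ y⟫_ℂ = c.inner x y := by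
  let _ : NormedAddCommGroup F := c.toNormedAddCommGroup
  let _ : InnerProductSpace ℂ F := InnerProductSpace.ofCore c.toCore
  refine ⟨UniformSpace.Completion F, inferInstance, inferInstance, inferInstance,
    (UniformSpace.Completion.toComplₗᵢ (𝕜 := ℂ) (E := F)).toLinearMap,
    UniformSpace.Completion.denseRange_coe, fun x y => ?_⟩
  exact UniformSpace.Completion.inner_coe x y

namespace VonNeumannAlgebra

variable {K : Type*} [NormedAddCommGroup K] [InnerProductSpace ℂ K] [CompleteSpace K]
  {M : VonNeumannAlgebra K} {τ : M.toStarSubalgebra →ₗ[ℂ] ℂ}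

namespace IsFaithfulNormalTrace

/-- Polarization: `τ` is real on `(1 + x)*(1 + x)` and on `(1 + ix)*(1 + ix)`, which gives the
imaginary and the real part respectively. -/
theorem apply_star (hτ : IsFaithfulNormalTrace M τ) (x : M.toStarSubalgebra) :
    τ (star x) = star (τ x) := by
  have h1 := (Complex.le_def.mp (hτ.nonneg (1 + x))).2
  have h2 := (Complex.le_def.mp (hτ.nonneg (1 + Complex.I • x))).2
  have h3 := (Complex.le_def.mp (hτ.nonneg x)).2
  simp only [star_add, star_one, star_smul, mul_add, add_mul, one_mul, mul_one, smul_mul_assoc,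
    mul_smul_comm, map_add, map_smul, hτ.map_one, smul_eq_mul] at h1 h2
  simp at h1 h2 h3
  refine Complex.ext ?_ ?_
  · simp; linarith
  · simp; linarith

theorem norm_amp_le {ι : Type*} (x : K →L[ℂ] K) : ‖amp K ι x‖ ≤ ‖x‖ :=
  NonUnitalStarAlgHom.norm_apply_le (amp K ι) x

/-- The Hilbert space `L²(M, τ)`. -/
theorem exists_gns.{v} {K : Type v} [NormedAddCommGroup K] [InnerProductSpace ℂ K]
    [CompleteSpace K] {M : VonNeumannAlgebra K} {τ : M.toStarSubalgebra →ₗ[ℂ] ℂ} (hτ : IsFaithfulNormalTrace M τ) :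
    ∃ (L : Type v) (_ : NormedAddCommGroup L) (_ : InnerProductSpace ℂ L) (_ : CompleteSpace L)
      (Λ : M.toStarSubalgebra →ₗ[ℂ] L), DenseRange Λ ∧
      ∀ x y, ⟪Λ x, Λ y⟫_ℂ = τ (star x * y) := by
  let c : InnerProductSpace.Core ℂ M.toStarSubalgebra :=
    { inner := fun x y => τ (star x * y)
      conj_inner_symm := fun x y => by
        change star (τ (star y * x)) = τ (star x * y)
        rw [← hτ.apply_star, star_mul, star_star]
      re_inner_nonneg := fun x => (Complex.le_def.mp (hτ.nonneg x)).1
      add_left := fun x y z => by rw [star_add, add_mul, map_add]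
      smul_left := fun x y r => by
        rw [star_smul, smul_mul_assoc, map_smul]; rfl
      definite := fun x hx => hτ.faithful x hx }
  exact c.exists_completion

/-- `τ(x*x)` is controlled by the action of `x` on a vector of the amplified space. -/
theorem exists_vector (hτ : IsFaithfulNormalTrace M τ) :
    ∃ d : lp (fun _ : ℕ ⊕ ℕ => K) 2, ∀ x : M.toStarSubalgebra,
      (τ (star x * x)).re ≤ ‖amp K (ℕ ⊕ ℕ) x d‖ ^ 2 := by
  obtain ⟨a, b, h⟩ := isSigmaWeaklyContinuous_iff.mp hτ.normal
  -- The vector `d` is the concatenation of `a` and `b`: by Cauchy-Schwarz `|⟪xa, xb⟫| ≤ ‖xa‖ ‖xb‖`,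
  -- and both factors are at most `‖xd‖`.
  let d : lp (fun _ : ℕ ⊕ ℕ => K) 2 := ⟨Sum.elim a b, (memℓp_two_iff _).mpr
    (Summable.sum _ ((memℓp_two_iff _).mp a.2) ((memℓp_two_iff _).mp b.2))⟩
  refine ⟨d, fun x => ?_⟩
  have hnorm : ∀ {ι : Type} (f : lp (fun _ : ι => K) 2), ‖f‖ ^ 2 = ∑' i, ‖f i‖ ^ 2 := by
    intro ι f
    have := lp.norm_rpow_eq_tsum (p := 2) (by simp) f
    simpa using this
  have hle : ∀ (f : lp (fun _ : ℕ => K) 2) (j : ℕ → ℕ ⊕ ℕ), Function.Injective j →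
      (∀ n, f n = d (j n)) → ‖amp K ℕ x f‖ ≤ ‖amp K (ℕ ⊕ ℕ) x d‖ := by
    intro f j hj hf
    refine le_of_sq_le_sq ?_ (norm_nonneg _)
    rw [hnorm, hnorm]
    have hs := (memℓp_two_iff _).mp (amp K (ℕ ⊕ ℕ) x d).2
    have := tsum_comp_le_tsum_of_inj hs (fun _ => sq_nonneg _) hj
    simpa [hf, Function.comp_def] using this
  have ha := hle a Sum.inl Sum.inl_injective fun _ => rfl
  have hb := hle b Sum.inr Sum.inr_injective fun _ => rfl
  rw [h]
  have e : ⟪a, amp K ℕ (star x * x : M.toStarSubalgebra) b⟫_ℂ =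
      ⟪amp K ℕ x a, amp K ℕ x b⟫_ℂ := by
    change ⟪a, amp K ℕ (star (x : K →L[ℂ] K) * x) b⟫_ℂ = _
    rw [map_mul, map_star, mul_apply_eq_comp, ContinuousLinearMap.star_eq_adjoint,
      ContinuousLinearMap.adjoint_inner_right]
  rw [e, sq]
  refine (Complex.re_le_norm _).trans ((norm_inner_le_norm _ _).trans ?_)
  exact mul_le_mul ha hb (norm_nonneg _) (norm_nonneg _)

theorem exists_norm_le (hτ : IsFaithfulNormalTrace M τ) :
    ∃ C : ℝ, 0 ≤ C ∧ ∀ x : M.toStarSubalgebra, ‖τ x‖ ≤ C * ‖x‖ := by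
  obtain ⟨a, b, h⟩ := isSigmaWeaklyContinuous_iff.mp hτ.normal
  refine ⟨‖a‖ * ‖b‖, by positivity, fun x => ?_⟩
  rw [h, mul_right_comm, mul_assoc]
  refine (norm_inner_le_norm _ _).trans (mul_le_mul_of_nonneg_left ?_ (norm_nonneg _))
  exact (ContinuousLinearMap.le_opNorm _ _).trans
    (mul_le_mul_of_nonneg_right (norm_amp_le _) (norm_nonneg _))

theorem norm2_sq (hτ : IsFaithfulNormalTrace M τ) (x : M.toStarSubalgebra) :
    norm2 M τ x ^ 2 = (τ (star x * x)).re :=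
  Real.sq_sqrt (Complex.le_def.mp (hτ.nonneg x)).1

theorem eq_zero_of_norm2 (hτ : IsFaithfulNormalTrace M τ) {x : M.toStarSubalgebra}
    (hx : norm2 M τ x = 0) : x = 0 := by
  refine hτ.faithful x (Complex.ext ?_ (Complex.le_def.mp (hτ.nonneg x)).2.symm)
  rw [← hτ.norm2_sq, hx]
  simp

end IsFaithfulNormalTrace

end VonNeumannAlgebra
end

/-! ### Fourier masses and the criterion for fullness -/

noncomputable section

namespace VonNeumannAlgebra

variable {K : Type*} [NormedAddCommGroup K] [InnerProductSpace ℂ K] [CompleteSpace K]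
  {M : VonNeumannAlgebra K} {τ : M.toStarSubalgebra →ₗ[ℂ] ℂ} {G : Type*} [Group G]
  {c : Circle →* G} {lam : G →* unitary M.toStarSubalgebra}

/-- `M` with the trace `τ` is generated by a representation `lam` of `G` in which the subgroup
`c` acts by scalars and all other group elements have trace zero. -/
structure IsTracialRep (c : Circle →* G) (M : VonNeumannAlgebra K)
    (τ : M.toStarSubalgebra →ₗ[ℂ] ℂ) (lam : G →* unitary M.toStarSubalgebra) : Prop where
  trace : IsFaithfulNormalTrace M τ
  lam_circle : ∀ z, (lam (c z) : M.toStarSubalgebra) = (z : ℂ) • 1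
  trace_lam : ∀ g, g ∉ c.range → τ (lam g) = 0
  generates : generatedBy (Set.range fun g => ((lam g : M.toStarSubalgebra) : K →L[ℂ] K)) = M

/-- The squared modulus of a Fourier coefficient, as a function on the cosets of the circle. -/
def weight (c : Circle →* G) (τ : M.toStarSubalgebra →ₗ[ℂ] ℂ)
    (lam : G →* unitary M.toStarSubalgebra) (x : M.toStarSubalgebra) (γ : G ⧸ c.range) : ℝ≥0∞ :=
  ‖τ (star (lam γ.out : M.toStarSubalgebra) * x)‖ₑ ^ 2

/-- The mass of the Fourier series of `x` on the set `S`. -/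
def mass (c : Circle →* G) (τ : M.toStarSubalgebra →ₗ[ℂ] ℂ)
    (lam : G →* unitary M.toStarSubalgebra) (S : Set G) (x : M.toStarSubalgebra) : ℝ≥0∞ :=
  ∑' γ : G ⧸ c.range, ((QuotientGroup.mk '' S : Set (G ⧸ c.range)).indicator
    (weight c τ lam x)) γ

theorem norm2_sub_comm (x y : M.toStarSubalgebra) : norm2 M τ (x - y) = norm2 M τ (y - x) := by
  rw [norm2, norm2, ← neg_sub y x, star_neg, neg_mul_neg]

namespace IsTracialRep

variable (h : IsTracialRep c M τ lam)

theorem star_lam (lam : G →* unitary M.toStarSubalgebra) (g : G) :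
    star (lam g : M.toStarSubalgebra) = lam g⁻¹ := by
  rw [map_inv]; rfl

include h in
theorem weight_mk (x : M.toStarSubalgebra) (g : G) :
    weight c τ lam x (QuotientGroup.mk g) = ‖τ (star (lam g : M.toStarSubalgebra) * x)‖ₑ ^ 2 := by
  obtain ⟨⟨_, z, rfl⟩, hz⟩ := QuotientGroup.mk_out_eq_mul c.range g
  have hgz : (lam (g * c z) : M.toStarSubalgebra) = (z : ℂ) • (lam g : M.toStarSubalgebra) := by
    rw [map_mul lam, Submonoid.coe_mul, h.lam_circle, mul_smul_comm, mul_one]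
  rw [weight, hz, hgz, star_smul, smul_mul_assoc, map_smul, smul_eq_mul, enorm_mul]
  have : ‖star (z : ℂ)‖ₑ = 1 := by
    rw [← ofReal_norm, norm_star, Circle.norm_coe, ENNReal.ofReal_one]
  rw [this, one_mul]

-- By `exists_vector` the 2-norm is dominated by the norm of the action on a single vector of the
-- amplified space, where the density theorem gives the approximation.
include h in
theorem dense_span (x : M.toStarSubalgebra) {ε : ℝ} (hε : 0 < ε) :
    ∃ s ∈ Submodule.span ℂ (Set.range fun g => (lam g : M.toStarSubalgebra)),
      norm2 M τ (x - s) < ε := by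
  obtain ⟨d, hd⟩ := h.trace.exists_vector
  let S : Submonoid (K →L[ℂ] K) := MonoidHom.mrange
    (((M.toStarSubalgebra.subtype : M.toStarSubalgebra →* (K →L[ℂ] K)).comp
      (unitary M.toStarSubalgebra).subtype).comp lam)
  have hS : ∀ s ∈ S, star s ∈ S := by
    rintro _ ⟨g, rfl⟩
    exact ⟨g⁻¹, congrArg Subtype.val (star_lam lam g).symm⟩
  have hx : (x : K →L[ℂ] K) ∈ generatedBy (S : Set (K →L[ℂ] K)) := by
    have : (S : Set (K →L[ℂ] K)) = Set.range fun g => ((lam g : M.toStarSubalgebra) : K →L[ℂ] K) :=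
      rfl
    rw [this, h.generates]
    exact x.2
  have hcl := amp_mem_closure S hS hx d
  let Φ : M.toStarSubalgebra →ₗ[ℂ] lp (fun _ : ℕ ⊕ ℕ => K) 2 :=
    { toFun := fun y => amp K (ℕ ⊕ ℕ) y d
      map_add' := fun y z => by simp
      map_smul' := fun a y => by simp }
  have himg : (fun s => amp K (ℕ ⊕ ℕ) s d) '' (S : Set (K →L[ℂ] K)) =
      Φ '' Set.range fun g => (lam g : M.toStarSubalgebra) := by
    ext f
    constructor
    · rintro ⟨_, ⟨g, rfl⟩, rfl⟩
      exact ⟨_, ⟨g, rfl⟩, rfl⟩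
    · rintro ⟨_, ⟨g, rfl⟩, rfl⟩
      exact ⟨_, ⟨g, rfl⟩, rfl⟩
  rw [himg, Submodule.span_image] at hcl
  obtain ⟨_, ⟨s, hs, rfl⟩, hlt⟩ := Metric.mem_closure_iff.mp hcl ε hε
  refine ⟨s, hs, lt_of_le_of_lt (le_of_sq_le_sq ?_ dist_nonneg) hlt⟩
  rw [h.trace.norm2_sq]
  refine (hd _).trans (le_of_eq ?_)
  rw [dist_eq_norm]
  change ‖Φ (x - s)‖ ^ 2 = ‖Φ x - Φ s‖ ^ 2
  rw [map_sub]

include h in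
theorem orthonormal {L : Type*} [NormedAddCommGroup L] [InnerProductSpace ℂ L]
    {Λ : M.toStarSubalgebra →ₗ[ℂ] L} (hΛ : ∀ x y, ⟪Λ x, Λ y⟫_ℂ = τ (star x * y)) :
    Orthonormal ℂ fun γ : G ⧸ c.range => Λ (lam γ.out) := by
  classical
  rw [orthonormal_iff_ite]
  intro γ δ
  rw [hΛ]
  split_ifs with hγ
  · subst hγ
    rw [Unitary.coe_star_mul_self, h.trace.map_one]
  · rw [star_lam, ← Submonoid.coe_mul, ← map_mul]
    refine h.trace_lam _ fun hm => hγ ?_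
    rw [← QuotientGroup.out_eq' γ, ← QuotientGroup.out_eq' δ]
    exact QuotientGroup.eq.mpr hm

include h in
/-- Parseval's identity. -/
theorem tsum_weight (x : M.toStarSubalgebra) :
    ∑' γ, weight c τ lam x γ = ENNReal.ofReal (norm2 M τ x ^ 2) := by
  obtain ⟨L, _, _, _, Λ, hd, hΛ⟩ := h.trace.exists_gns
  have hnorm : ∀ y, ‖Λ y‖ = norm2 M τ y := fun y => by
    rw [norm_eq_sqrt_re_inner (𝕜 := ℂ), hΛ]; rfl
  -- Totality of the orthonormal family: each group element is a phase times its coset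
  -- representative, so `V` contains the image of the linear span of the group, which is dense in
  -- 2-norm.
  set V := (Submodule.span ℂ (Set.range fun γ : G ⧸ c.range =>
    Λ (lam γ.out : M.toStarSubalgebra))).topologicalClosure with hV
  have hlam : ∀ g, Λ (lam g) ∈ V := by
    intro g
    obtain ⟨⟨_, z, rfl⟩, hz⟩ := QuotientGroup.mk_out_eq_mul c.range g
    have : (lam g : M.toStarSubalgebra) = ((z⁻¹ : Circle) : ℂ) •
        (lam (QuotientGroup.mk g : G ⧸ c.range).out : M.toStarSubalgebra) := by
      rw [hz, map_mul, Submonoid.coe_mul, h.lam_circle, mul_smul_comm, mul_one, smul_smul,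
        ← Circle.coe_mul, inv_mul_cancel, Circle.coe_one, one_smul]
    rw [this, map_smul]
    exact V.smul_mem _ (Submodule.le_topologicalClosure _ (Submodule.subset_span ⟨_, rfl⟩))
  have hspan : ∀ s ∈ Submodule.span ℂ (Set.range fun g => (lam g : M.toStarSubalgebra)),
      Λ s ∈ V := by
    intro s hs
    have : Submodule.span ℂ (Set.range fun g => (lam g : M.toStarSubalgebra)) ≤ V.comap Λ := by
      rw [Submodule.span_le]
      rintro _ ⟨g, rfl⟩
      exact hlam g
    exact this hs
  have hcl : IsClosed (V : Set L) := Submodule.isClosed_topologicalClosure _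
  have hΛV : ∀ y, Λ y ∈ V := by
    intro y
    rw [← SetLike.mem_coe, ← hcl.closure_eq, Metric.mem_closure_iff]
    intro ε hε
    obtain ⟨s, hs, hlt⟩ := h.dense_span y hε
    exact ⟨Λ s, hspan s hs, by rwa [dist_eq_norm, ← map_sub, hnorm]⟩
  have htop : ⊤ ≤ V := fun ξ _ => by
    have : closure (Set.range Λ) ⊆ V := hcl.closure_subset_iff.mpr (by
      rintro _ ⟨y, rfl⟩; exact hΛV y)
    exact this (hd ξ)
  let b := HilbertBasis.mk (h.orthonormal hΛ) htop
  have hs := b.hasSum_inner_mul_inner (Λ x) (Λ x)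
  have hs' : HasSum (fun γ : G ⧸ c.range =>
      ‖τ (star (lam γ.out : M.toStarSubalgebra) * x)‖ ^ 2) (norm2 M τ x ^ 2) := by
    rw [← hnorm]
    have h2 := Complex.hasSum_re hs
    have e1 : (⟪Λ x, Λ x⟫_ℂ).re = ‖Λ x‖ ^ 2 := by
      rw [inner_self_eq_norm_sq_to_K]; norm_cast
    rw [e1] at h2
    refine h2.congr_fun fun γ => ?_
    have hb : b γ = Λ (lam γ.out) := congrFun (HilbertBasis.coe_mk _ _) γ
    rw [hb, ← inner_conj_symm, hΛ, RCLike.conj_mul]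
    norm_cast
  rw [← hs'.tsum_eq, ENNReal.ofReal_tsum_of_nonneg (fun _ => sq_nonneg _) hs'.summable]
  refine tsum_congr fun γ => ?_
  rw [weight, ← ofReal_norm, ENNReal.ofReal_pow (norm_nonneg _)]

include h in
theorem mass_le (S : Set G) (x : M.toStarSubalgebra) :
    mass c τ lam S x ≤ ENNReal.ofReal (norm2 M τ x ^ 2) := by
  rw [← h.tsum_weight]
  exact ENNReal.tsum_le_tsum fun γ => Set.indicator_le_self' (fun _ _ => zero_le) γ

theorem mass_mono {S T : Set G} (hST : S ⊆ T) (x : M.toStarSubalgebra) :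
    mass c τ lam S x ≤ mass c τ lam T x :=
  ENNReal.tsum_le_tsum fun γ => Set.indicator_le_indicator_of_subset (Set.image_mono hST)
    (fun _ => zero_le) γ

theorem mass_union_le (S T : Set G) (x : M.toStarSubalgebra) :
    mass c τ lam (S ∪ T) x ≤ mass c τ lam S x + mass c τ lam T x := by
  rw [mass, mass, mass, ← ENNReal.tsum_add]
  refine ENNReal.tsum_le_tsum fun γ => ?_
  rw [Set.image_union, ← Set.indicator_union_add_inter_apply]
  exact le_self_add

/-- The constants come from `|a + b|² ≤ 2|a|² + 2|b|²`; they do no harm, as only convergence of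
masses to zero matters. -/
theorem weight_le (x y : M.toStarSubalgebra) (γ : G ⧸ c.range) :
    weight c τ lam x γ ≤ 2 * weight c τ lam y γ + 2 * weight c τ lam (x - y) γ := by
  have e : star (lam γ.out : M.toStarSubalgebra) * x =
      star (lam γ.out : M.toStarSubalgebra) * y + star (lam γ.out : M.toStarSubalgebra) * (x - y) := by
    rw [← mul_add, add_sub_cancel]
  rw [weight, e, map_add, ← mul_add]
  refine (pow_le_pow_left' (enorm_add_le _ _) 2).trans ?_
  have := ENNReal.rpow_add_le_mul_rpow_add_rpow
    ‖τ (star (lam γ.out : M.toStarSubalgebra) * y)‖ₑ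
    ‖τ (star (lam γ.out : M.toStarSubalgebra) * (x - y))‖ₑ (p := 2) (by norm_num)
  norm_num at this
  exact this

include h in
theorem mass_le_of_sub (S : Set G) (x y : M.toStarSubalgebra) :
    mass c τ lam S x ≤ 2 * mass c τ lam S y + 2 * ENNReal.ofReal (norm2 M τ (x - y) ^ 2) := by
  refine le_trans ?_ (add_le_add_right (mul_le_mul_right (h.mass_le S (x - y)) 2) _)
  rw [mass, mass, mass, ← ENNReal.tsum_mul_left, ← ENNReal.tsum_mul_left, ← ENNReal.tsum_add]
  refine ENNReal.tsum_le_tsum fun γ => ?_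
  by_cases hγ : γ ∈ (QuotientGroup.mk '' S : Set (G ⧸ c.range))
  · simp only [Set.indicator_of_mem hγ]
    exact weight_le x y γ
  · simp [Set.indicator_of_notMem hγ]

-- By traciality the coefficient of `x` at `k g k⁻¹` is that of `λ_k* x λ_k` at `g`, and conjugation
-- by `k` permutes the cosets.
include h in
theorem mass_conj (hc : c.range ≤ Subgroup.center G) (S : Set G) (k : G) (x : M.toStarSubalgebra) :
    mass c τ lam {g | k⁻¹ * g * k ∈ S} x =
      mass c τ lam S (star (lam k : M.toStarSubalgebra) * x * lam k) := by
  have : c.range.Normal := ⟨fun n hn g => by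
    rw [Subgroup.mem_center_iff.mp (hc hn) g, mul_inv_cancel_right]
    exact hn⟩
  rw [mass, mass, ← (MulAut.conj (QuotientGroup.mk k : G ⧸ c.range)).toEquiv.tsum_eq]
  refine tsum_congr fun γ => ?_
  obtain ⟨g, rfl⟩ := QuotientGroup.mk_surjective γ
  change Set.indicator _ _ (QuotientGroup.mk (k * g * k⁻¹) : G ⧸ c.range) = _
  have hmem : (QuotientGroup.mk (k * g * k⁻¹) : G ⧸ c.range) ∈
      (QuotientGroup.mk '' {g | k⁻¹ * g * k ∈ S} : Set (G ⧸ c.range)) ↔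
      (QuotientGroup.mk g : G ⧸ c.range) ∈ (QuotientGroup.mk '' S : Set (G ⧸ c.range)) := by
    constructor
    · rintro ⟨g', hg', he⟩
      refine ⟨_, hg', ?_⟩
      rw [QuotientGroup.mk_mul, QuotientGroup.mk_mul, he, ← QuotientGroup.mk_mul,
        ← QuotientGroup.mk_mul]
      congr 1
      group
    · rintro ⟨g', hg', he⟩
      refine ⟨k * g' * k⁻¹, ?_, ?_⟩
      · change k⁻¹ * (k * g' * k⁻¹) * k ∈ S
        convert hg' using 1
        group
      · rw [QuotientGroup.mk_mul, QuotientGroup.mk_mul, he, ← QuotientGroup.mk_mul,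
          ← QuotientGroup.mk_mul]
  have hw : weight c τ lam x (QuotientGroup.mk (k * g * k⁻¹)) =
      weight c τ lam (star (lam k : M.toStarSubalgebra) * x * lam k) (QuotientGroup.mk g) := by
    rw [h.weight_mk, h.weight_mk, ← mul_assoc, h.trace.tracial _ (lam k : M.toStarSubalgebra)]
    simp only [star_lam, ← mul_assoc, ← Submonoid.coe_mul, ← map_mul]
    simp [mul_assoc]
  by_cases hg : (QuotientGroup.mk g : G ⧸ c.range) ∈ (QuotientGroup.mk '' S : Set (G ⧸ c.range))
  · rw [Set.indicator_of_mem hg, Set.indicator_of_mem (hmem.mpr hg), hw]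
  · rw [Set.indicator_of_notMem hg, Set.indicator_of_notMem (mt hmem.mp hg)]

-- The images in `G ⧸ c.range` are pairwise disjoint, so the masses are disjoint pieces of one
-- Parseval sum.
include h in
theorem sum_mass_le {S : ℕ → Set G} (hS : ∀ i j, i ≠ j → ∀ g ∈ S i, ∀ z, g * c z ∉ S j)
    (N : ℕ) (x : M.toStarSubalgebra) :
    ∑ i ∈ Finset.range N, mass c τ lam (S i) x ≤ ENNReal.ofReal (norm2 M τ x ^ 2) := by
  rw [← h.tsum_weight]
  simp only [mass]
  rw [← Summable.tsum_finsetSum fun _ _ => ENNReal.summable]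
  refine ENNReal.tsum_le_tsum fun γ => ?_
  by_cases hγ : ∃ i ∈ Finset.range N, γ ∈ (QuotientGroup.mk '' S i : Set (G ⧸ c.range))
  · obtain ⟨i, hi, hγ⟩ := hγ
    rw [Finset.sum_eq_single_of_mem i hi]
    · exact Set.indicator_le_self' (fun _ _ => zero_le) γ
    · intro j _ hji
      refine Set.indicator_of_notMem ?_ _
      rintro ⟨g', hg', he⟩
      obtain ⟨g, hg, rfl⟩ := hγ
      obtain ⟨z, hz⟩ := QuotientGroup.eq.mp he
      refine hS j i hji g' hg' z ?_
      rw [hz]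
      simpa using hg
  · rw [Finset.sum_eq_zero]
    · exact zero_le
    · intro i hi
      exact Set.indicator_of_notMem (fun hm => hγ ⟨i, hi, hm⟩) _

include h in
theorem mass_range (x : M.toStarSubalgebra) : mass c τ lam (c.range : Set G) x = ‖τ x‖ₑ ^ 2 := by
  have himg : (QuotientGroup.mk '' (c.range : Set G) : Set (G ⧸ c.range)) =
      {QuotientGroup.mk 1} := by
    ext γ
    constructor
    · rintro ⟨g, hg, rfl⟩
      exact QuotientGroup.eq.mpr (by simpa using hg)
    · rintro rfl
      exact ⟨1, one_mem _, rfl⟩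
  have h1 : ∀ γ : G ⧸ c.range, γ ≠ QuotientGroup.mk 1 →
      ({QuotientGroup.mk 1} : Set (G ⧸ c.range)).indicator (weight c τ lam x) γ = 0 :=
    fun γ hγ => Set.indicator_of_notMem (Set.notMem_singleton_iff.mpr hγ) _
  rw [mass, himg, tsum_eq_single _ h1, Set.indicator_of_mem (Set.mem_singleton _), h.weight_mk,
    map_one, OneMemClass.coe_one, star_one, one_mul]

include h in
/-- If the complement of the circle is null for every invariant family of null sets, then `M` is
full. -/
theorem isFull (hc : c.range ≤ Subgroup.center G)
    (hG : ∀ Null : Set G → Prop, (∀ S T, S ⊆ T → Null T → Null S) →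
      (∀ S T, Null S → Null T → Null (S ∪ T)) →
      (∀ S k, Null S → Null {g | k⁻¹ * g * k ∈ S}) →
      (∀ S : Set G, (∀ g ∈ S, ∀ z, g * c z ∈ S) →
        (∃ k : ℕ → G, ∀ i j, i ≠ j → ∀ g, (k i)⁻¹ * g * k i ∈ S → (k j)⁻¹ * g * k j ∉ S) →
        Null S) → Null {g | g ∉ c.range}) : IsFull M τ := by
  intro ω _ x ⟨C, hC⟩ hx
  obtain ⟨D, hD, hτ⟩ := h.trace.exists_norm_le
  -- The limiting scalar is the ultralimit of the bounded sequence of traces.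
  obtain ⟨a, -, ha⟩ := (isCompact_closedBall (0 : ℂ) (D * C)).ultrafilter_le_nhds
    (ω.map fun n => τ (x n)) (by
      rw [Filter.le_principal_iff]
      change ∀ᶠ n in (ω : Filter ℕ), τ (x n) ∈ Metric.closedBall (0 : ℂ) (D * C)
      refine Filter.Eventually.of_forall fun n => ?_
      rw [mem_closedBall_zero_iff]
      exact (hτ _).trans (mul_le_mul_of_nonneg_left (hC n) hD))
  have ha : Filter.Tendsto (fun n => τ (x n)) ω (nhds a) := ha
  refine ⟨a, ?_⟩
  set y : ℕ → M.toStarSubalgebra := fun n => x n - a • 1 with hy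
  set B : ℝ := D * (C + ‖a • (1 : M.toStarSubalgebra)‖) ^ 2 with hB
  have hyB : ∀ n, norm2 M τ (y n) ^ 2 ≤ B := by
    intro n
    rw [h.trace.norm2_sq]
    refine (Complex.re_le_norm _).trans ((hτ _).trans (mul_le_mul_of_nonneg_left ?_ hD))
    rw [CStarRing.norm_star_mul_self, ← sq]
    exact pow_le_pow_left₀ (norm_nonneg _) ((norm_sub_le _ _).trans (add_le_add_left (hC n) _)) 2
  set δ : G → ℕ → ℝ≥0∞ := fun k n => ENNReal.ofReal
    (norm2 M τ (star (lam k : M.toStarSubalgebra) * y n * lam k - y n) ^ 2) with hδ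
  -- The expression under the norm is `λ_k* (x λ_k - λ_k x)`: the scalar drops out, and the unitary
  -- on the left does not affect the 2-norm.
  have hδ0 : ∀ k, Filter.Tendsto (δ k) ω (nhds 0) := by
    intro k
    have h1 := ENNReal.tendsto_ofReal ((hx (lam k)).pow 2)
    rw [zero_pow two_ne_zero, ENNReal.ofReal_zero] at h1
    refine h1.congr fun n => ?_
    simp only [hδ]
    rw [h.trace.norm2_sq, h.trace.norm2_sq]
    have e : star (lam k : M.toStarSubalgebra) * y n * lam k - y n =
        star (lam k : M.toStarSubalgebra) * (x n * lam k - lam k * x n) := by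
      have hk : star (lam k : M.toStarSubalgebra) * lam k = 1 := Unitary.coe_star_mul_self _
      simp only [hy, mul_sub, sub_mul, mul_smul_comm, smul_mul_assoc, mul_one, hk, ← mul_assoc,
        one_mul]
      abel
    have hk : (lam k : M.toStarSubalgebra) * star (lam k : M.toStarSubalgebra) = 1 :=
      Unitary.coe_mul_star_self _
    rw [e, star_mul, star_star, mul_assoc, ← mul_assoc (lam k : M.toStarSubalgebra), hk, one_mul]
  have hzero : ∀ {f g : ℕ → ℝ≥0∞}, Filter.Tendsto g ω (nhds 0) → (∀ n, f n ≤ g n) →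
      Filter.Tendsto f ω (nhds 0) := fun hg hfg =>
    tendsto_of_tendsto_of_tendsto_of_le_of_le tendsto_const_nhds hg (fun _ => zero_le) hfg
  have hadd : ∀ {f g : ℕ → ℝ≥0∞}, Filter.Tendsto f ω (nhds 0) → Filter.Tendsto g ω (nhds 0) →
      Filter.Tendsto (fun n => 2 * f n + 2 * g n) ω (nhds 0) := by
    intro f g hf hg
    have := (ENNReal.Tendsto.const_mul (a := 2) hf (Or.inr (by simp))).add
      (ENNReal.Tendsto.const_mul (a := 2) hg (Or.inr (by simp)))
    simpa using this
  have hnull : Filter.Tendsto (fun n => mass c τ lam {g | g ∉ c.range} (y n)) ω (nhds 0) := by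
    -- A set counts as null when the mass of `y n` on it tends to zero along `ω`. Invariance under
    -- conjugation is asymptotic commutation with `lam k`.
    refine hG (fun S => Filter.Tendsto (fun n => mass c τ lam S (y n)) ω (nhds 0))
      (fun S T hST hT => hzero hT fun n => mass_mono hST _)
      (fun S T hS hT => ?_) (fun S k hS => ?_) (fun S hS hk => ?_)
    · have := hS.add hT
      rw [add_zero] at this
      exact hzero this fun n => mass_union_le S T _
    · refine hzero (hadd hS (hδ0 k)) fun n => ?_
      rw [h.mass_conj hc]
      exact h.mass_le_of_sub S _ _
    · obtain ⟨k, hk⟩ := hk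
      rw [ENNReal.tendsto_nhds_zero]
      intro ε hε
      -- If `S` had mass above `ε`, its first `N` conjugates would force `N ε ≤ 2B + 1`: being
      -- disjoint they have total mass at most `B`, and the `1` absorbs the commutation errors once
      -- `n` is far enough along `ω`.
      obtain ⟨N, hN⟩ := ENNReal.exists_nat_mul_gt (a := ε) (b := 2 * ENNReal.ofReal B + 1)
        hε.ne' (by finiteness)
      have hsum : Filter.Tendsto (fun n => 2 * ∑ i ∈ Finset.range N, δ (k i) n) ω (nhds 0) := by
        have := ENNReal.Tendsto.const_mul (a := 2) (tendsto_finsetSum (Finset.range N)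
          fun i _ => hδ0 (k i)) (Or.inr (by simp))
        simpa using this
      filter_upwards [hsum.eventually (ge_mem_nhds one_pos)] with n hn
      by_contra! hlt
      refine absurd hN (not_lt.mpr ?_)
      calc (N : ℝ≥0∞) * ε ≤ N * mass c τ lam S (y n) := by gcongr
        _ = ∑ i ∈ Finset.range N, mass c τ lam S (y n) := by simp
        _ ≤ ∑ i ∈ Finset.range N, (2 * mass c τ lam {g | (k i)⁻¹ * g * k i ∈ S} (y n) +
              2 * δ (k i) n) := by
            refine Finset.sum_le_sum fun i _ => ?_
            rw [h.mass_conj hc]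
            simp only [hδ]
            rw [norm2_sub_comm]
            exact h.mass_le_of_sub S _ _
        _ = 2 * ∑ i ∈ Finset.range N, mass c τ lam {g | (k i)⁻¹ * g * k i ∈ S} (y n) +
              2 * ∑ i ∈ Finset.range N, δ (k i) n := by
            rw [Finset.sum_add_distrib, Finset.mul_sum, Finset.mul_sum]
        _ ≤ 2 * ENNReal.ofReal B + 1 := by
            refine add_le_add (mul_le_mul_right ((h.sum_mass_le ?_ N (y n)).trans
              (ENNReal.ofReal_le_ofReal (hyB n))) 2) hn
            intro i j hij g hg z hgz
            refine hk i j hij (g * c z) ?_ hgz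
            have := hS _ hg z
            have hz := Subgroup.mem_center_iff.mp (hc ⟨z, rfl⟩)
            rwa [mul_assoc, hz, ← mul_assoc, mul_assoc _ g] at this
  have hτ0 : Filter.Tendsto (fun n => ‖τ (y n)‖ₑ ^ 2) ω (nhds 0) := by
    have h1 : Filter.Tendsto (fun n => τ (y n)) ω (nhds 0) := by
      have := ha.sub_const a
      rw [sub_self] at this
      refine this.congr fun n => ?_
      rw [hy, map_sub, map_smul, h.trace.map_one, smul_eq_mul, mul_one]
    have h2 := ENNReal.Tendsto.pow (n := 2) h1.enorm
    simpa using h2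
  -- Parseval again: the mass on the circle is `|τ(y n)|²`, and the rest is null.
  have htot : Filter.Tendsto (fun n => ENNReal.ofReal (norm2 M τ (y n) ^ 2)) ω (nhds 0) := by
    have := hτ0.add hnull
    rw [add_zero] at this
    refine hzero this fun n => ?_
    rw [← h.tsum_weight, ← h.mass_range]
    refine le_trans (le_of_eq ?_) (mass_union_le _ _ _)
    have : ((c.range : Set G) ∪ {g | g ∉ c.range}) = Set.univ := Set.union_compl_self _
    rw [this, mass, Set.image_univ, (QuotientGroup.mk_surjective).range_eq, Set.indicator_univ]
  have h3 := (ENNReal.tendsto_toReal ENNReal.zero_ne_top).comp htot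
  have h4 := h3.sqrt
  simp only [ENNReal.toReal_zero, Real.sqrt_zero] at h4
  refine h4.congr fun n => ?_
  simp only [Function.comp_apply]
  rw [ENNReal.toReal_ofReal (sq_nonneg _)]
  exact Real.sqrt_sq (Real.sqrt_nonneg _)

include h in
theorem not_finiteDimensional [Infinite (G ⧸ c.range)] :
    ¬ FiniteDimensional ℂ M.toStarSubalgebra := by
  intro hfin
  obtain ⟨L, _, _, _, Λ, -, hΛ⟩ := h.trace.exists_gns
  have hli : LinearIndependent ℂ fun γ : G ⧸ c.range => (lam γ.out : M.toStarSubalgebra) :=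
    LinearIndependent.of_comp Λ (h.orthonormal hΛ).linearIndependent
  exact not_finite_iff_infinite.mpr inferInstance hli.finite

end IsTracialRep

/-- A central element is an asymptotically central constant sequence, and the hyperfilter supplies a
free ultrafilter. -/
theorem IsFull.isFactor (h : IsFull M τ) (hτ : IsFaithfulNormalTrace M τ) : IsFactor M := by
  intro x hx hx'
  obtain ⟨a, ha⟩ := h (Filter.hyperfilter ℕ) Filter.hyperfilter_le_cofinite (fun _ => ⟨x, hx⟩)
    ⟨_, fun _ => le_rfl⟩ (fun y => by
      have : (⟨x, hx⟩ * y - y * ⟨x, hx⟩ : M.toStarSubalgebra) = 0 :=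
        sub_eq_zero.mpr (Subtype.ext (mem_commutant_iff.mp hx' y y.2).symm)
      simp only [this, norm2, mul_zero, map_zero, Complex.zero_re, Real.sqrt_zero]
      exact tendsto_const_nhds)
  have := hτ.eq_zero_of_norm2 (tendsto_nhds_unique tendsto_const_nhds ha)
  exact ⟨a, congrArg Subtype.val (sub_eq_zero.mp this)⟩

end VonNeumannAlgebra
end

/-! ### Group elements under the trace preserving expectations and under `θ_α` -/

noncomputable section

open VonNeumannAlgebra HNNExtension

namespace VonNeumannAlgebra

variable {K : Type*} [NormedAddCommGroup K] [InnerProductSpace ℂ K] [CompleteSpace K]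
  {G : Type*} [Group G]

/-- A unitary representation in a von Neumann algebra. -/
def unitaryCodRestrict (M : VonNeumannAlgebra K) (f : G →* unitary (K →L[ℂ] K))
    (hf : ∀ g, (f g : K →L[ℂ] K) ∈ M) : G →* unitary M.toStarSubalgebra where
  toFun g := ⟨⟨f g, hf g⟩, Unitary.mem_iff.mpr
    ⟨Subtype.ext (Unitary.coe_star_mul_self (f g)), Subtype.ext (Unitary.coe_mul_star_self (f g))⟩⟩
  map_one' := Subtype.ext (Subtype.ext (by simp))
  map_mul' g h := Subtype.ext (Subtype.ext (by simp))

variable {M : VonNeumannAlgebra K} {τ : M.toStarSubalgebra →ₗ[ℂ] ℂ}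

/-- A normal functional which is tracial on a generating group is tracial. -/
theorem IsSigmaWeaklyContinuous.tracial {lam : G →* unitary M.toStarSubalgebra}
    (hτ : IsSigmaWeaklyContinuous M τ)
    (hM : generatedBy (Set.range fun g => ((lam g : M.toStarSubalgebra) : K →L[ℂ] K)) = M)
    (h : ∀ g g', τ (lam (g * g')) = τ (lam (g' * g))) (x y : M.toStarSubalgebra) :
    τ (x * y) = τ (y * x) := by
  let S : Submonoid (K →L[ℂ] K) := MonoidHom.mrange
    (((M.toStarSubalgebra.subtype : M.toStarSubalgebra →* (K →L[ℂ] K)).comp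
      (unitary M.toStarSubalgebra).subtype).comp lam)
  have hS : ∀ s ∈ S, star s ∈ S := by
    rintro _ ⟨g, rfl⟩
    exact ⟨g⁻¹, congrArg Subtype.val (IsTracialRep.star_lam lam g).symm⟩
  have hl : ∀ a : M.toStarSubalgebra, IsSigmaWeaklyContinuous M fun x => τ (a * x) := fun a => by
    simpa using hτ.mul_mul a 1
  have hr : ∀ a : M.toStarSubalgebra, IsSigmaWeaklyContinuous M fun x => τ (x * a) := fun a => by
    simpa using hτ.mul_mul 1 a
  refine (hr y).ext_of_generatedBy (hl y) S hS hM (fun s hs => ?_) x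
  obtain ⟨g, hg⟩ := hs
  have hg : s = lam g := Subtype.ext hg.symm
  refine (hl s).ext_of_generatedBy (hr s) S hS hM (fun s' hs' => ?_) y
  obtain ⟨g', hg'⟩ := hs'
  have hg' : s' = lam g' := Subtype.ext hg'.symm
  rw [hg, hg', ← Submonoid.coe_mul, ← Submonoid.coe_mul, ← map_mul, ← map_mul, h]

/-- A positive operator whose vector state vanishes at a vector annihilates it. -/
theorem apply_eq_zero_of_isPositive {T : K →L[ℂ] K} (hT : T.IsPositive) {ξ : K}
    (h : ⟪ξ, T ξ⟫_ℂ = 0) : T ξ = 0 := by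
  rw [← ContinuousLinearMap.nonneg_iff_isPositive, CStarAlgebra.nonneg_iff_eq_star_mul_self] at hT
  obtain ⟨S, rfl⟩ := hT
  rw [mul_apply_eq_comp, ContinuousLinearMap.star_eq_adjoint,
    ContinuousLinearMap.adjoint_inner_right, inner_self_eq_zero] at h
  rw [mul_apply_eq_comp, h, map_zero]

end VonNeumannAlgebra

namespace NCTorus

variable (α : ℝ)

theorem gnsHom_mem (x : Heis α) : (gnsHom α x : GNSSpace α →L[ℂ] GNSSpace α) ∈ R α := by
  rw [← vN_gnsRep]
  exact (gnsRep α).lam_mem_vN x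

/-- The Heisenberg group in `R`. -/
def lamR : Heis α →* unitary (R α).toStarSubalgebra :=
  unitaryCodRestrict (R α) (gnsHom α) (gnsHom_mem α)

variable {α}

theorem traceR_lamR {x : Heis α} (hx : x ∉ (Heis.circle α).range) : traceR α (lamR α x) = 0 :=
  (gnsRep α).inner_vac x hx

theorem lamR_circle (z : Circle) :
    (lamR α (Heis.circle α z) : (R α).toStarSubalgebra) = (z : ℂ) • 1 :=
  Subtype.ext ((gnsRep α).lam_circle z)

/-- The trace preserving conditional expectation onto the subalgebra of a subgroup vanishes on the
other group elements. -/
theorem IsTracePreservingCondExp.apply_lamR {B : VonNeumannAlgebra (GNSSpace α)}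
    {hB : B.toStarSubalgebra ≤ (R α).toStarSubalgebra}
    {E : (R α).toStarSubalgebra →ₗ[ℂ] B.toStarSubalgebra}
    (hE : IsTracePreservingCondExp α B hB E) {j : Heis.Line →* Heis α}
    (hj : RegularRep.Inclusion.subAlg j (gnsRep α) = B)
    (hjc : ∀ z, j (Heis.lineCircle z) = Heis.circle α z) {x : Heis α} (hx : x ∉ j.range) :
    E (lamR α x) = 0 := by
  set y := E (lamR α x) with hy
  refine Subtype.ext ?_
  have hyR : (y : GNSSpace α →L[ℂ] GNSSpace α) ∈ (gnsRep α).vN := by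
    rw [vN_gnsRep]; exact hB y.2
  refine ((gnsRep α).eq_zero_iff_inner_e Heis.circle_central hyR).mpr fun g => ?_
  have hmul : ∀ {g : Heis α}, g ∈ j.range → ∀ z, g * Heis.circle α z ∈ j.range := by
    rintro _ ⟨k, rfl⟩ z
    exact ⟨k * Heis.lineCircle z, by rw [map_mul, hjc]⟩
  -- At a point `g` of the subgroup the coefficient is `τ(λ_{g⁻¹ x})`, by bimodularity and trace
  -- preservation, and `g⁻¹ x` is off the circle. At other points it vanishes because `y` lies in
  -- `B`, so that `y` applied to the vacuum lies in the closed span of the subgroup orbit.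
  by_cases hg : g ∈ j.range
  · obtain ⟨k, rfl⟩ := hg
    have hk : (gnsHom α (j k⁻¹) : GNSSpace α →L[ℂ] GNSSpace α) ∈ B := by
      rw [← hj]; exact subset_generatedBy _ ⟨k⁻¹, rfl⟩
    let b : B.toStarSubalgebra := ⟨_, hk⟩
    have h1 := hE.1.bimodule b (lamR α x) 1
    have h2 := hE.2 (lamR α (j k⁻¹ * x))
    have h3 : StarSubalgebra.inclusion hB b * (lamR α x : (R α).toStarSubalgebra) *
        StarSubalgebra.inclusion hB 1 = lamR α (j k⁻¹ * x) := by
      rw [map_one, mul_one, map_mul]; rfl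
    have h4 : j k⁻¹ * x ∉ (Heis.circle α).range := by
      rintro ⟨z, hz⟩
      refine hx ?_
      have : x = j k * Heis.circle α z := by rw [hz, map_inv, mul_inv_cancel_left]
      rw [this]
      exact hmul ⟨k, rfl⟩ z
    rw [traceR_lamR h4, ← h3, h1, mul_one] at h2
    have h5 : ⟪(gnsRep α).e (j k), (y : GNSSpace α →L[ℂ] GNSSpace α) (gnsRep α).vac⟫_ℂ =
        ⟪(gnsRep α).vac, ((gnsRep α).lam (j k)⁻¹ : GNSSpace α →L[ℂ] GNSSpace α)
          ((y : GNSSpace α →L[ℂ] GNSSpace α) (gnsRep α).vac)⟫_ℂ := by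
      rw [(gnsRep α).inner_lam_right, inv_inv]; rfl
    rw [h5, ← map_inv]
    exact h2
  · have hy' : (y : GNSSpace α →L[ℂ] GNSSpace α) ∈
        generatedBy (RegularRep.Inclusion.subOps j (gnsRep α) :
          Set (GNSSpace α →L[ℂ] GNSSpace α)) := by
      change _ ∈ RegularRep.Inclusion.subAlg j (gnsRep α)
      rw [hj]; exact y.2
    have hcl := apply_mem_closure _ RegularRep.Inclusion.star_mem_subOps hy' (gnsRep α).vac
    rw [← Submodule.mem_orthogonal_singleton_iff_inner_right]
    refine Submodule.topologicalClosure_minimal _ ?_ (Submodule.isClosed_orthogonal _) hcl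
    rw [Submodule.span_le]
    rintro _ ⟨_, ⟨k, rfl⟩, rfl⟩
    rw [SetLike.mem_coe, Submodule.mem_orthogonal_singleton_iff_inner_right]
    change ⟪(gnsRep α).e g, (gnsRep α).e (j k)⟫_ℂ = 0
    refine (gnsRep α).inner_e_eq_zero ?_
    rintro ⟨z, hz⟩
    refine hg ?_
    have : g = j k * Heis.circle α z⁻¹ := by rw [map_inv, hz]; group
    rw [this]
    exact hmul ⟨k, rfl⟩ _

theorem Heis.line_hom_ext {𝒰 : Type*} [Group 𝒰] {f g : Heis.Line →* 𝒰}
    (h1 : f (1, Multiplicative.ofAdd 1) = g (1, Multiplicative.ofAdd 1))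
    (h2 : ∀ z, f (z, 1) = g (z, 1)) : f = g := by
  refine MonoidHom.ext fun k => ?_
  have hk : k = ((k.1, 1) : Heis.Line) * ((1, Multiplicative.ofAdd 1) : Heis.Line) ^ k.2.toAdd := by
    refine Prod.ext ?_ ?_
    · simp
    · simp [← ofAdd_zsmul]
  rw [hk, map_mul, map_mul, map_zpow, map_zpow, h1, h2]

/-- Only the value at `u_α` is prescribed; multiplicativity and linearity carry it to all `z uᵏ`,
and no more is needed to obtain the relation of the group `HNN α`. -/
theorem IsTheta.apply_line {θ : (D α).toStarSubalgebra ≃⋆ₐ[ℂ] (C α).toStarSubalgebra}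
    (hθ : IsTheta α θ) (k : Heis.Line) :
    ∃ d : (D α).toStarSubalgebra,
      StarSubalgebra.inclusion (D_le_R α) d = lamR α (Heis.lineU α k) ∧
      StarSubalgebra.inclusion (C_le_R α) (θ d) = lamR α (Heis.lineV α k) := by
  let lamD : Heis.Line →* unitary (D α).toStarSubalgebra :=
    unitaryCodRestrict (D α) ((gnsHom α).comp (Heis.lineU α)) fun k => by
      rw [← subAlg_lineU]; exact subset_generatedBy _ ⟨k, rfl⟩
  let lamC : Heis.Line →* unitary (C α).toStarSubalgebra :=
    unitaryCodRestrict (C α) ((gnsHom α).comp (Heis.lineV α)) fun k => by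
      rw [← subAlg_lineV]; exact subset_generatedBy _ ⟨k, rfl⟩
  have hD1 : (lamD (1, Multiplicative.ofAdd 1) : (D α).toStarSubalgebra) = uD α := by
    refine Subtype.ext ?_
    change _ = gns α (u α)
    rw [← torusRep_u]; rfl
  have hC1 : (lamC (1, Multiplicative.ofAdd 1) : (C α).toStarSubalgebra) = vC α := by
    refine Subtype.ext ?_
    change _ = gns α (v α)
    rw [← torusRep_v]; rfl
  have hDz : ∀ z : Circle, (lamD (z, 1) : (D α).toStarSubalgebra) = (z : ℂ) • 1 := fun z =>
    Subtype.ext ((gnsRep α).lam_circle z)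
  have hCz : ∀ z : Circle, (lamC (z, 1) : (C α).toStarSubalgebra) = (z : ℂ) • 1 := fun z =>
    Subtype.ext ((gnsRep α).lam_circle z)
  let Θ := unitaryMap (θ : (D α).toStarSubalgebra →⋆ₐ[ℂ] (C α).toStarSubalgebra)
  have h1 : Θ (lamD (1, Multiplicative.ofAdd 1)) = lamC (1, Multiplicative.ofAdd 1) := by
    refine Subtype.ext ?_
    change θ (lamD (1, Multiplicative.ofAdd 1) : (D α).toStarSubalgebra) = _
    rw [hD1, hθ.2, hC1]
  have h2 : ∀ z : Circle, Θ (lamD (z, 1)) = lamC (z, 1) := by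
    intro z
    refine Subtype.ext ?_
    change θ (lamD (z, 1) : (D α).toStarSubalgebra) = _
    rw [hDz, hCz, map_smul, map_one]
  have h3 : Θ.comp lamD = lamC := Heis.line_hom_ext h1 h2
  refine ⟨lamD k, rfl, ?_⟩
  have h4 : θ (lamD k : (D α).toStarSubalgebra) = lamC k :=
    congrArg Subtype.val (DFunLike.congr_fun h3 k)
  rw [h4]
  rfl

end NCTorus
end

/-! ### Every HNN extension is a tracial representation of the group `HNN α` -/

noncomputable section

open VonNeumannAlgebra HNNExtension

namespace NCTorus

section Group

variable (α : ℝ)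

/-- The homomorphism counting the exponent of `t`. -/
def tDegree : HNN α →* Multiplicative ℤ :=
  HNNExtension.lift 1 (Multiplicative.ofAdd 1) fun _ => by simp

/-- The exponent sum of `t` is trivial on the circle. -/
theorem t_zpow_notMem {n : ℤ} (hn : n ≠ 0) : (t : HNN α) ^ n ∉ (hnnCircle α).range := by
  rintro ⟨z, hz⟩
  have h := congrArg (tDegree α) hz
  rw [hnnCircle_apply, map_zpow, tDegree, HNNExtension.lift_of, HNNExtension.lift_t] at h
  refine hn ?_
  have h2 := congrArg Multiplicative.toAdd h
  simpa using h2.symm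

theorem mem_circle_of_ofH {x : Heis α} (hx : ofH α x ∈ (hnnCircle α).range) :
    x ∈ (Heis.circle α).range := by
  obtain ⟨z, hz⟩ := hx
  exact ⟨z, HNNExtension.of_injective (swap α) hz⟩

theorem v_zpow_notMem {n : ℤ} (hn : n ≠ 0) :
    ofH α (Heis.lineV α (1, Multiplicative.ofAdd 1)) ^ n ∉ (hnnCircle α).range := by
  intro h
  rw [← map_zpow, ← map_zpow] at h
  have h2 := (Heis.mem_range_circle.mp (mem_circle_of_ofH α h)).2
  refine hn ?_
  simpa [Heis.lineV, ← ofAdd_zsmul] using h2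

instance : Infinite (HNN α ⧸ (hnnCircle α).range) := by
  refine Infinite.of_injective (fun n : ℤ => (QuotientGroup.mk ((t : HNN α) ^ n) :
    HNN α ⧸ (hnnCircle α).range)) fun m n h => ?_
  by_contra hmn
  have h1 := QuotientGroup.eq.mp h
  rw [← zpow_neg, ← zpow_add] at h1
  exact t_zpow_notMem α (by omega) h1

theorem notMem_hnnCircle (g : HNN α) :
    g ∉ (hnnCircle α).range ↔ ∀ z ∈ subV α ⊓ subU α, g ≠ ofH α z := by
  constructor
  · rintro hg z ⟨hz1, hz2⟩ rfl
    obtain ⟨a, ha⟩ := Heis.mem_range_circle.mpr ⟨hz1, hz2⟩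
    exact hg ⟨a, by rw [hnnCircle_apply, ha]⟩
  · rintro hg ⟨z, rfl⟩
    exact hg (Heis.circle α z) ⟨rfl, rfl⟩ rfl

theorem null_compl_circle (Null : Set (HNN α) → Prop) (mono : ∀ S T, S ⊆ T → Null T → Null S)
    (union : ∀ S T, Null S → Null T → Null (S ∪ T))
    (conj : ∀ S k, Null S → Null {g | k⁻¹ * g * k ∈ S})
    (disj : ∀ S : Set (HNN α), (∀ g ∈ S, ∀ z, g * hnnCircle α z ∈ S) →
      (∃ k : ℕ → HNN α, ∀ i j, i ≠ j → ∀ g, (k i)⁻¹ * g * k i ∈ S → (k j)⁻¹ * g * k j ∉ S) →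
      Null S) : Null {g | g ∉ (hnnCircle α).range} := by
  simp only [notMem_hnnCircle]
  refine null_compl_inf mono union conj (fun S hS hk => disj S (fun g hg z => ?_) hk) ?_ ?_ ?_
  · exact hS g hg (Heis.circle α z) ⟨rfl, rfl⟩
  · rintro z ⟨hz1, hz2⟩
    obtain ⟨a, rfl⟩ := Heis.mem_range_circle.mpr ⟨hz1, hz2⟩
    exact hnnCircle_central α ⟨a, rfl⟩
  -- Infinite index: the powers of `u` lie in distinct cosets of `subV`, and those of `v`, below, in
  -- distinct cosets of `subU`.
  · refine ⟨fun i => ⟨1, i, 0⟩, fun i j hij h => hij ?_⟩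
    have : -(i : ℤ) + j = 0 := h
    omega
  · refine ⟨fun i => ⟨1, 0, i⟩, fun i j hij h => hij ?_⟩
    have : -(i : ℤ) + j = 0 := h
    omega

/-- The group is generated by the circle, `t` and `v`. -/
theorem subgroup_eq_top {P : Subgroup (HNN α)} (hc : (hnnCircle α).range ≤ P) (ht : t ∈ P)
    (hv : ofH α (Heis.lineV α (1, Multiplicative.ofAdd 1)) ∈ P) (g : HNN α) : g ∈ P := by
  induction g using HNNExtension.induction_on with
  | of x =>
    have hx : x = Heis.circle α x.z * Heis.lineU α (1, Multiplicative.ofAdd 1) ^ x.m *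
        Heis.lineV α (1, Multiplicative.ofAdd 1) ^ x.n := by
      rw [← map_zpow, ← map_zpow]
      ext1 <;> simp [Heis.mul_def, Heis.circle, Heis.lineU, Heis.lineV, ← ofAdd_zsmul]
    rw [hx, map_mul, map_mul, map_zpow, map_zpow]
    refine mul_mem (mul_mem (hc ⟨x.z, rfl⟩) (zpow_mem ?_ _)) (zpow_mem hv _)
    rw [← t_lineV]
    exact mul_mem (mul_mem ht hv) (inv_mem ht)
  | t => exact ht
  | mul x y hx hy => exact mul_mem hx hy
  | inv x hx => exact inv_mem hx

end Group

namespace IsTorusHNNExtension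

variable {α : ℝ} {θ : (D α).toStarSubalgebra ≃⋆ₐ[ℂ] (C α).toStarSubalgebra}
  {ED : (R α).toStarSubalgebra →ₗ[ℂ] (D α).toStarSubalgebra}
  {EC : (R α).toStarSubalgebra →ₗ[ℂ] (C α).toStarSubalgebra}
  {K : Type*} [NormedAddCommGroup K] [InnerProductSpace ℂ K] [CompleteSpace K]
  {M : VonNeumannAlgebra K} {π : (R α).toStarSubalgebra →⋆ₐ[ℂ] M.toStarSubalgebra}
  {w : unitary M.toStarSubalgebra} {E : M.toStarSubalgebra →ₗ[ℂ] (R α).toStarSubalgebra}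

theorem stable_mul (h : IsTorusHNNExtension α θ ED EC M π w E) (hθ : IsTheta α θ) (a : subV α) :
    w * unitaryMap π (lamR α a) = unitaryMap π (lamR α (swap α a)) * w := by
  obtain ⟨k, hk⟩ := mem_range_lineV α a.2
  obtain ⟨d, hd1, hd2⟩ := hθ.apply_line k
  have hsw : (swap α a : Heis α) = Heis.lineU α k := by
    have : a = ⟨Heis.lineV α k, rfl⟩ := Subtype.ext hk.symm
    rw [this]; rfl
  have hconj := h.conj d
  rw [hd1, hd2] at hconj
  rw [← hk, hsw, ← mul_inv_eq_iff_eq_mul]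
  exact Subtype.ext hconj

/-- The group `HNN α` in the HNN extension. -/
def lamM (h : IsTorusHNNExtension α θ ED EC M π w E) (hθ : IsTheta α θ) :
    HNN α →* unitary M.toStarSubalgebra :=
  HNNExtension.lift ((unitaryMap π).comp (lamR α)) w (stable_mul h hθ)

variable (h : IsTorusHNNExtension α θ ED EC M π w E) (hθ : IsTheta α θ)

theorem lamM_of (x : Heis α) : (lamM h hθ (ofH α x) : M.toStarSubalgebra) = π (lamR α x) := by
  rw [lamM, HNNExtension.lift_of]; rfl

theorem lamM_t : lamM h hθ t = w := by
  rw [lamM, HNNExtension.lift_t]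

theorem lamM_circle (z : Circle) :
    (lamM h hθ (hnnCircle α z) : M.toStarSubalgebra) = (z : ℂ) • 1 := by
  rw [hnnCircle_apply, lamM_of, lamR_circle, map_smul, map_one]

theorem signPow_eq (ε : Bool) : signPow w ε = lamM h hθ (tPow (swap α) ε) := by
  cases ε
  · change star (w : M.toStarSubalgebra) = lamM h hθ t⁻¹
    rw [map_inv, lamM_t]; rfl
  · change (w : M.toStarSubalgebra) = lamM h hθ t
    rw [lamM_t]

/-- A letter `n` outside an associated subgroup satisfies the corresponding expectation condition,
because the expectation kills `λ_n` (`apply_lamR`). Hence reducedness in the group gives reducedness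
in the algebra. -/
theorem exists_hnnWord (hED : IsTracePreservingCondExp α (D α) (D_le_R α) ED)
    (hEC : IsTracePreservingCondExp α (C α) (C_le_R α) EC) {ε δ : Bool} {k : HNN α}
    (hk : IsTWord (swap α) ε δ k) :
    ∃ l, IsReducedWord ED EC ε l ∧ hnnWord π w ε l = lamM h hθ k := by
  induction hk with
  | base ε => exact ⟨[], trivial, signPow_eq h hθ ε⟩
  | @cons ε ε' δ n g hn hg ih =>
    obtain ⟨l, hl, he⟩ := ih
    refine ⟨(lamR α n, ε') :: l, ⟨fun h1 h2 => ?_, fun h1 h2 => ?_, hl⟩, ?_⟩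
    · refine hEC.apply_lamR (subAlg_lineV α) Heis.lineV_circle ?_
      rintro ⟨k, rfl⟩
      exact hn.1 h1 h2 rfl
    · refine hED.apply_lamR (subAlg_lineU α) Heis.lineU_circle ?_
      rintro ⟨k, rfl⟩
      exact hn.2 h1 h2 rfl
    · change signPow w ε * π (lamR α n) * hnnWord π w ε' l = _
      rw [he, map_mul, map_mul, Submonoid.coe_mul, Submonoid.coe_mul, lamM_of, signPow_eq h hθ]

/-- A group element outside `H` is `n k m` with `k` a reduced word and `n`, `m` in `H`; the bimodule
property pulls `n` and `m` out of `E`, and the moment condition kills `k`. On `H` the value is the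
trace of `R`. -/
theorem trace_lamM (hED : IsTracePreservingCondExp α (D α) (D_le_R α) ED)
    (hEC : IsTracePreservingCondExp α (C α) (C_le_R α) EC) {g : HNN α}
    (hg : g ∉ (hnnCircle α).range) : (traceR α ∘ₗ E) (lamM h hθ g) = 0 := by
  rw [LinearMap.comp_apply]
  rcases mem_range_or_isProper g with ⟨x, rfl⟩ | ⟨ε, δ, k, n, m, hk, rfl⟩
  · rw [lamM_of, h.condExp.map_embedding]
    refine traceR_lamR ?_
    rintro ⟨z, rfl⟩
    exact hg ⟨z, rfl⟩
  · obtain ⟨l, hl, he⟩ := exists_hnnWord h hθ hED hEC hk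
    rw [map_mul, map_mul, Submonoid.coe_mul, Submonoid.coe_mul, lamM_of, lamM_of,
      h.condExp.bimodule, ← he, h.moment ε l hl, mul_zero, zero_mul, map_zero]

/-- Normality of `π` is essential: `R` is generated only weakly by its group elements, and `π` has
to carry this into `M`. -/
theorem generatedBy_lamM :
    generatedBy (Set.range fun g => ((lamM h hθ g : M.toStarSubalgebra) : K →L[ℂ] K)) = M := by
  refine le_antisymm (generatedBy_le ?_) ?_
  · rintro _ ⟨g, rfl⟩
    exact (lamM h hθ g : M.toStarSubalgebra).2
  · conv_lhs => rw [← h.generates]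
    refine generatedBy_le ?_
    rintro _ (rfl | ⟨n, rfl⟩)
    · exact subset_generatedBy _ ⟨t, by simp only [lamM_t]⟩
    · rw [SetLike.mem_coe, mem_generatedBy_iff]
      intro y hy
      refine clm_ext_inner fun ξ η => ?_
      have h1 := h.normal (star y ξ) η
      have h2 := h.normal ξ (y η)
      have h3 : ∀ T : K →L[ℂ] K, ⟪star y ξ, T η⟫_ℂ = ⟪ξ, (y * T) η⟫_ℂ := fun T => by
        rw [ContinuousLinearMap.star_eq_adjoint, ContinuousLinearMap.adjoint_inner_left,
          mul_apply_eq_comp]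
      simp only [h3] at h1
      refine h1.ext_of_generatedBy h2 (gnsRep α).ops (gnsRep α).star_mem_ops (vN_gnsRep α) ?_ n
      rintro s ⟨x, hx⟩
      have hs : s = lamR α x := Subtype.ext hx.symm
      have := (hy _ ⟨ofH α x, rfl⟩).1
      simp only [lamM_of] at this
      rw [hs, ← this]
      rfl

-- Faithfulness combines that of `E` with the separating vacuum of `R`. By normality traciality need
-- only be checked on group elements: `g * g'` and `g' * g` are conjugate, so they are equal if one
-- lies in the central circle, and otherwise both have trace zero.
include h hθ in
theorem isFaithfulNormalTrace (hED : IsTracePreservingCondExp α (D α) (D_le_R α) ED)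
    (hEC : IsTracePreservingCondExp α (C α) (C_le_R α) EC) :
    IsFaithfulNormalTrace M (traceR α ∘ₗ E) := by
  have hn : IsSigmaWeaklyContinuous M (traceR α ∘ₗ E) :=
    h.condExp.normal (cyclicVector α) (cyclicVector α)
  refine ⟨?_, fun x => (h.condExp.positive x).inner_nonneg_right _, fun x hx => ?_,
    hn.tracial (generatedBy_lamM h hθ) fun g g' => ?_, hn⟩
  · have h2 := h.condExp.map_embedding 1
    rw [map_one] at h2
    rw [LinearMap.comp_apply, h2]
    have := (gnsRep α).inner_vac_circle 1
    rw [map_one, (gnsRep α).e_one] at this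
    exact this
  · refine h.condExp.faithful x (Subtype.ext ?_)
    refine (gnsRep α).eq_zero_of_apply_vac Heis.circle_central ?_
      (apply_eq_zero_of_isPositive (h.condExp.positive x) hx)
    rw [vN_gnsRep]
    exact (E (star x * x)).2
  · by_cases hg : g * g' ∈ (hnnCircle α).range
    · have hc := Subgroup.mem_center_iff.mp (hnnCircle_central α hg) g
      rw [mul_assoc, mul_left_cancel_iff] at hc
      rw [hc]
    · rw [trace_lamM h hθ hED hEC hg, trace_lamM h hθ hED hEC]
      rintro ⟨z, hz⟩
      refine hg ⟨z, ?_⟩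
      have hc := Subgroup.mem_center_iff.mp (hnnCircle_central α ⟨z, rfl⟩) g
      have he : g * g' = g * (g' * g) * g⁻¹ := by group
      rw [he, ← hz, hc, mul_inv_cancel_right]

theorem isTracialRep (hED : IsTracePreservingCondExp α (D α) (D_le_R α) ED)
    (hEC : IsTracePreservingCondExp α (C α) (C_le_R α) EC) :
    IsTracialRep (hnnCircle α) M (traceR α ∘ₗ E) (lamM h hθ) where
  trace := isFaithfulNormalTrace h hθ hED hEC
  lam_circle := lamM_circle h hθ
  trace_lam _ := trace_lamM h hθ hED hEC
  generates := generatedBy_lamM h hθ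

theorem isHaarUnitary_lamM (hED : IsTracePreservingCondExp α (D α) (D_le_R α) ED)
    (hEC : IsTracePreservingCondExp α (C α) (C_le_R α) EC) {g : HNN α}
    (hg : ∀ n : ℤ, n ≠ 0 → g ^ n ∉ (hnnCircle α).range) :
    IsHaarUnitary M (traceR α ∘ₗ E) (lamM h hθ g) := by
  intro n hn
  rw [← map_zpow]
  exact trace_lamM h hθ hED hEC (hg n hn)

theorem generatedBy_pair :
    generatedBy {((lamM h hθ t : M.toStarSubalgebra) : K →L[ℂ] K),
      ((lamM h hθ (ofH α (Heis.lineV α (1, Multiplicative.ofAdd 1))) : M.toStarSubalgebra) :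
        K →L[ℂ] K)} = M := by
  set N := generatedBy {((lamM h hθ t : M.toStarSubalgebra) : K →L[ℂ] K),
      ((lamM h hθ (ofH α (Heis.lineV α (1, Multiplicative.ofAdd 1))) : M.toStarSubalgebra) :
        K →L[ℂ] K)} with hN
  refine le_antisymm (generatedBy_le ?_) ?_
  · rintro _ (rfl | rfl)
    · exact (lamM h hθ _ : M.toStarSubalgebra).2
    · exact (lamM h hθ _ : M.toStarSubalgebra).2
  · conv_lhs => rw [← generatedBy_lamM h hθ]
    refine generatedBy_le ?_
    let P : Subgroup (HNN α) :=
      { carrier := {g | ((lamM h hθ g : M.toStarSubalgebra) : K →L[ℂ] K) ∈ N}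
        one_mem' := by
          change ((lamM h hθ 1 : M.toStarSubalgebra) : K →L[ℂ] K) ∈ N
          rw [map_one]; exact one_mem N
        mul_mem' := fun {g g'} hg hg' => by
          change ((lamM h hθ (g * g') : M.toStarSubalgebra) : K →L[ℂ] K) ∈ N
          rw [map_mul]; exact mul_mem hg hg'
        inv_mem' := fun {g} hg => by
          change ((lamM h hθ g⁻¹ : M.toStarSubalgebra) : K →L[ℂ] K) ∈ N
          rw [← IsTracialRep.star_lam]
          exact star_mem (S := VonNeumannAlgebra K) hg }
    rintro _ ⟨g, rfl⟩
    refine subgroup_eq_top α (P := P) ?_ ?_ ?_ g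
    · rintro _ ⟨z, rfl⟩
      change ((lamM h hθ (hnnCircle α z) : M.toStarSubalgebra) : K →L[ℂ] K) ∈ N
      rw [lamM_circle]
      exact smul_mem_vN N (one_mem N) _
    · exact subset_generatedBy _ (Or.inl rfl)
    · exact subset_generatedBy _ (Or.inr rfl)

end IsTorusHNNExtension

end NCTorus
end

/-! ### The main theorem -/

theorem mainTheorem11 (α : ℝ) (hα₀ : 0 ≤ α) (hα₁ : α < 1) (hα : Irrational α) :
    (∃ (θ : (NCTorus.D α).toStarSubalgebra ≃⋆ₐ[ℂ] (NCTorus.C α).toStarSubalgebra)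
        (ED : (NCTorus.R α).toStarSubalgebra →ₗ[ℂ] (NCTorus.D α).toStarSubalgebra)
        (EC : (NCTorus.R α).toStarSubalgebra →ₗ[ℂ] (NCTorus.C α).toStarSubalgebra),
      NCTorus.IsTheta α θ ∧
      NCTorus.IsTracePreservingCondExp α (NCTorus.D α) (NCTorus.D_le_R α) ED ∧
      NCTorus.IsTracePreservingCondExp α (NCTorus.C α) (NCTorus.C_le_R α) EC ∧
      ∃ (K : Type) (_ : NormedAddCommGroup K) (_ : InnerProductSpace ℂ K) (_ : CompleteSpace K)
        (M : VonNeumannAlgebra K)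
        (π : (NCTorus.R α).toStarSubalgebra →⋆ₐ[ℂ] M.toStarSubalgebra)
        (w : unitary M.toStarSubalgebra)
        (E : M.toStarSubalgebra →ₗ[ℂ] (NCTorus.R α).toStarSubalgebra),
        NCTorus.IsTorusHNNExtension α θ ED EC M π w E) ∧
    ∀ (θ : (NCTorus.D α).toStarSubalgebra ≃⋆ₐ[ℂ] (NCTorus.C α).toStarSubalgebra)
      (ED : (NCTorus.R α).toStarSubalgebra →ₗ[ℂ] (NCTorus.D α).toStarSubalgebra)
      (EC : (NCTorus.R α).toStarSubalgebra →ₗ[ℂ] (NCTorus.C α).toStarSubalgebra),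
      NCTorus.IsTheta α θ →
      NCTorus.IsTracePreservingCondExp α (NCTorus.D α) (NCTorus.D_le_R α) ED →
      NCTorus.IsTracePreservingCondExp α (NCTorus.C α) (NCTorus.C_le_R α) EC →
      ∀ (K : Type*) [NormedAddCommGroup K] [InnerProductSpace ℂ K] [CompleteSpace K]
        (M : VonNeumannAlgebra K)
        (π : (NCTorus.R α).toStarSubalgebra →⋆ₐ[ℂ] M.toStarSubalgebra)
        (w : unitary M.toStarSubalgebra)
        (E : M.toStarSubalgebra →ₗ[ℂ] (NCTorus.R α).toStarSubalgebra),
        NCTorus.IsTorusHNNExtension α θ ED EC M π w E →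
        M.IsTypeII1Factor ∧
        M.IsFaithfulNormalTrace (NCTorus.traceR α ∘ₗ E) ∧
        M.IsFull (NCTorus.traceR α ∘ₗ E) ∧
        ∃ a b : unitary M.toStarSubalgebra,
          M.IsHaarUnitary (NCTorus.traceR α ∘ₗ E) a ∧
          M.IsHaarUnitary (NCTorus.traceR α ∘ₗ E) b ∧
          VonNeumannAlgebra.generatedBy
            {((a : M.toStarSubalgebra) : K →L[ℂ] K), ((b : M.toStarSubalgebra) : K →L[ℂ] K)} = M
    := by
  refine ⟨NCTorus.exists_torusHNNExtension α, ?_⟩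
  intro θ ED EC hθ hED hEC K _ _ _ M π w E h
  have hrep := NCTorus.IsTorusHNNExtension.isTracialRep h hθ hED hEC
  have hfull := hrep.isFull (NCTorus.hnnCircle_central α) (NCTorus.null_compl_circle α)
  exact ⟨⟨hfull.isFactor hrep.trace, hrep.not_finiteDimensional, _, hrep.trace⟩, hrep.trace, hfull,
    _, _,
    NCTorus.IsTorusHNNExtension.isHaarUnitary_lamM h hθ hED hEC
      fun _ => NCTorus.t_zpow_notMem α,
    NCTorus.IsTorusHNNExtension.isHaarUnitary_lamM h hθ hED hEC
      fun _ => NCTorus.v_zpow_notMem α,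
    NCTorus.IsTorusHNNExtension.generatedBy_pair h hθ⟩
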